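/- Let $n\ge 1$ be odd, write $\mathbb R^{1+n}_+=\{(t,x)\in\mathbb R\times\mathbb R^n:\ t>0\}$ and $\square=\partial_t^2-\Delta_x$. Let $2<q\le \frac{2(n+1)}{n-1}$ (to be read as $2<q<\infty$ if $n=1$), and let $\alpha,\beta,\gamma$ be real numbers with $$\beta<\frac1q,\qquad \alpha+\beta+\gamma=\frac2q,\qquad \gamma=(n-1)\Bigl(\frac12-\frac1q\Bigr).$$ Then there is a constant $C<\infty$, depending only on $n,q,\alpha,\beta$, such that the following holds. Let $F$ be real-valued, spherically symmetric ($F(t,x)$ depends only on $t$ and $|x|$) and supported in the forward light cone $\{|x|\le t\}$, and let $w$ be a weak solution of $$\square w=F\ \text{ in }\mathbb R^{1+n}_+,\qquad w(0,\cdot)=\partial_tw(0,\cdot)=0,$$ that is, $w$ and $F$ are locally integrable on $[0,\infty)\times\mathbb R^n$ and $$\int_{\mathbb R^{1+n}_+}w\,\square\varphi\,dt\,dx=\int_{\mathbb R^{1+n}_+}F\,\varphi\,dt\,dx\qquad\text{for all }\varphi\in C_c^\infty(\mathbb R^{1+n}).$$ Then $$\bigl\|(t^2-|x|^2)^{-\alpha}w\bigr\|_{L^q(\mathbb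 R^{1+n}_+)}\le C\,\bigl\|(t^2-|x|^2)^{\beta}F\bigr\|_{L^{q/(q-1)}(\mathbb R^{1+n}_+)}.$$ -/

import Mathlib

open MeasureTheory Set
open scoped ENNReal NNReal ContDiff

/-- Space-time `ℝ × ℝⁿ`, with points `z = (t, x)`, where `ℝⁿ` carries the Euclidean norm. -/
abbrev SpaceTime (n : ℕ) : Type := ℝ × EuclideanSpace ℝ (Fin n)

/-- The open upper half-space `{(t, x) : 0 < t}`. -/
def upperHalf (n : ℕ) : Set (SpaceTime n) := {z | 0 < z.1}

/-- The D'Alembertian `∂²φ/∂t² - Δₓ φ` of a (smooth) function on space-time. -/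
noncomputable def dAlembertian {n : ℕ} (φ : SpaceTime n → ℝ) (z : SpaceTime n) : ℝ :=
  iteratedDeriv 2 (fun s : ℝ => φ (s, z.2)) z.1
    - Laplacian.laplacian (fun y : EuclideanSpace ℝ (Fin n) => φ (z.1, y)) z.2

/-- `w` is the weak solution of `□ w = F` in `{0 < t}` with zero Cauchy data
`w(0, ·) = ∂ₜ w(0, ·) = 0`. Both functions are locally integrable up to the boundary `t = 0`, and
the equation is tested against smooth compactly supported functions on the whole of space-time.
The test functions need not vanish near `t = 0`, and this is what encodes the zero Cauchy data. -/
structure IsWeakSolution {n : ℕ} (w F : SpaceTime n → ℝ) : Prop where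
  locallyIntegrable : LocallyIntegrableOn w {z : SpaceTime n | 0 ≤ z.1} volume
  locallyIntegrable_source : LocallyIntegrableOn F {z : SpaceTime n | 0 ≤ z.1} volume
  integral_eq : ∀ φ : SpaceTime n → ℝ, ContDiff ℝ ∞ φ → HasCompactSupport φ →
    ∫ z in upperHalf n, w z * dAlembertian φ z = ∫ z in upperHalf n, F z * φ z

/-- `F(t, x)` depends only on `t` and `|x|` for `t > 0`. -/
def SphericallySymmetric {n : ℕ} (F : SpaceTime n → ℝ) : Prop :=
  ∀ (t : ℝ) (x y : EuclideanSpace ℝ (Fin n)), 0 < t → ‖x‖ = ‖y‖ → F (t, x) = F (t, y)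

/-- In `{0 < t}`, the function `F` vanishes outside the forward light cone `{|x| ≤ t}`. -/
def SupportedInForwardCone {n : ℕ} (F : SpaceTime n → ℝ) : Prop :=
  ∀ (t : ℝ) (x : EuclideanSpace ℝ (Fin n)), 0 < t → t < ‖x‖ → F (t, x) = 0

/-- The weighted norm `‖(t² - |x|²)^a f‖` in `L^p({0 < t})`, with values in `[0, ∞]`. It is used
for functions that vanish (almost everywhere) outside the forward light cone, so that the value of
the power at a negative base plays no role. -/
noncomputable def weightedNorm {n : ℕ} (a p : ℝ) (f : SpaceTime n → ℝ) : ℝ≥0∞ :=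
  eLpNorm (fun z : SpaceTime n => (z.1 ^ 2 - ‖z.2‖ ^ 2) ^ a * f z) (ENNReal.ofReal p)
    (volume.restrict (upperHalf n))

/-! Write n = 2k+1, r = |x|, and use null coordinates u = t - r, v = t + r, so that t² - |x|² = uv.
For radial solutions W = r^k w satisfies ∂ᵤ∂ᵥW + k(k-1)/(v-u)² W = r^k F/4. The Riemann function of
this operator is a polynomial in a variable that stays in [0,1] on the domain of influence, so it is
bounded. Hence |w| at (u,v) is at most a constant times r^{-k} ∫ s^k |F(a,b)| da db, where s =
(b-a)/2 and the integral runs over 0 < a < u < b < v if k ≥ 1. If k = 0, reflection in the axis adds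
the sources with b < u.

The estimate. For k ≥ 1 the condition u < b forces (u-a)(v-b) ≤ 4rs. The powers r^γ s^γ left over
from the radial densities can therefore be traded for (u-a)^{-γ}(v-b)^{-γ}; this is the role of γ =
k(1-2/q), which vanishes when k = 0 (`influence_kernel_le`). The kernel is then dominated by a
product of two copies, in (u,a) and in (v,b), of the one-sided Stein–Weiss kernel
x^{-α}y^{-β}(x-y)^{-γ}, 0 < y < x. In logarithmic variables such a copy is dominated by the
one-sided Riesz kernel of order 2/q: near the diagonal because γ ≤ 2/q, which is the upper bound on
q, and far from it because β < 1/q (`steinWeiss_exp_le`). The Riesz kernel falls under a weak-type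
Hardy–Littlewood–Sobolev inequality (`lintegral_kernel_le`). For nonnegative kernels the tensor
product costs nothing, and duality turns the bilinear bound `lintegral_conePotential_bilinear` into
the norm bound `lintegral_conePotential_le`.

The identification of w. A weak solution is assumed neither radial nor regular, so the
representation is proved on the dual side. The spherical means of a test function φ are smooth and
satisfy the Euler–Poisson–Darboux equation, and Riemann's method expresses them through the means of
□φ in the future (`riemann_rectangle`, `wave_representation`, `nullMean_representation`). Fubini
transposes this formula and shows that the explicit potential of F is a weak solution
(`integral_radialSolution_mul`, `integral_coneSolution_mul_dAlembertian`); its local integrability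
comes from the same bilinear bound when the right-hand norm is finite, and otherwise there is
nothing to prove. The time-reversed formula also gives uniqueness (`weak_uniqueness`): a mollified
difference of two solutions is a smooth solution of the homogeneous equation that vanishes in the
past, so its spherical means, and with them its value at the origin, are zero. -/

/-! ### Hardy–Littlewood–Sobolev inequality for kernels of weak type -/

theorem lintegral_Ioi_ite_ofReal_lt (c : ℝ≥0∞) :
    ∫⁻ a in Ioi (0 : ℝ), (if ENNReal.ofReal a < c then (1 : ℝ≥0∞) else 0) = c := by
  have h1 : ∀ a : ℝ, (if ENNReal.ofReal a < c then (1 : ℝ≥0∞) else 0)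
      = {a : ℝ | ENNReal.ofReal a < c}.indicator 1 a := by
    intro a; simp [indicator]
  have hm : MeasurableSet {a : ℝ | ENNReal.ofReal a < c} :=
    measurableSet_lt ENNReal.measurable_ofReal measurable_const
  simp_rw [h1]
  rw [lintegral_indicator_one hm, Measure.restrict_apply hm]
  rcases eq_or_ne c ⊤ with rfl | hc
  · have : {a : ℝ | ENNReal.ofReal a < ⊤} ∩ Ioi 0 = Ioi 0 := by ext; simp
    rw [this]; simp
  · have : {a : ℝ | ENNReal.ofReal a < c} ∩ Ioi 0 = Ioo 0 c.toReal := by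
      ext a
      simp only [mem_inter_iff, mem_ofPred_eq, mem_Ioi, mem_Ioo]
      constructor
      · rintro ⟨h, h0⟩
        exact ⟨h0, (ENNReal.ofReal_lt_iff_lt_toReal h0.le hc).1 h⟩
      · rintro ⟨h0, h⟩
        exact ⟨(ENNReal.ofReal_lt_iff_lt_toReal h0.le hc).2 h, h0⟩
    rw [this, Real.volume_Ioo, sub_zero, ENNReal.ofReal_toReal hc]

section Kernel

variable {X : Type*} [MeasurableSpace X] (μ : Measure X)

/-- The layer-cake formula has a factor p in front of this integral, and p ≥ 1 lets it be dropped.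
The `p`-th power bound makes `f` finite almost everywhere, so the real-valued formula applies to
`toReal`. -/
theorem lintegral_meas_lt_mul_rpow_le {p : ℝ} (hp : 1 ≤ p) {f : X → ℝ≥0∞} (hf : Measurable f)
    (h1 : ∫⁻ x, f x ^ p ∂μ ≤ 1) :
    ∫⁻ a in Ioi (0 : ℝ), μ {x | ENNReal.ofReal a < f x} * ENNReal.ofReal (a ^ (p - 1)) ≤ 1 := by
  have hp0 : 0 < p := by linarith
  have hfin : ∀ᵐ x ∂μ, f x < ⊤ := by
    have := ae_lt_top (hf.pow_const p) (ne_top_of_le_ne_top ENNReal.one_ne_top h1)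
    filter_upwards [this] with x hx
    by_contra h
    rw [not_lt, top_le_iff] at h
    rw [h, ENNReal.top_rpow_of_pos hp0] at hx
    exact lt_irrefl _ hx
  have key := lintegral_rpow_eq_lintegral_meas_lt_mul μ (f := fun x => (f x).toReal)
    (ae_of_all _ fun x => ENNReal.toReal_nonneg) hf.ennreal_toReal.aemeasurable hp0
  have e1 : ∫⁻ x, ENNReal.ofReal ((f x).toReal ^ p) ∂μ = ∫⁻ x, f x ^ p ∂μ := by
    apply lintegral_congr_ae
    filter_upwards [hfin] with x hx
    rw [← ENNReal.ofReal_rpow_of_nonneg ENNReal.toReal_nonneg hp0.le, ENNReal.ofReal_toReal hx.ne]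
  have e2 : ∀ a ∈ Ioi (0 : ℝ), μ {x | ENNReal.ofReal a < f x} * ENNReal.ofReal (a ^ (p - 1))
      = μ {x | a < (f x).toReal} * ENNReal.ofReal (a ^ (p - 1)) := by
    intro a ha
    congr 1
    apply measure_congr
    filter_upwards [hfin] with x hx
    exact propext (ENNReal.ofReal_lt_iff_lt_toReal (le_of_lt ha) hx.ne)
  rw [setLIntegral_congr_fun measurableSet_Ioi e2]
  rw [e1] at key
  calc _ ≤ ENNReal.ofReal p * ∫⁻ a in Ioi (0 : ℝ), μ {x | a < (f x).toReal} *
        ENNReal.ofReal (a ^ (p - 1)) := by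
        refine le_mul_of_one_le_left zero_le ?_
        rw [← ENNReal.ofReal_one]; exact ENNReal.ofReal_le_ofReal hp
    _ ≤ 1 := by rw [← key]; exact h1

theorem lintegral_Ioc_rpow_neg {θ : ℝ} (hθ : θ < 1) {a : ℝ} (ha : 0 < a) :
    ∫⁻ b in Ioc 0 a, ENNReal.ofReal (b ^ (-θ)) = ENNReal.ofReal (a ^ (1 - θ) / (1 - θ)) := by
  have hi : IntervalIntegrable (fun x : ℝ => x ^ (-θ)) volume 0 a :=
    intervalIntegral.intervalIntegrable_rpow' (by linarith)
  rw [← ofReal_integral_eq_lintegral_ofReal hi.1, ← intervalIntegral.integral_of_le ha.le,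
    integral_rpow (Or.inl (by linarith))]
  · rw [Real.zero_rpow (by linarith : -θ + 1 ≠ 0), sub_zero]
    congr 2 <;> ring_nf
  · filter_upwards [ae_restrict_mem measurableSet_Ioc] with x hx
    exact Real.rpow_nonneg hx.1.le _

/-- Hölder bound for `∫₀ᵃ B^{1-l}` when `∫ B b^{p-1} ≤ 1` and `p = 2/(2-l)`. -/
theorem lintegral_Ioc_rpow_one_sub_le {l : ℝ} (hl0 : 0 < l) (hl1 : l < 1) {B : ℝ → ℝ≥0∞}
    (hB : Measurable B)
    (h1 : ∫⁻ b in Ioi (0 : ℝ), B b * ENNReal.ofReal (b ^ (2 / (2 - l) - 1)) ≤ 1)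
    {a : ℝ} (ha : 0 < a) :
    ∫⁻ b in Ioc 0 a, B b ^ (1 - l) ≤ ENNReal.ofReal ((2 - l) ^ l * a ^ (2 / (2 - l) - 1)) := by
  have h2l : 0 < 2 - l := by linarith
  have h1l : 0 < 1 - l := by linarith
  set s := 2 / (2 - l) - 1 with hs
  have hs' : s = l / (2 - l) := by rw [hs]; field_simp; ring
  have hs0 : 0 < s := by rw [hs']; positivity
  -- The weight b^m is chosen so that the power 1/(1-l) of B^{1-l} b^m is exactly B b^{p-1}. The
  -- conjugate factor b^{-m/l} is integrable at 0 since m/l = (1-l)/(2-l) < 1.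
  set m := s * (1 - l) with hm
  have hconj : (1 / (1 - l)).HolderConjugate (1 / l) := by
    rw [Real.holderConjugate_iff]
    constructor
    · rw [one_lt_div h1l]; linarith
    · simp
  have hmeas : Measurable fun b : ℝ => ENNReal.ofReal (b ^ m) := by fun_prop
  have hmeas' : Measurable fun b : ℝ => ENNReal.ofReal (b ^ (-m)) := by fun_prop
  have H := ENNReal.lintegral_mul_le_Lp_mul_Lq (volume.restrict (Ioc 0 a)) hconj
    (f := fun b => B b ^ (1 - l) * ENNReal.ofReal (b ^ m)) (g := fun b => ENNReal.ofReal (b ^ (-m)))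
    ((hB.pow_const _).mul hmeas).aemeasurable hmeas'.aemeasurable
  have e0 : ∫⁻ b in Ioc 0 a, B b ^ (1 - l) = ∫⁻ b in Ioc 0 a,
      ((fun b => B b ^ (1 - l) * ENNReal.ofReal (b ^ m)) * fun b => ENNReal.ofReal (b ^ (-m))) b := by
    apply setLIntegral_congr_fun measurableSet_Ioc
    intro b hb
    simp only [Pi.mul_apply]
    rw [mul_assoc, ← ENNReal.ofReal_mul (Real.rpow_nonneg hb.1.le _), ← Real.rpow_add hb.1]
    simp
  have e1 : ∫⁻ b in Ioc 0 a, (B b ^ (1 - l) * ENNReal.ofReal (b ^ m)) ^ (1 / (1 - l)) ≤ 1 := by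
    refine le_trans ?_ h1
    refine le_trans (le_of_eq ?_) (lintegral_mono_set (show Ioc 0 a ⊆ Ioi 0 from Ioc_subset_Ioi_self))
    apply setLIntegral_congr_fun measurableSet_Ioc
    intro b hb
    simp only
    rw [ENNReal.mul_rpow_of_nonneg _ _ (by positivity), ← ENNReal.rpow_mul,
      mul_one_div_cancel h1l.ne', ENNReal.rpow_one,
      ENNReal.ofReal_rpow_of_nonneg (Real.rpow_nonneg hb.1.le _) (by positivity),
      ← Real.rpow_mul hb.1.le, hm]
    congr 3; field_simp
  have hθ : m * (1 / l) < 1 := by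
    rw [hm, hs', mul_one_div, div_lt_one hl0, div_mul_eq_mul_div, div_lt_iff₀ h2l]; nlinarith
  have e2 : ∫⁻ b in Ioc 0 a, (ENNReal.ofReal (b ^ (-m))) ^ (1 / l)
      = ENNReal.ofReal (a ^ (1 - m * (1 / l)) / (1 - m * (1 / l))) := by
    rw [← lintegral_Ioc_rpow_neg hθ ha]
    apply setLIntegral_congr_fun measurableSet_Ioc
    intro b hb
    simp only
    rw [ENNReal.ofReal_rpow_of_nonneg (Real.rpow_nonneg hb.1.le _) (by positivity),
      ← Real.rpow_mul hb.1.le]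
    congr 2; ring
  rw [e0]
  refine H.trans ?_
  rw [e2, one_div_one_div, one_div_one_div]
  have hv : 1 - m * (1 / l) = 1 / (2 - l) := by
    rw [hm, hs']; field_simp; ring
  rw [hv]
  calc _ ≤ (1 : ℝ≥0∞) * ENNReal.ofReal (a ^ (1 / (2 - l)) / (1 / (2 - l))) ^ l := by
        gcongr
        exact ENNReal.rpow_le_one e1 h1l.le
    _ = _ := by
        rw [one_mul, ENNReal.ofReal_rpow_of_nonneg (by positivity) hl0.le]
        congr 1
        rw [div_div_eq_mul_div, div_one, Real.mul_rpow (by positivity) h2l.le,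
          ← Real.rpow_mul ha.le, hs', mul_comm]
        congr 2; ring

/-- Layer-cake proof of the diagonal Hardy–Littlewood–Sobolev inequality, normalized. -/
theorem lintegral_kernel_le_of_norm_le_one [SFinite μ] {l : ℝ} (hl0 : 0 < l) (hl1 : l < 1)
    {K : X → X → ℝ≥0∞} (hK : Measurable (Function.uncurry K)) (D : ℝ≥0∞)
    (hK1 : ∀ x, ∀ E, MeasurableSet E → ∫⁻ y in E, K x y ∂μ ≤ D * μ E ^ (1 - l))
    (hK2 : ∀ y, ∀ E, MeasurableSet E → ∫⁻ x in E, K x y ∂μ ≤ D * μ E ^ (1 - l))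
    {f g : X → ℝ≥0∞} (hf : Measurable f) (hg : Measurable g)
    (hf1 : ∫⁻ x, f x ^ (2 / (2 - l)) ∂μ ≤ 1) (hg1 : ∫⁻ x, g x ^ (2 / (2 - l)) ∂μ ≤ 1) :
    ∫⁻ x, ∫⁻ y, f x * K x y * g y ∂μ ∂μ ≤ 2 * D * ENNReal.ofReal ((2 - l) ^ l) := by
  have h2l : 0 < 2 - l := by linarith
  have hp : 1 ≤ 2 / (2 - l) := by rw [le_div_iff₀ h2l]; linarith
  have hS : ∀ f : X → ℝ≥0∞, Measurable f →
      Measurable fun z : ℝ × X => (if ENNReal.ofReal z.1 < f z.2 then (1 : ℝ≥0∞) else 0) := by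
    intro f hf
    refine Measurable.ite (measurableSet_lt ?_ ?_) measurable_const measurable_const <;> fun_prop
  set χ : (X → ℝ≥0∞) → ℝ → X → ℝ≥0∞ :=
    fun f a x => if ENNReal.ofReal a < f x then (1 : ℝ≥0∞) else 0 with hχ
  have hχm : ∀ f : X → ℝ≥0∞, Measurable f → Measurable (Function.uncurry (χ f)) := fun f hf => hS f hf
  have hset : ∀ f : X → ℝ≥0∞, Measurable f → ∀ a : ℝ, MeasurableSet {x | ENNReal.ofReal a < f x} :=
    fun f hf a => measurableSet_lt measurable_const hf
  set A : (X → ℝ≥0∞) → ℝ → ℝ≥0∞ := fun f a => μ {x | ENNReal.ofReal a < f x} with hA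
  have hAm : ∀ f : X → ℝ≥0∞, Measurable (A f) := by
    intro f
    have : Antitone (A f) := by
      intro a b hab
      exact measure_mono fun x hx => lt_of_le_of_lt (ENNReal.ofReal_le_ofReal hab) hx
    exact this.measurable
  set J : ℝ → ℝ → ℝ≥0∞ := fun a b => ∫⁻ x, ∫⁻ y, χ f a x * K x y * χ g b y ∂μ ∂μ with hJ
  have hm4 : Measurable fun z : (ℝ × ℝ) × X × X => χ f z.1.1 z.2.1 * K z.2.1 z.2.2 * χ g z.1.2 z.2.2 := by
    have h1 : Measurable fun z : (ℝ × ℝ) × X × X => χ f z.1.1 z.2.1 :=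
      (hχm f hf).comp (f := fun z : (ℝ × ℝ) × X × X => (z.1.1, z.2.1)) (by fun_prop)
    have h2 : Measurable fun z : (ℝ × ℝ) × X × X => χ g z.1.2 z.2.2 :=
      (hχm g hg).comp (f := fun z : (ℝ × ℝ) × X × X => (z.1.2, z.2.2)) (by fun_prop)
    have h3 : Measurable fun z : (ℝ × ℝ) × X × X => K z.2.1 z.2.2 :=
      hK.comp (f := fun z : (ℝ × ℝ) × X × X => (z.2.1, z.2.2)) (by fun_prop)
    exact (h1.mul h3).mul h2
  have hJm : Measurable (Function.uncurry J) := by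
    have : Function.uncurry J = fun w : ℝ × ℝ => ∫⁻ z : X × X, χ f w.1 z.1 * K z.1 z.2 * χ g w.2 z.2 ∂(μ.prod μ) := by
      ext ⟨a, b⟩
      simp only [Function.uncurry, hJ]
      rw [lintegral_prod]
      have : Measurable fun z : X × X => χ f a z.1 * K z.1 z.2 * χ g b z.2 :=
        hm4.comp (f := fun z : X × X => ((a, b), z)) (by fun_prop)
      exact this.aemeasurable
    rw [this]
    exact hm4.lintegral_prod_right'
  -- Integrating the kernel first over the superlevel set of `g`, or first over that of `f` as in
  -- `hJ2`, gives two competing bounds for the form on indicator functions.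
  have hJ1 : ∀ a b, J a b ≤ D * (A f a * A g b ^ (1 - l)) := by
    intro a b
    have : ∀ x, ∫⁻ y, χ f a x * K x y * χ g b y ∂μ ≤
        {x | ENNReal.ofReal a < f x}.indicator (fun _ => D * A g b ^ (1 - l)) x := by
      intro x
      by_cases hx : ENNReal.ofReal a < f x
      · have e : ∀ y, χ f a x * K x y * χ g b y
            = {y | ENNReal.ofReal b < g y}.indicator (fun y => K x y) y := by
          intro y
          by_cases hy : ENNReal.ofReal b < g y <;> simp [hχ, hx, hy]
        simp_rw [e]
        rw [lintegral_indicator (hset g hg b), indicator_of_mem (by exact hx)]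
        exact hK1 x _ (hset g hg b)
      · simp [hχ, hx]
    refine (lintegral_mono this).trans ?_
    rw [lintegral_indicator_const (hset f hf a)]
    apply le_of_eq; simp only [hA]; ring
  have hJ2 : ∀ a b, J a b ≤ D * (A g b * A f a ^ (1 - l)) := by
    intro a b
    have hsw : J a b = ∫⁻ y, ∫⁻ x, χ f a x * K x y * χ g b y ∂μ ∂μ := by
      simp only [hJ]
      rw [lintegral_lintegral_swap]
      exact (hm4.comp (f := fun z : X × X => ((a, b), z)) (by fun_prop)).aemeasurable
    rw [hsw]
    have : ∀ y, ∫⁻ x, χ f a x * K x y * χ g b y ∂μ ≤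
        {y | ENNReal.ofReal b < g y}.indicator (fun _ => D * A f a ^ (1 - l)) y := by
      intro y
      by_cases hy : ENNReal.ofReal b < g y
      · have e : ∀ x, χ f a x * K x y * χ g b y
            = {x | ENNReal.ofReal a < f x}.indicator (fun x => K x y) x := by
          intro x
          by_cases hx : ENNReal.ofReal a < f x <;> simp [hχ, hx, hy]
        simp_rw [e]
        rw [lintegral_indicator (hset f hf a), indicator_of_mem (by exact hy)]
        exact hK2 y _ (hset f hf a)
      · simp [hχ, hy]
    refine (lintegral_mono this).trans ?_
    rw [lintegral_indicator_const (hset g hg b)]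
    apply le_of_eq; simp only [hA]; ring
  -- layer cake
  have hcake : ∫⁻ x, ∫⁻ y, f x * K x y * g y ∂μ ∂μ
      = ∫⁻ a in Ioi (0 : ℝ), ∫⁻ b in Ioi (0 : ℝ), J a b := by
    have e1 : ∀ x y, f x * K x y * g y = ∫⁻ w : ℝ × ℝ, χ f w.1 x * K x y * χ g w.2 y
        ∂((volume.restrict (Ioi 0)).prod (volume.restrict (Ioi 0))) := by
      intro x y
      have e : ∀ w : ℝ × ℝ, χ f w.1 x * K x y * χ g w.2 y = K x y * (χ f w.1 x * χ g w.2 y) := by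
        intro w; ring
      have m1 : ∀ f : X → ℝ≥0∞, Measurable f → ∀ x, Measurable fun a => χ f a x := fun f hf x =>
        (hχm f hf).comp (f := fun a : ℝ => (a, x)) (by fun_prop)
      simp_rw [e]
      rw [lintegral_const_mul, lintegral_prod_mul (f := fun a => χ f a x) (g := fun a => χ g a y)
        (m1 f hf x).aemeasurable (m1 g hg y).aemeasurable,
        lintegral_Ioi_ite_ofReal_lt, lintegral_Ioi_ite_ofReal_lt]
      · ring
      · exact ((m1 f hf x).comp measurable_fst).mul ((m1 g hg y).comp measurable_snd)
    have mfg : Measurable fun z : X × X => f z.1 * K z.1 z.2 * g z.2 :=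
      ((hf.comp measurable_fst).mul hK).mul (hg.comp measurable_snd)
    rw [← lintegral_prod (fun z : X × X => f z.1 * K z.1 z.2 * g z.2) mfg.aemeasurable]
    simp_rw [e1]
    rw [lintegral_lintegral_swap, lintegral_prod]
    · apply lintegral_congr; intro a
      apply lintegral_congr; intro b
      rw [lintegral_prod]
      exact (hm4.comp (f := fun z : X × X => ((a, b), z)) (by fun_prop)).aemeasurable
    · exact (hm4.lintegral_prod_right' (ν := μ.prod μ)).aemeasurable
    · exact (hm4.comp measurable_swap).aemeasurable
  rw [hcake]
  have hfA := lintegral_meas_lt_mul_rpow_le μ hp hf hf1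
  have hgA := lintegral_meas_lt_mul_rpow_le μ hp hg hg1
  -- For levels b ≤ a the fractional power is put on the distribution function of `g`: Hölder bounds
  -- its integral over (0, a] by a multiple of a^{p-1}, which is the weight under which the
  -- distribution function of `f` has mass at most 1. The region a ≤ b is the same with the roles
  -- exchanged.
  have half : ∀ f g : X → ℝ≥0∞,
      (∫⁻ a in Ioi (0 : ℝ), A f a * ENNReal.ofReal (a ^ (2 / (2 - l) - 1)) ≤ 1) →
      (∫⁻ a in Ioi (0 : ℝ), A g a * ENNReal.ofReal (a ^ (2 / (2 - l) - 1)) ≤ 1) →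
      ∫⁻ a in Ioi (0 : ℝ), ∫⁻ b in Ioc 0 a, D * (A f a * A g b ^ (1 - l))
        ≤ D * ENNReal.ofReal ((2 - l) ^ l) := by
    intro f g hfA hgA
    calc _ ≤ ∫⁻ a in Ioi (0 : ℝ), (D * ENNReal.ofReal ((2 - l) ^ l)) *
          (A f a * ENNReal.ofReal (a ^ (2 / (2 - l) - 1))) := by
          apply setLIntegral_mono' measurableSet_Ioi
          intro a ha
          have m1 : Measurable fun b => A g b ^ (1 - l) := (hAm g).pow_const _
          rw [lintegral_const_mul _ (m1.const_mul _), lintegral_const_mul _ m1]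
          have := lintegral_Ioc_rpow_one_sub_le hl0 hl1 (hAm g) hgA ha
          rw [ENNReal.ofReal_mul (by positivity)] at this
          calc _ ≤ D * (A f a * (ENNReal.ofReal ((2 - l) ^ l) *
                ENNReal.ofReal (a ^ (2 / (2 - l) - 1)))) := by gcongr
            _ = _ := by ring
      _ ≤ _ := by
          have m2 : Measurable fun a : ℝ => ENNReal.ofReal (a ^ (2 / (2 - l) - 1)) := by fun_prop
          have m3 : Measurable fun a : ℝ => A f a * ENNReal.ofReal (a ^ (2 / (2 - l) - 1)) :=
            (hAm f).mul m2
          rw [lintegral_const_mul _ m3]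
          exact mul_le_of_le_one_right zero_le hfA
  have hsplit : ∀ a b : ℝ, 0 < a → 0 < b → J a b ≤
      (Ioc 0 a).indicator (fun b => D * (A f a * A g b ^ (1 - l))) b +
      (Ioc 0 b).indicator (fun a => D * (A g b * A f a ^ (1 - l))) a := by
    intro a b ha hb
    rcases le_total b a with h | h
    · rw [indicator_of_mem (show b ∈ Ioc 0 a from ⟨hb, h⟩)]
      exact (hJ1 a b).trans le_self_add
    · rw [indicator_of_mem (show a ∈ Ioc 0 b from ⟨ha, h⟩)]
      exact (hJ2 a b).trans le_add_self
  have mI : ∀ f g : X → ℝ≥0∞, Measurable fun w : ℝ × ℝ =>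
      (Ioc 0 w.1).indicator (fun b => D * (A f w.1 * A g b ^ (1 - l))) w.2 := by
    intro f g
    have : (fun w : ℝ × ℝ => (Ioc 0 w.1).indicator (fun b => D * (A f w.1 * A g b ^ (1 - l))) w.2)
      = {w : ℝ × ℝ | 0 < w.2 ∧ w.2 ≤ w.1}.indicator
          (fun w => D * (A f w.1 * A g w.2 ^ (1 - l))) := by
      ext w; simp [indicator]
    rw [this]
    apply Measurable.indicator
    · exact (((hAm f).comp measurable_fst).mul (((hAm g).comp measurable_snd).pow_const _)).const_mul _
    · exact (measurableSet_lt measurable_const measurable_snd).inter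
        (measurableSet_le measurable_snd measurable_fst)
  have hI : ∀ f g : X → ℝ≥0∞,
      ∫⁻ a in Ioi (0 : ℝ), ∫⁻ b in Ioi (0 : ℝ),
        (Ioc 0 a).indicator (fun b => D * (A f a * A g b ^ (1 - l))) b
      = ∫⁻ a in Ioi (0 : ℝ), ∫⁻ b in Ioc 0 a, D * (A f a * A g b ^ (1 - l)) := by
    intro f g
    apply lintegral_congr; intro a
    rw [setLIntegral_indicator measurableSet_Ioc, inter_eq_left.2 Ioc_subset_Ioi_self]
  calc _ ≤ ∫⁻ a in Ioi (0 : ℝ), ∫⁻ b in Ioi (0 : ℝ),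
        ((Ioc 0 a).indicator (fun b => D * (A f a * A g b ^ (1 - l))) b +
      (Ioc 0 b).indicator (fun a => D * (A g b * A f a ^ (1 - l))) a) := by
        apply setLIntegral_mono' measurableSet_Ioi
        intro a ha
        apply setLIntegral_mono' measurableSet_Ioi
        intro b hb
        exact hsplit a b ha hb
    _ = (∫⁻ a in Ioi (0 : ℝ), ∫⁻ b in Ioi (0 : ℝ),
        (Ioc 0 a).indicator (fun b => D * (A f a * A g b ^ (1 - l))) b) +
        ∫⁻ a in Ioi (0 : ℝ), ∫⁻ b in Ioi (0 : ℝ),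
      (Ioc 0 b).indicator (fun a => D * (A g b * A f a ^ (1 - l))) a := by
        rw [← lintegral_add_left]
        · apply lintegral_congr; intro a
          rw [lintegral_add_left]
          exact (mI f g).comp (f := fun b : ℝ => (a, b)) (by fun_prop)
        · exact (mI f g).lintegral_prod_right'
    _ ≤ D * ENNReal.ofReal ((2 - l) ^ l) + D * ENNReal.ofReal ((2 - l) ^ l) := by
        rw [lintegral_lintegral_swap (f := fun a b =>
          (Ioc 0 b).indicator (fun a => D * (A g b * A f a ^ (1 - l))) a)]
        · rw [hI f g, hI g f]
          exact add_le_add (half f g hfA hgA) (half g f hgA hfA)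
        · exact ((mI g f).comp measurable_swap).aemeasurable
    _ = _ := by ring

/-- The diagonal Hardy–Littlewood–Sobolev inequality for kernels of weak type, as a bound on a
bilinear form. -/
theorem lintegral_kernel_le [SFinite μ] {l : ℝ} (hl0 : 0 < l) (hl1 : l < 1)
    {K : X → X → ℝ≥0∞} (hK : Measurable (Function.uncurry K)) (D : ℝ≥0∞)
    (hK1 : ∀ x, ∀ E, MeasurableSet E → ∫⁻ y in E, K x y ∂μ ≤ D * μ E ^ (1 - l))
    (hK2 : ∀ y, ∀ E, MeasurableSet E → ∫⁻ x in E, K x y ∂μ ≤ D * μ E ^ (1 - l))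
    {p : ℝ} (hp : p = 2 / (2 - l))
    {f g : X → ℝ≥0∞} (hf : Measurable f) (hg : Measurable g) :
    ∫⁻ x, ∫⁻ y, f x * K x y * g y ∂μ ∂μ ≤ 2 * (D + 1) * ENNReal.ofReal ((2 - l) ^ l) *
      (∫⁻ x, f x ^ p ∂μ) ^ (1 / p) * (∫⁻ x, g x ^ p ∂μ) ^ (1 / p) := by
  have h2l : 0 < 2 - l := by linarith
  have hp0 : 0 < p := by rw [hp]; positivity
  have hM : ENNReal.ofReal ((2 - l) ^ l) ≠ 0 := by
    rw [ne_eq, ENNReal.ofReal_eq_zero, not_le]; positivity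
  -- `D + 1` in place of `D` keeps the constant nonzero, so that the right side is `⊤` when one norm
  -- is infinite and the other is nonzero.
  have hC : 2 * (D + 1) * ENNReal.ofReal ((2 - l) ^ l) ≠ 0 := by
    refine mul_ne_zero (mul_ne_zero two_ne_zero ?_) hM
    simp
  set a := (∫⁻ x, f x ^ p ∂μ) ^ (1 / p) with ha
  set b := (∫⁻ x, g x ^ p ∂μ) ^ (1 / p) with hb
  have hzero : ∀ f : X → ℝ≥0∞, Measurable f → (∫⁻ x, f x ^ p ∂μ) ^ (1 / p) = 0 → f =ᵐ[μ] 0 := by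
    intro f hf h
    rw [ENNReal.rpow_eq_zero_iff_of_pos (by positivity), lintegral_eq_zero_iff (hf.pow_const _)] at h
    filter_upwards [h] with x hx
    simpa [hp0, hp0.le, ENNReal.rpow_eq_zero_iff, not_lt.2 hp0.le] using hx
  rcases eq_or_ne a 0 with ha0 | ha0
  · have := hzero f hf ha0
    have : ∫⁻ x, ∫⁻ y, f x * K x y * g y ∂μ ∂μ = 0 := by
      rw [lintegral_congr_ae (g := fun _ => 0)]
      · simp
      · filter_upwards [this] with x hx
        simp [hx]
    rw [this]; exact zero_le
  rcases eq_or_ne b 0 with hb0 | hb0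
  · have := hzero g hg hb0
    have : ∀ x, ∫⁻ y, f x * K x y * g y ∂μ = 0 := by
      intro x
      rw [lintegral_congr_ae (g := fun _ => 0)]
      · simp
      · filter_upwards [this] with x hx
        simp [hx]
    simp [this]
  rcases eq_or_ne a ⊤ with hat | hat
  · rw [hat, ENNReal.mul_top hC, ENNReal.top_mul hb0]; exact le_top
  rcases eq_or_ne b ⊤ with hbt | hbt
  · rw [hbt, ENNReal.mul_top (mul_ne_zero hC ha0)]; exact le_top
  have hnorm : ∀ f : X → ℝ≥0∞, Measurable f → ∀ a, a = (∫⁻ x, f x ^ p ∂μ) ^ (1 / p) → a ≠ 0 → a ≠ ⊤ →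
      ∫⁻ x, (a⁻¹ * f x) ^ p ∂μ ≤ 1 := by
    intro f hf a ha ha0 hat
    simp_rw [ENNReal.mul_rpow_of_nonneg _ _ hp0.le]
    rw [lintegral_const_mul _ (hf.pow_const _)]
    have : ∫⁻ x, f x ^ p ∂μ = a ^ p := by
      rw [ha, ← ENNReal.rpow_mul, one_div_mul_cancel hp0.ne', ENNReal.rpow_one]
    rw [this, ← ENNReal.mul_rpow_of_nonneg _ _ hp0.le, ENNReal.inv_mul_cancel ha0 hat]
    simp
  have key := lintegral_kernel_le_of_norm_le_one μ hl0 hl1 hK D hK1 hK2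
    (f := fun x => a⁻¹ * f x) (g := fun x => b⁻¹ * g x) (hf.const_mul _) (hg.const_mul _)
    (by rw [← hp]; exact hnorm f hf a ha ha0 hat) (by rw [← hp]; exact hnorm g hg b hb hb0 hbt)
  have mfg : Measurable fun z : X × X => f z.1 * K z.1 z.2 * g z.2 :=
    ((hf.comp measurable_fst).mul hK).mul (hg.comp measurable_snd)
  have e : ∫⁻ x, ∫⁻ y, a⁻¹ * f x * K x y * (b⁻¹ * g y) ∂μ ∂μ
      = a⁻¹ * b⁻¹ * ∫⁻ x, ∫⁻ y, f x * K x y * g y ∂μ ∂μ := by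
    rw [← lintegral_const_mul]
    · apply lintegral_congr; intro x
      rw [← lintegral_const_mul]
      · apply lintegral_congr; intro y; ring
      · exact mfg.comp (f := fun y : X => (x, y)) (by fun_prop)
    · exact mfg.lintegral_prod_right'
  rw [e] at key
  calc ∫⁻ x, ∫⁻ y, f x * K x y * g y ∂μ ∂μ
      = a * b * (a⁻¹ * b⁻¹ * ∫⁻ x, ∫⁻ y, f x * K x y * g y ∂μ ∂μ) := by
        rw [← mul_assoc, mul_mul_mul_comm, ENNReal.mul_inv_cancel ha0 hat,
          ENNReal.mul_inv_cancel hb0 hbt, one_mul, one_mul]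
    _ ≤ a * b * (2 * (D + 1) * ENNReal.ofReal ((2 - l) ^ l)) := by
        refine mul_le_mul_right (key.trans ?_) _
        gcongr
        exact le_self_add
    _ = _ := by ring

end Kernel

/-! ### One-sided Riesz and Stein–Weiss kernels -/

/-- The one-sided Riesz kernel on the line. -/
noncomputable def oneSidedRiesz (l σ : ℝ) : ℝ≥0∞ :=
  (Ioi (0 : ℝ)).indicator (fun σ => ENNReal.ofReal (σ ^ (-l))) σ

theorem measurable_oneSidedRiesz (l : ℝ) : Measurable (oneSidedRiesz l) := by
  unfold oneSidedRiesz
  exact Measurable.indicator (by fun_prop) measurableSet_Ioi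

/-- The kernel is decreasing on the half-line, so split at δ = |E|: up to δ it integrates to
δ^{1-l}/(1-l), and beyond δ it is at most δ^{-l} on a set of measure at most δ. The two
contributions are the two terms of the constant. -/
theorem setLIntegral_oneSidedRiesz_le {l : ℝ} (hl0 : 0 < l) (hl1 : l < 1) (E : Set ℝ) :
    ∫⁻ σ in E, oneSidedRiesz l σ ≤ (Real.toNNReal (1 + 1 / (1 - l)) : ℝ≥0) * volume E ^ (1 - l) := by
  have h1l : 0 < 1 - l := by linarith
  have hD : (0 : ℝ) < 1 + 1 / (1 - l) := by positivity
  rcases eq_or_ne (volume E) ⊤ with ht | ht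
  · rw [ht, ENNReal.top_rpow_of_pos h1l, ENNReal.mul_top]
    · exact le_top
    · simpa using hD
  rcases eq_or_ne (volume E) 0 with h0 | h0
  · rw [Measure.restrict_eq_zero.2 h0]; simp
  set δ := (volume E).toReal with hδ
  have hδ0 : 0 < δ := ENNReal.toReal_pos h0 ht
  have hvE : volume E = ENNReal.ofReal δ := (ENNReal.ofReal_toReal ht).symm
  have hb : ∀ σ, oneSidedRiesz l σ ≤
      (Ioc 0 δ).indicator (fun σ => ENNReal.ofReal (σ ^ (-l))) σ + ENNReal.ofReal (δ ^ (-l)) := by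
    intro σ
    unfold oneSidedRiesz
    by_cases h : 0 < σ
    · rw [indicator_of_mem (show σ ∈ Ioi 0 from h)]
      by_cases h' : σ ≤ δ
      · rw [indicator_of_mem (show σ ∈ Ioc 0 δ from ⟨h, h'⟩)]
        exact le_self_add
      · refine le_trans ?_ le_add_self
        apply ENNReal.ofReal_le_ofReal
        exact Real.rpow_le_rpow_of_nonpos hδ0 (not_le.1 h').le (by linarith)
    · rw [indicator_of_notMem (show σ ∉ Ioi 0 from h)]; exact zero_le
  calc _ ≤ ∫⁻ σ in E, ((Ioc 0 δ).indicator (fun σ => ENNReal.ofReal (σ ^ (-l))) σ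
        + ENNReal.ofReal (δ ^ (-l))) := lintegral_mono hb
    _ = (∫⁻ σ in E, (Ioc 0 δ).indicator (fun σ => ENNReal.ofReal (σ ^ (-l))) σ)
        + ENNReal.ofReal (δ ^ (-l)) * volume E := by
        rw [lintegral_add_right _ measurable_const, setLIntegral_const]
    _ ≤ (∫⁻ σ in Ioc 0 δ, ENNReal.ofReal (σ ^ (-l))) + ENNReal.ofReal (δ ^ (-l)) * volume E := by
        refine add_le_add ?_ le_rfl
        rw [← lintegral_indicator measurableSet_Ioc]
        exact setLIntegral_le_lintegral _ _
    _ = _ := by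
        rw [lintegral_Ioc_rpow_neg hl1 hδ0, hvE, ENNReal.ofReal_rpow_of_pos hδ0,
          ← ENNReal.ofReal_mul (by positivity), ← ENNReal.ofReal_add (by positivity) (by positivity)]
        change _ = ENNReal.ofReal _ * _
        rw [← ENNReal.ofReal_mul hD.le]
        congr 1
        have : δ ^ (-l) * δ = δ ^ (1 - l) := by
          nth_rewrite 2 [← Real.rpow_one δ]
          rw [← Real.rpow_add hδ0]; congr 1; ring
        rw [this]; ring

theorem lintegral_oneSidedRiesz_bilinear {l : ℝ} (hl0 : 0 < l) (hl1 : l < 1) {p : ℝ}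
    (hp : p = 2 / (2 - l)) : ∃ C : ℝ≥0, ∀ f g : ℝ → ℝ≥0∞, Measurable f → Measurable g →
    ∫⁻ x, ∫⁻ y, f x * oneSidedRiesz l (x - y) * g y
      ≤ C * (∫⁻ x, f x ^ p) ^ (1 / p) * (∫⁻ x, g x ^ p) ^ (1 / p) := by
  set D : ℝ≥0 := Real.toNNReal (1 + 1 / (1 - l)) with hD
  refine ⟨2 * (D + 1) * Real.toNNReal ((2 - l) ^ l), fun f g hf hg => ?_⟩
  have hm : Measurable (Function.uncurry fun x y : ℝ => oneSidedRiesz l (x - y)) :=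
    (measurable_oneSidedRiesz l).comp (measurable_fst.sub measurable_snd)
  have := lintegral_kernel_le (volume : Measure ℝ) hl0 hl1 hm D ?_ ?_ hp hf hg
  · refine this.trans (le_of_eq ?_)
    push_cast
    rfl
  · intro x E hE
    have hE' : MeasurableSet ((fun y => x - y) ⁻¹' E) := hE.preimage (by fun_prop)
    have hmp := Measure.measurePreserving_sub_left (volume : Measure ℝ) x
    calc _ = ∫⁻ σ in (fun y => x - y) ⁻¹' E, oneSidedRiesz l σ := by
          rw [← lintegral_indicator hE, ← lintegral_indicator hE']
          rw [← lintegral_sub_left_eq_self _ x]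
          apply lintegral_congr; intro y
          simp [indicator]
          rfl
      _ ≤ _ := setLIntegral_oneSidedRiesz_le hl0 hl1 _
      _ = _ := by rw [hmp.measure_preimage hE.nullMeasurableSet]
  · intro y E hE
    have hE' : MeasurableSet ((fun x => x + y) ⁻¹' E) := hE.preimage (by fun_prop)
    have hmp := measurePreserving_add_right (volume : Measure ℝ) y
    calc _ = ∫⁻ σ in (fun x => x + y) ⁻¹' E, oneSidedRiesz l σ := by
          rw [← lintegral_indicator hE, ← lintegral_indicator hE']
          rw [← lintegral_add_right_eq_self _ y]
          apply lintegral_congr; intro x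
          simp [indicator]
          rfl
      _ ≤ _ := setLIntegral_oneSidedRiesz_le hl0 hl1 _
      _ = _ := by rw [hmp.measure_preimage hE.nullMeasurableSet]

theorem lintegral_Ioi_eq_lintegral_exp (g : ℝ → ℝ≥0∞) :
    ∫⁻ x in Ioi (0 : ℝ), g x = ∫⁻ s, ENNReal.ofReal (Real.exp s) * g (Real.exp s) := by
  have := lintegral_image_eq_lintegral_abs_deriv_mul (s := univ) (f := Real.exp) (f' := Real.exp)
    MeasurableSet.univ (fun x _ => (Real.hasDerivAt_exp x).hasDerivWithinAt)
    Real.exp_injective.injOn g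
  rw [image_univ, Real.range_exp, Measure.restrict_univ] at this
  rw [this]
  simp

/-- The one-sided Stein–Weiss kernel `x^{-α} y^{-β} (x-y)^{-γ}` on `0 < y < x`. -/
noncomputable def steinWeiss (α β γ x y : ℝ) : ℝ≥0∞ :=
  {z : ℝ × ℝ | 0 < z.2 ∧ z.2 < z.1}.indicator
    (fun z => ENNReal.ofReal (z.1 ^ (-α) * z.2 ^ (-β) * (z.1 - z.2) ^ (-γ))) (x, y)

theorem measurable_steinWeiss (α β γ : ℝ) : Measurable (Function.uncurry (steinWeiss α β γ)) := by
  have : Function.uncurry (steinWeiss α β γ) = {z : ℝ × ℝ | 0 < z.2 ∧ z.2 < z.1}.indicator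
    (fun z => ENNReal.ofReal (z.1 ^ (-α) * z.2 ^ (-β) * (z.1 - z.2) ^ (-γ))) := by
    ext ⟨x, y⟩; rfl
  rw [this]
  refine Measurable.indicator (by fun_prop) ?_
  exact (measurableSet_lt measurable_const measurable_snd).inter
    (measurableSet_lt measurable_snd measurable_fst)

/-- The kernel is homogeneous of degree -2/q, so after x = e^s, y = e^τ and extraction of
e^{-s/q}e^{-τ/q} it depends only on σ = s - τ and equals e^{-εσ}(1-e^{-σ})^{-γ} with ε = 1/q - β >
0. Since 1 - e^{-σ} ≥ σ/(1+σ) and γ ≤ 2/q < 1, this is at most σ^{-2/q}(1+σ)e^{-εσ}, and the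
exponential absorbs the linear growth. -/
theorem steinWeiss_exp_le {q α β γ : ℝ} (hq : 2 < q) (hβ : β < 1 / q) (hγ0 : 0 ≤ γ)
    (hγ : γ ≤ 2 / q) (h : α + β + γ = 2 / q) : ∃ C : ℝ≥0, ∀ s τ : ℝ,
    steinWeiss α β γ (Real.exp s) (Real.exp τ) ≤
      C * (ENNReal.ofReal (Real.exp (-s / q)) * oneSidedRiesz (2 / q) (s - τ) *
        ENNReal.ofReal (Real.exp (-τ / q))) := by
  set ε := 1 / q - β with hε
  have hε0 : 0 < ε := by linarith
  have hC : 0 ≤ 1 + 1 / ε := by positivity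
  refine ⟨Real.toNNReal (1 + 1 / ε), fun s τ => ?_⟩
  unfold steinWeiss
  by_cases hst : τ < s
  swap
  · rw [indicator_of_notMem]
    · exact zero_le
    · simp [hst]
  set σ := s - τ with hσ
  have hσ0 : 0 < σ := by linarith
  rw [indicator_of_mem (by exact ⟨Real.exp_pos _, Real.exp_lt_exp.2 hst⟩)]
  unfold oneSidedRiesz
  rw [indicator_of_mem (show σ ∈ Ioi 0 from hσ0)]
  change _ ≤ ENNReal.ofReal _ * _
  rw [← ENNReal.ofReal_mul (by positivity), ← ENNReal.ofReal_mul (by positivity),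
    ← ENNReal.ofReal_mul hC]
  apply ENNReal.ofReal_le_ofReal
  simp only
  have h1 : Real.exp s * (σ / (1 + σ)) ≤ Real.exp s - Real.exp τ := by
    have : Real.exp τ = Real.exp s * Real.exp (-σ) := by rw [← Real.exp_add]; congr 1; rw [hσ]; ring
    rw [this]
    have h2 : Real.exp (-σ) ≤ 1 / (1 + σ) := by
      rw [Real.exp_neg, ← one_div]
      exact one_div_le_one_div_of_le (by linarith) (by linarith [Real.add_one_le_exp σ])
    have h3 : σ / (1 + σ) = 1 - 1 / (1 + σ) := by field_simp; ring
    rw [h3]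
    nlinarith [Real.exp_pos s]
  have h2 : (Real.exp s - Real.exp τ) ^ (-γ) ≤ Real.exp (-γ * s) * (σ ^ (-γ) * (1 + σ) ^ γ) := by
    calc _ ≤ (Real.exp s * (σ / (1 + σ))) ^ (-γ) :=
          Real.rpow_le_rpow_of_nonpos (by positivity) h1 (by linarith)
      _ = _ := by
          rw [Real.mul_rpow (Real.exp_pos _).le (by positivity), ← Real.exp_mul,
            Real.div_rpow hσ0.le (by positivity), Real.rpow_neg (by positivity : (0:ℝ) ≤ 1 + σ)]
          rw [div_inv_eq_mul]; congr 2; ring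
  have h3 : (1 + σ) ^ γ * σ ^ (2 / q - γ) ≤ 1 + σ := by
    calc _ ≤ (1 + σ) ^ γ * (1 + σ) ^ (2 / q - γ) := by
          gcongr
          linarith
      _ = (1 + σ) ^ (2 / q) := by rw [← Real.rpow_add (by positivity)]; congr 1; ring
      _ ≤ (1 + σ) ^ (1 : ℝ) := by
          apply Real.rpow_le_rpow_of_exponent_le (by linarith)
          rw [div_le_one (by linarith)]; linarith
      _ = _ := Real.rpow_one _
  have h4 : 1 + σ ≤ (1 + 1 / ε) * Real.exp (ε * σ) := by
    have := Real.add_one_le_exp (ε * σ)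
    have e : (1 + 1 / ε) * (ε * σ + 1) = 1 + σ + (ε * σ + 1 / ε) := by field_simp; ring
    have : (1 + 1 / ε) * (ε * σ + 1) ≤ (1 + 1 / ε) * Real.exp (ε * σ) := by gcongr
    have : 0 ≤ ε * σ + 1 / ε := by positivity
    linarith
  have hσs : σ ^ (-γ) = σ ^ (2 / q - γ) * σ ^ (-(2 / q)) := by
    rw [← Real.rpow_add hσ0]; congr 1; ring
  rw [← Real.exp_mul, ← Real.exp_mul]
  calc Real.exp (s * -α) * Real.exp (τ * -β) * (Real.exp s - Real.exp τ) ^ (-γ)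
      ≤ Real.exp (s * -α) * Real.exp (τ * -β) * (Real.exp (-γ * s) * (σ ^ (-γ) * (1 + σ) ^ γ)) := by
        gcongr
    _ = Real.exp (s * -α) * Real.exp (τ * -β) * Real.exp (-γ * s) * σ ^ (-(2 / q)) *
        ((1 + σ) ^ γ * σ ^ (2 / q - γ)) := by rw [hσs]; ring
    _ ≤ Real.exp (s * -α) * Real.exp (τ * -β) * Real.exp (-γ * s) * σ ^ (-(2 / q)) *
        ((1 + 1 / ε) * Real.exp (ε * σ)) := by
        exact mul_le_mul_of_nonneg_left (h3.trans h4) (by positivity)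
    _ = (1 + 1 / ε) * σ ^ (-(2 / q)) * (Real.exp (s * -α) * Real.exp (τ * -β) * Real.exp (-γ * s) *
        Real.exp (ε * σ)) := by ring
    _ = (1 + 1 / ε) * σ ^ (-(2 / q)) * (Real.exp (-s / q) * Real.exp (-τ / q)) := by
        rw [← Real.exp_add, ← Real.exp_add, ← Real.exp_add, ← Real.exp_add]
        congr 2
        have : α = 2 / q - β - γ := by linarith
        rw [this, hε, hσ]; ring
    _ = _ := by ring

/-- A one-sided Stein–Weiss inequality `L^{q'} → L^q` on the half-line, as a bilinear bound. -/
theorem lintegral_steinWeiss_bilinear {q α β γ : ℝ} (hq : 2 < q) (hβ : β < 1 / q) (hγ0 : 0 ≤ γ)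
    (hγ : γ ≤ 2 / q) (h : α + β + γ = 2 / q) {p : ℝ} (hp : p = q / (q - 1)) :
    ∃ C : ℝ≥0, ∀ f g : ℝ → ℝ≥0∞, Measurable f → Measurable g →
    ∫⁻ x, ∫⁻ y, f x * steinWeiss α β γ x y * g y
      ≤ C * (∫⁻ x, f x ^ p) ^ (1 / p) * (∫⁻ x, g x ^ p) ^ (1 / p) := by
  have hq0 : 0 < q := by linarith
  have hq1 : 0 < q - 1 := by linarith
  have hp0 : 0 < p := by rw [hp]; positivity
  obtain ⟨C1, hC1⟩ := steinWeiss_exp_le hq hβ hγ0 hγ h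
  obtain ⟨C2, hC2⟩ := lintegral_oneSidedRiesz_bilinear (l := 2 / q) (p := p) (by positivity)
    (by rw [div_lt_one hq0]; exact hq) (by rw [hp]; field_simp)
  refine ⟨C1 * C2, fun f g hf hg => ?_⟩
  have m1 : Measurable fun s => ENNReal.ofReal (Real.exp (s * (1 - 1 / q))) := by fun_prop
  -- The exponent 1 - 1/q = 1/p makes f ↦ f' an isometry from L^p of the half-line to L^p(ds). It is
  -- also the Jacobian e^s times the factor e^{-s/q} split off from the kernel.
  set f' : ℝ → ℝ≥0∞ := fun s => ENNReal.ofReal (Real.exp (s * (1 - 1 / q))) * f (Real.exp s) with hf'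
  set g' : ℝ → ℝ≥0∞ := fun s => ENNReal.ofReal (Real.exp (s * (1 - 1 / q))) * g (Real.exp s) with hg'
  have hf'm : Measurable f' := m1.mul (hf.comp Real.measurable_exp)
  have hg'm : Measurable g' := m1.mul (hg.comp Real.measurable_exp)
  have hnorm : ∀ f : ℝ → ℝ≥0∞, ∫⁻ s, (ENNReal.ofReal (Real.exp (s * (1 - 1 / q))) * f (Real.exp s)) ^ p
      ≤ ∫⁻ x, f x ^ p := by
    intro f
    calc _ = ∫⁻ x in Ioi (0 : ℝ), f x ^ p := by
          rw [lintegral_Ioi_eq_lintegral_exp]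
          apply lintegral_congr; intro s
          rw [ENNReal.mul_rpow_of_nonneg _ _ hp0.le, ENNReal.ofReal_rpow_of_pos (Real.exp_pos _),
            ← Real.exp_mul]
          congr 3
          rw [hp]; field_simp
      _ ≤ _ := setLIntegral_le_lintegral _ _
  have hL : ∀ x y, f x * steinWeiss α β γ x y * g y = (Ioi (0 : ℝ)).indicator
      (fun x => (Ioi (0 : ℝ)).indicator (fun y => f x * steinWeiss α β γ x y * g y) y) x := by
    intro x y
    by_cases hxy : 0 < y ∧ y < x
    · rw [indicator_of_mem (show x ∈ Ioi 0 from hxy.1.trans hxy.2),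
        indicator_of_mem (show y ∈ Ioi 0 from hxy.1)]
    · have : steinWeiss α β γ x y = 0 := by
        unfold steinWeiss; rw [indicator_of_notMem]; exact hxy
      simp [indicator, this]
  have e1 : ∫⁻ x, ∫⁻ y, f x * steinWeiss α β γ x y * g y = ∫⁻ s, ∫⁻ τ,
      ENNReal.ofReal (Real.exp s) * (ENNReal.ofReal (Real.exp τ) *
        (f (Real.exp s) * steinWeiss α β γ (Real.exp s) (Real.exp τ) * g (Real.exp τ))) := by
    calc _ = ∫⁻ x in Ioi (0 : ℝ), ∫⁻ y in Ioi (0 : ℝ), f x * steinWeiss α β γ x y * g y := by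
          rw [← lintegral_indicator measurableSet_Ioi]
          apply lintegral_congr; intro x
          by_cases hx : x ∈ Ioi (0 : ℝ)
          · rw [indicator_of_mem hx, ← lintegral_indicator measurableSet_Ioi]
            apply lintegral_congr; intro y
            rw [hL x y, indicator_of_mem hx]
          · rw [indicator_of_notMem hx]
            simp_rw [hL x, indicator_of_notMem hx]
            simp
      _ = _ := by
          rw [lintegral_Ioi_eq_lintegral_exp]
          apply lintegral_congr; intro s
          rw [lintegral_Ioi_eq_lintegral_exp, ← lintegral_const_mul' _ _ ENNReal.ofReal_ne_top]
  rw [e1]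
  calc _ ≤ ∫⁻ s, ∫⁻ τ, C1 * (f' s * oneSidedRiesz (2 / q) (s - τ) * g' τ) := by
        apply lintegral_mono; intro s
        apply lintegral_mono; intro τ
        have e : ∀ s, Real.exp (s * (1 - 1 / q)) = Real.exp s * Real.exp (-s / q) := by
          intro s; rw [← Real.exp_add]; congr 1; ring
        simp only [hf', hg', e, ENNReal.ofReal_mul (Real.exp_pos _).le]
        calc _ ≤ ENNReal.ofReal (Real.exp s) * (ENNReal.ofReal (Real.exp τ) *
            (f (Real.exp s) * (C1 * (ENNReal.ofReal (Real.exp (-s / q)) * oneSidedRiesz (2 / q) (s - τ) *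
        ENNReal.ofReal (Real.exp (-τ / q)))) * g (Real.exp τ))) := by
              gcongr; exact hC1 s τ
          _ = _ := by ring
    _ = C1 * ∫⁻ s, ∫⁻ τ, f' s * oneSidedRiesz (2 / q) (s - τ) * g' τ := by
        rw [← lintegral_const_mul' _ _ ENNReal.coe_ne_top]
        apply lintegral_congr; intro s
        rw [lintegral_const_mul' _ _ ENNReal.coe_ne_top]
    _ ≤ C1 * (C2 * (∫⁻ x, f x ^ p) ^ (1 / p) * (∫⁻ x, g x ^ p) ^ (1 / p)) := by
        gcongr
        refine (hC2 f' g' hf'm hg'm).trans ?_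
        exact mul_le_mul (mul_le_mul_right (ENNReal.rpow_le_rpow (hnorm f) (by positivity)) _)
          (ENNReal.rpow_le_rpow (hnorm g) (by positivity)) zero_le zero_le
    _ = _ := by push_cast; ring

/-! ### Tensor products and duality for nonnegative kernels -/

/-- Tensor product of two bounded bilinear forms on `L^p`. -/
theorem lintegral_tensor_bilinear {p : ℝ} (hp0 : 0 < p) {k : ℝ → ℝ → ℝ≥0∞}
    (hk : Measurable (Function.uncurry k)) {C : ℝ≥0}
    (hC : ∀ f g : ℝ → ℝ≥0∞, Measurable f → Measurable g →
      ∫⁻ x, ∫⁻ y, f x * k x y * g y ≤ C * (∫⁻ x, f x ^ p) ^ (1 / p) * (∫⁻ x, g x ^ p) ^ (1 / p))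
    {f g : ℝ × ℝ → ℝ≥0∞} (hf : Measurable f) (hg : Measurable g) :
    ∫⁻ z, ∫⁻ w, f z * (k z.1 w.1 * k z.2 w.2) * g w ≤
      C * C * (∫⁻ z, f z ^ p) ^ (1 / p) * (∫⁻ z, g z ^ p) ^ (1 / p) := by
  -- Norms of horizontal slices. The one-dimensional bound is used in (u, u') with v and v' frozen,
  -- and then once more in (v, v') for the slice norms, whose own L^p norm is the norm on the plane.
  set A : (ℝ × ℝ → ℝ≥0∞) → ℝ → ℝ≥0∞ := fun f v => (∫⁻ u, f (u, v) ^ p) ^ (1 / p) with hA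
  have hAm : ∀ f : ℝ × ℝ → ℝ≥0∞, Measurable f → Measurable (A f) := by
    intro f hf
    have : Measurable fun v => ∫⁻ u, f (u, v) ^ p :=
      Measurable.lintegral_prod_left' (f := fun z : ℝ × ℝ => f z ^ p) (hf.pow_const _)
    exact this.pow_const _
  have hAp : ∀ f : ℝ × ℝ → ℝ≥0∞, Measurable f → ∫⁻ v, A f v ^ p = ∫⁻ z, f z ^ p := by
    intro f hf
    rw [Measure.volume_eq_prod, lintegral_prod_symm' _ (hf.pow_const _)]
    apply lintegral_congr; intro v
    simp only [hA]
    rw [← ENNReal.rpow_mul, one_div_mul_cancel hp0.ne', ENNReal.rpow_one]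
  have hm : Measurable fun t : (ℝ × ℝ) × ℝ × ℝ =>
      f (t.2.1, t.1.1) * (k t.2.1 t.2.2 * k t.1.1 t.1.2) * g (t.2.2, t.1.2) := by
    have h1 : Measurable fun t : (ℝ × ℝ) × ℝ × ℝ => f (t.2.1, t.1.1) :=
      hf.comp (f := fun t : (ℝ × ℝ) × ℝ × ℝ => (t.2.1, t.1.1)) (by fun_prop)
    have h2 : Measurable fun t : (ℝ × ℝ) × ℝ × ℝ => g (t.2.2, t.1.2) :=
      hg.comp (f := fun t : (ℝ × ℝ) × ℝ × ℝ => (t.2.2, t.1.2)) (by fun_prop)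
    exact (h1.mul ((hk.comp measurable_snd).mul (hk.comp measurable_fst))).mul h2
  have e : ∫⁻ z, ∫⁻ w, f z * (k z.1 w.1 * k z.2 w.2) * g w = ∫⁻ v, ∫⁻ v', ∫⁻ u, ∫⁻ u',
      f (u, v) * (k u u' * k v v') * g (u', v') := by
    have hm0 : Measurable fun t : (ℝ × ℝ) × ℝ × ℝ =>
        f t.1 * (k t.1.1 t.2.1 * k t.1.2 t.2.2) * g t.2 :=
      hm.comp (f := fun t : (ℝ × ℝ) × ℝ × ℝ => ((t.1.2, t.2.2), (t.1.1, t.2.1))) (by fun_prop)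
    have hm0' : Measurable fun z : ℝ × ℝ => ∫⁻ w : ℝ × ℝ, f z * (k z.1 w.1 * k z.2 w.2) * g w :=
      hm0.lintegral_prod_right' (ν := (volume : Measure (ℝ × ℝ)))
    refine (lintegral_prod_symm' _ hm0').trans ?_
    apply lintegral_congr; intro v
    have : ∀ u, ∫⁻ w : ℝ × ℝ, f (u, v) * (k u w.1 * k v w.2) * g w =
        ∫⁻ v', ∫⁻ u', f (u, v) * (k u u' * k v v') * g (u', v') := by
      intro u
      rw [Measure.volume_eq_prod, lintegral_prod_symm']
      exact hm0.comp (f := fun w : ℝ × ℝ => ((u, v), w)) (by fun_prop)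
    simp only
    calc _ = ∫⁻ u, ∫⁻ v', ∫⁻ u', f (u, v) * (k u u' * k v v') * g (u', v') :=
          lintegral_congr this
      _ = _ := by
          rw [lintegral_lintegral_swap]
          apply Measurable.aemeasurable
          have := hm.comp (f := fun t : (ℝ × ℝ) × ℝ => ((v, t.1.2), (t.1.1, t.2))) (by fun_prop)
          exact this.lintegral_prod_right' (ν := (volume : Measure ℝ))
  rw [e]
  have hin : ∀ v v', ∫⁻ u, ∫⁻ u', f (u, v) * (k u u' * k v v') * g (u', v') ≤
      C * (A f v * k v v' * A g v') := by
    intro v v'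
    have m1 : Measurable fun u => f (u, v) := hf.comp (f := fun u : ℝ => (u, v)) (by fun_prop)
    have m2 : Measurable fun u => g (u, v') := hg.comp (f := fun u : ℝ => (u, v')) (by fun_prop)
    have m3 : Measurable fun z : ℝ × ℝ => f (z.1, v) * k z.1 z.2 * g (z.2, v') :=
      ((m1.comp measurable_fst).mul hk).mul (m2.comp measurable_snd)
    calc _ = ∫⁻ u, ∫⁻ u', k v v' * (f (u, v) * k u u' * g (u', v')) := by
          apply lintegral_congr; intro u
          apply lintegral_congr; intro u'
          ring
      _ = k v v' * ∫⁻ u, ∫⁻ u', f (u, v) * k u u' * g (u', v') := by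
          rw [← lintegral_const_mul _ m3.lintegral_prod_right']
          apply lintegral_congr; intro u
          rw [lintegral_const_mul]
          exact m3.comp (f := fun u' : ℝ => (u, u')) (by fun_prop)
      _ ≤ k v v' * (C * A f v * A g v') := by
          gcongr
          exact hC _ _ m1 m2
      _ = _ := by ring
  calc _ ≤ ∫⁻ v, ∫⁻ v', C * (A f v * k v v' * A g v') :=
        lintegral_mono fun v => lintegral_mono fun v' => hin v v'
    _ = C * ∫⁻ v, ∫⁻ v', A f v * k v v' * A g v' := by
        rw [← lintegral_const_mul' _ _ ENNReal.coe_ne_top]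
        apply lintegral_congr; intro s
        rw [lintegral_const_mul' _ _ ENNReal.coe_ne_top]
    _ ≤ C * (C * (∫⁻ v, A f v ^ p) ^ (1 / p) * (∫⁻ v, A g v ^ p) ^ (1 / p)) := by
        gcongr
        exact hC _ _ (hAm f hf) (hAm g hg)
    _ = _ := by rw [hAp f hf, hAp g hg]; ring

/-- Converse of Hölder's inequality for nonnegative functions. -/
theorem lintegral_rpow_le_of_forall_mul_le {X : Type*} [MeasurableSpace X] (μ : Measure X)
    [SigmaFinite μ] {p q : ℝ} (hpq : p.HolderConjugate q) {g : X → ℝ≥0∞} (hg : Measurable g)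
    {M : ℝ≥0∞} (h : ∀ H : X → ℝ≥0∞, Measurable H → ∫⁻ x, H x * g x ∂μ ≤ M * (∫⁻ x, H x ^ p ∂μ) ^ (1 / p)) :
    (∫⁻ x, g x ^ q ∂μ) ^ (1 / q) ≤ M := by
  have hp0 : 0 < p := hpq.pos
  have hq0 : 0 < q := hpq.symm.pos
  have hq1 : 0 < q - 1 := hpq.symm.sub_one_pos
  -- The bounded truncations have finite `q`-th power integral, so the inequality obtained by
  -- testing with G^{q-1} can be divided by that integral to the power 1/p.
  set G : ℕ → X → ℝ≥0∞ := fun j => (spanningSets μ j).indicator fun x => min (g x) j with hG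
  have hGm : ∀ j, Measurable (G j) := fun j =>
    (hg.min measurable_const).indicator (measurableSet_spanningSets μ j)
  have hGg : ∀ j x, G j x ≤ g x := by
    intro j x
    simp only [hG]
    by_cases hx : x ∈ spanningSets μ j
    · rw [indicator_of_mem hx]; exact min_le_left _ _
    · rw [indicator_of_notMem hx]; exact zero_le
  have hGj : ∀ j x, G j x ≤ (spanningSets μ j).indicator (fun _ => (j : ℝ≥0∞)) x := by
    intro j x
    simp only [hG]
    by_cases hx : x ∈ spanningSets μ j
    · rw [indicator_of_mem hx, indicator_of_mem hx]; exact min_le_right _ _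
    · rw [indicator_of_notMem hx]; exact zero_le
  have hfin : ∀ j, ∫⁻ x, G j x ^ q ∂μ ≠ ⊤ := by
    intro j
    refine ne_top_of_le_ne_top ?_ (lintegral_mono fun x => ENNReal.rpow_le_rpow (hGj j x) hq0.le)
    have : ∀ x, (spanningSets μ j).indicator (fun _ => (j : ℝ≥0∞)) x ^ q
        = (spanningSets μ j).indicator (fun _ => (j : ℝ≥0∞) ^ q) x := by
      intro x
      by_cases hx : x ∈ spanningSets μ j <;> simp [hx, hq0]
    simp_rw [this]
    rw [lintegral_indicator_const (measurableSet_spanningSets μ j)]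
    exact ENNReal.mul_ne_top (ENNReal.rpow_ne_top_of_nonneg hq0.le (ENNReal.natCast_ne_top j))
      (measure_spanningSets_lt_top μ j).ne
  have hI : ∀ j, ∫⁻ x, G j x ^ q ∂μ ≤ M ^ q := by
    intro j
    set I := ∫⁻ x, G j x ^ q ∂μ with hIdef
    have h1 : I ≤ M * I ^ (1 / p) := by
      calc I ≤ ∫⁻ x, G j x ^ (q - 1) * g x ∂μ := by
            apply lintegral_mono; intro x
            calc G j x ^ q = G j x ^ (q - 1) * G j x := by
                  nth_rewrite 3 [← ENNReal.rpow_one (G j x)]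
                  rw [← ENNReal.rpow_add_of_nonneg _ _ hq1.le zero_le_one]; congr 1; ring
              _ ≤ _ := mul_le_mul_right (hGg j x) _
        _ ≤ M * (∫⁻ x, (G j x ^ (q - 1)) ^ p ∂μ) ^ (1 / p) := h _ ((hGm j).pow_const _)
        _ = M * I ^ (1 / p) := by
            congr 2
            apply lintegral_congr; intro x
            rw [← ENNReal.rpow_mul, hpq.symm.sub_one_mul_conj]
    rcases eq_or_ne I 0 with h0 | h0
    · rw [h0]; exact zero_le
    have hpos : I ^ (1 / p) ≠ 0 := by
      rw [ne_eq, ENNReal.rpow_eq_zero_iff_of_pos (by positivity)]; exact h0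
    have htop : I ^ (1 / p) ≠ ⊤ := ENNReal.rpow_ne_top_of_nonneg (by positivity) (hfin j)
    have h2 : I ^ (1 / q) ≤ M := by
      have e : I = I ^ (1 / q) * I ^ (1 / p) := by
        rw [← ENNReal.rpow_add_of_nonneg _ _ (by positivity) (by positivity)]
        have := hpq.inv_add_inv_eq_one
        rw [one_div, one_div, add_comm, this, ENNReal.rpow_one]
      rw [e] at h1
      rw [← e] at h1
      have h3 : I ^ (1 / q) * I ^ (1 / p) ≤ M * I ^ (1 / p) := by rw [← e]; exact h1
      exact (ENNReal.mul_le_mul_iff_left hpos htop).1 h3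
    calc I = (I ^ (1 / q)) ^ q := by
          rw [← ENNReal.rpow_mul, one_div_mul_cancel hq0.ne', ENNReal.rpow_one]
      _ ≤ M ^ q := ENNReal.rpow_le_rpow h2 hq0.le
  have hlim : Filter.Tendsto (fun j => ∫⁻ x, G j x ^ q ∂μ) Filter.atTop
      (nhds (∫⁻ x, g x ^ q ∂μ)) := by
    apply lintegral_tendsto_of_tendsto_of_monotone
    · exact fun j => ((hGm j).pow_const _).aemeasurable
    · refine ae_of_all _ fun x => ?_
      intro i j hij
      apply ENNReal.rpow_le_rpow _ hq0.le
      simp only [hG]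
      by_cases hx : x ∈ spanningSets μ i
      · rw [indicator_of_mem hx, indicator_of_mem (monotone_spanningSets μ hij hx)]
        exact min_le_min le_rfl (by exact_mod_cast hij)
      · rw [indicator_of_notMem hx]; exact zero_le
    · refine ae_of_all _ fun x => ?_
      apply Filter.Tendsto.ennrpow_const
      have h1 : Filter.Tendsto (fun j : ℕ => min (g x) (j : ℝ≥0∞)) Filter.atTop
          (nhds (min (g x) ⊤)) := tendsto_const_nhds.min ENNReal.tendsto_nat_nhds_top
      rw [min_eq_left le_top] at h1
      refine h1.congr' ?_
      have hmem := mem_spanningSetsIndex μ x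
      filter_upwards [Filter.eventually_ge_atTop (spanningSetsIndex μ x)] with j hj
      simp only [hG]
      rw [indicator_of_mem (monotone_spanningSets μ hj hmem)]
  have : ∫⁻ x, g x ^ q ∂μ ≤ M ^ q := le_of_tendsto' hlim hI
  calc _ ≤ (M ^ q) ^ (1 / q) := ENNReal.rpow_le_rpow this (by positivity)
    _ = M := by rw [← ENNReal.rpow_mul, mul_one_div_cancel hq0.ne', ENNReal.rpow_one]

/-! ### The radial wave potential in null coordinates and its weighted bound -/

/-- The radius `|x|` of a point in null coordinates `(u, v) = (t - |x|, t + |x|)`. -/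
noncomputable def nullRadius (p : ℝ × ℝ) : ℝ := (p.2 - p.1) / 2

/-- The radial part of Lebesgue measure on `ℝ^{1+n}`, `n = 2 * k + 1`, in null coordinates. -/
noncomputable def nullMeasure (k : ℕ) : Measure (ℝ × ℝ) :=
  volume.withDensity fun p =>
    {p : ℝ × ℝ | p.1 < p.2}.indicator (fun p => ENNReal.ofReal (1 / 2 * nullRadius p ^ (2 * k))) p

/-- Pairs (point, source) for which the source, in the forward cone, contributes at the point. -/
def influencePairs (k : ℕ) : Set ((ℝ × ℝ) × ℝ × ℝ) :=
  {z | 0 < z.2.1 ∧ z.2.1 < z.2.2 ∧ z.2.1 < z.1.1 ∧ z.1.1 < z.1.2 ∧ z.2.2 < z.1.2 ∧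
    (k ≠ 0 → z.1.1 < z.2.2)}

/-- The positive potential which dominates the radial solution of the wave equation. -/
noncomputable def conePotential (k : ℕ) (f : ℝ × ℝ → ℝ≥0∞) (p : ℝ × ℝ) : ℝ≥0∞ :=
  (ENNReal.ofReal (nullRadius p ^ k))⁻¹ *
    ∫⁻ w, (influencePairs k).indicator (fun z => ENNReal.ofReal (nullRadius z.2 ^ k)) (p, w) * f w

theorem measurable_nullRadius : Measurable nullRadius := by
  unfold nullRadius; fun_prop

theorem measurableSet_influencePairs (k : ℕ) : MeasurableSet (influencePairs k) := by
  unfold influencePairs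
  by_cases hk : k = 0
  · simp only [hk, ne_eq, not_true_eq_false, false_imp_iff, and_true]
    measurability
  · simp only [ne_eq, hk, not_false_eq_true, true_imp_iff]
    measurability

theorem measurableSet_null_lt : MeasurableSet {p : ℝ × ℝ | p.1 < p.2} :=
  measurableSet_lt measurable_fst measurable_snd

theorem measurable_nullDensity (k : ℕ) : Measurable fun p : ℝ × ℝ =>
    {p : ℝ × ℝ | p.1 < p.2}.indicator
      (fun p => ENNReal.ofReal (1 / 2 * nullRadius p ^ (2 * k))) p := by
  have := measurable_nullRadius
  exact Measurable.indicator (by fun_prop) measurableSet_null_lt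

instance (k : ℕ) : SigmaFinite (nullMeasure k) := by
  unfold nullMeasure
  apply SigmaFinite.withDensity_of_ne_top
  refine ae_of_all _ fun p => ?_
  by_cases h : p ∈ {p : ℝ × ℝ | p.1 < p.2}
  · rw [indicator_of_mem h]; exact ENNReal.ofReal_ne_top
  · rw [indicator_of_notMem h]; exact ENNReal.zero_ne_top

theorem measurable_influence_integrand (k : ℕ) {f : ℝ × ℝ → ℝ≥0∞} (hf : Measurable f) :
    Measurable fun z : (ℝ × ℝ) × ℝ × ℝ =>
      (influencePairs k).indicator (fun z => ENNReal.ofReal (nullRadius z.2 ^ k)) z * f z.2 := by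
  have := measurable_nullRadius
  have h : Measurable fun z : (ℝ × ℝ) × ℝ × ℝ => ENNReal.ofReal (nullRadius z.2 ^ k) := by fun_prop
  exact (h.indicator (measurableSet_influencePairs k)).mul (hf.comp measurable_snd)

theorem measurable_conePotential (k : ℕ) {f : ℝ × ℝ → ℝ≥0∞} (hf : Measurable f) :
    Measurable (conePotential k f) := by
  have := measurable_nullRadius
  have h : Measurable fun p => (ENNReal.ofReal (nullRadius p ^ k))⁻¹ := by fun_prop
  exact h.mul (measurable_influence_integrand k hf).lintegral_prod_right'

theorem lintegral_nullMeasure (k : ℕ) {g : ℝ × ℝ → ℝ≥0∞} (hg : Measurable g) :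
    ∫⁻ p, g p ∂(nullMeasure k) = ∫⁻ p, {p : ℝ × ℝ | p.1 < p.2}.indicator
      (fun p => ENNReal.ofReal (1 / 2 * nullRadius p ^ (2 * k))) p * g p := by
  unfold nullMeasure
  rw [lintegral_withDensity_eq_lintegral_mul _ (measurable_nullDensity k) hg]
  rfl

/-- The cone `0 < u` in null coordinates. -/
def nullCone : Set (ℝ × ℝ) := {p | 0 < p.1}

theorem measurableSet_nullCone : MeasurableSet nullCone :=
  measurableSet_lt measurable_const measurable_fst

/-- The powers of u, v, a, b cancel. With r and s the two radii, (r^{2k})^{1/p} = r^{γ+k}, so what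
must be absorbed is r^γ s^γ against (u-a)^γ (v-b)^γ. For k ≥ 1 the hypothesis u < b gives u - a ≤ b
- a = 2s and v - b ≤ v - u = 2r; for k = 0 the exponent γ is zero. -/
theorem influence_kernel_le {k : ℕ} {q α β γ p : ℝ} (hq : 2 < q)
    (hγ : γ = k * (1 - 2 / q)) (hp : 1 / p = 1 - 1 / q) {u v a b : ℝ} (ha : 0 < a) (hab : a < b)
    (hau : a < u) (huv : u < v) (hbv : b < v) (hub : k ≠ 0 → u < b) :
    1 / 2 * ((v - u) / 2) ^ k * ((b - a) / 2) ^ k ≤ 2 * 4 ^ γ *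
      (((u * v) ^ α * (1 / 2 * ((v - u) / 2) ^ (2 * k)) ^ (1 / p)) *
      ((u ^ (-α) * a ^ (-β) * (u - a) ^ (-γ)) * (v ^ (-α) * b ^ (-β) * (v - b) ^ (-γ))) *
      ((a * b) ^ β * (1 / 2 * ((b - a) / 2) ^ (2 * k)) ^ (1 / p))) := by
  have hq0 : 0 < q := by linarith
  have hu : 0 < u := ha.trans hau
  have hv : 0 < v := hu.trans huv
  have hb : 0 < b := ha.trans hab
  have h2q : 0 < 1 - 2 / q := by rw [sub_pos, div_lt_one hq0]; exact hq
  have hγ0 : 0 ≤ γ := by rw [hγ]; positivity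
  set r := (v - u) / 2 with hr
  set s := (b - a) / 2 with hs
  have hr0 : 0 < r := by rw [hr]; linarith
  have hs0 : 0 < s := by rw [hs]; linarith
  have hua : 0 < u - a := by linarith
  have hvb : 0 < v - b := by linarith
  have hmain : (1 : ℝ) ≤ 4 ^ γ * r ^ γ * s ^ γ * (u - a) ^ (-γ) * (v - b) ^ (-γ) := by
    by_cases hk : k = 0
    · have : γ = 0 := by rw [hγ, hk]; simp
      simp [this]
    · have h1 : (u - a) * (v - b) ≤ 4 * r * s := by
        have : u < b := hub hk
        rw [hr, hs]
        nlinarith [mul_le_mul (show u - a ≤ b - a by linarith) (show v - b ≤ v - u by linarith)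
          hvb.le (by linarith)]
      have h2 : ((u - a) * (v - b)) ^ γ ≤ (4 * r * s) ^ γ :=
        Real.rpow_le_rpow (by positivity) h1 hγ0
      rw [Real.mul_rpow hua.le hvb.le, Real.mul_rpow (by positivity) hs0.le,
        Real.mul_rpow (by positivity) hr0.le] at h2
      rw [Real.rpow_neg hua.le, Real.rpow_neg hvb.le, mul_assoc _ _ ((v - b) ^ γ)⁻¹, ← mul_inv,
        ← div_eq_mul_inv, le_div_iff₀ (by positivity)]
      simpa using h2
  have hpow : ∀ x : ℝ, 0 < x → (1 / 2 * x ^ (2 * k)) ^ (1 / p) = (1 / 2) ^ (1 / p) * (x ^ γ * x ^ k) := by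
    intro x hx
    rw [Real.mul_rpow (by positivity) (by positivity), ← Real.rpow_natCast, ← Real.rpow_natCast,
      ← Real.rpow_mul hx.le, ← Real.rpow_add hx, hp, hγ]
    congr 2
    push_cast; field_simp; ring
  -- The factors 1/2 come from the Jacobian in the measure; since 2/p < 2 their product is at least
  -- 1/4, which explains the 2 in the constant.
  have hhalf : (1 / 2 : ℝ) ≤ 2 * ((1 / 2) ^ (1 / p) * (1 / 2) ^ (1 / p)) := by
    rw [← Real.rpow_add (by norm_num), hp]
    have : (1 / 2 : ℝ) ^ (2 : ℝ) ≤ (1 / 2) ^ (1 - 1 / q + (1 - 1 / q)) := by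
      apply Real.rpow_le_rpow_of_exponent_ge (by norm_num) (by norm_num)
      have : 0 < 1 / q := by positivity
      linarith
    norm_num at this ⊢
    linarith
  rw [hpow r hr0, hpow s hs0, Real.mul_rpow hu.le hv.le, Real.mul_rpow ha.le hb.le]
  have cu : u ^ α * u ^ (-α) = 1 := by rw [← Real.rpow_add hu]; simp
  have cv : v ^ α * v ^ (-α) = 1 := by rw [← Real.rpow_add hv]; simp
  have ca : a ^ β * a ^ (-β) = 1 := by rw [← Real.rpow_add ha]; simp
  have cb : b ^ β * b ^ (-β) = 1 := by rw [← Real.rpow_add hb]; simp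
  calc 1 / 2 * r ^ k * s ^ k ≤ (2 * ((1 / 2) ^ (1 / p) * (1 / 2) ^ (1 / p))) * r ^ k * s ^ k *
        (4 ^ γ * r ^ γ * s ^ γ * (u - a) ^ (-γ) * (v - b) ^ (-γ)) := by
        refine le_trans ?_ (le_mul_of_one_le_right (by positivity) hmain)
        gcongr
    _ = (2 * ((1 / 2) ^ (1 / p) * (1 / 2) ^ (1 / p))) * r ^ k * s ^ k *
        (4 ^ γ * r ^ γ * s ^ γ * (u - a) ^ (-γ) * (v - b) ^ (-γ)) *
        ((u ^ α * u ^ (-α)) * (v ^ α * v ^ (-α)) * (a ^ β * a ^ (-β)) * (b ^ β * b ^ (-β))) := by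
        rw [cu, cv, ca, cb]; ring
    _ = _ := by ring

/-- By `influence_kernel_le` the form is dominated by the tensor square of the Stein–Weiss form, in
the pairs (u, a) and (v, b). The hypothesis on `k * (q - 2)` is γ ≤ 2/q in disguise. -/
theorem lintegral_conePotential_bilinear {k : ℕ} {q α β γ p : ℝ} (hq : 2 < q)
    (hkq : k * (q - 2) ≤ 2) (hβ : β < 1 / q) (hγ : γ = k * (1 - 2 / q))
    (h : α + β + γ = 2 / q) (hp : p = q / (q - 1)) :
    ∃ C : ℝ≥0, ∀ G f : ℝ × ℝ → ℝ≥0∞, Measurable G → Measurable f →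
      ∫⁻ z in nullCone, G z * conePotential k f z ∂(nullMeasure k) ≤
        C * (∫⁻ z in nullCone, (ENNReal.ofReal ((z.1 * z.2) ^ α) * G z) ^ p ∂(nullMeasure k)) ^ (1 / p) *
        (∫⁻ z in nullCone, (ENNReal.ofReal ((z.1 * z.2) ^ β) * f z) ^ p ∂(nullMeasure k)) ^ (1 / p) := by
  have hq0 : 0 < q := by linarith
  have hq1 : 0 < q - 1 := by linarith
  have hp0 : 0 < p := by rw [hp]; positivity
  have hp1 : 1 / p = 1 - 1 / q := by rw [hp]; field_simp
  have h2q : 0 < 1 - 2 / q := by rw [sub_pos, div_lt_one hq0]; exact hq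
  have hγ0 : 0 ≤ γ := by rw [hγ]; positivity
  have hγ2 : γ ≤ 2 / q := by
    rw [hγ, le_div_iff₀ hq0]
    have : (k : ℝ) * (1 - 2 / q) * q = k * (q - 2) := by field_simp
    rw [this]; exact hkq
  obtain ⟨C, hC⟩ := lintegral_steinWeiss_bilinear hq hβ hγ0 hγ2 h hp
  have hrad := measurable_nullRadius
  have hD : ∀ δ : ℝ, Measurable fun z : ℝ × ℝ => (nullCone ∩ {p : ℝ × ℝ | p.1 < p.2}).indicator
      (fun z => ENNReal.ofReal ((z.1 * z.2) ^ δ * (1 / 2 * nullRadius z ^ (2 * k)) ^ (1 / p))) z := by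
    intro δ
    exact Measurable.indicator (by fun_prop) (measurableSet_nullCone.inter measurableSet_null_lt)
  -- The density of `nullMeasure` enters to the power 1/p, so that weighted L^p norms for
  -- `nullMeasure` become plain L^p norms for Lebesgue measure.
  set w : ℝ → ℝ × ℝ → ℝ≥0∞ := fun δ z => (nullCone ∩ {p : ℝ × ℝ | p.1 < p.2}).indicator
      (fun z => ENNReal.ofReal ((z.1 * z.2) ^ δ * (1 / 2 * nullRadius z ^ (2 * k)) ^ (1 / p))) z with hw
  have hnorm : ∀ (δ : ℝ) (f : ℝ × ℝ → ℝ≥0∞), Measurable f → ∫⁻ z, (w δ z * f z) ^ p =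
      ∫⁻ z in nullCone, (ENNReal.ofReal ((z.1 * z.2) ^ δ) * f z) ^ p ∂(nullMeasure k) := by
    intro δ f hf
    have m : Measurable fun z : ℝ × ℝ => (ENNReal.ofReal ((z.1 * z.2) ^ δ) * f z) ^ p := by
      fun_prop
    rw [← lintegral_indicator measurableSet_nullCone,
      lintegral_nullMeasure k (m.indicator measurableSet_nullCone)]
    apply lintegral_congr; intro z
    by_cases h1 : z ∈ nullCone
    · by_cases h2 : z ∈ {p : ℝ × ℝ | p.1 < p.2}
      · simp only [hw]
        have hz1 : 0 < z.1 := h1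
        have hz : z.1 < z.2 := h2
        have hr : 0 < nullRadius z := by unfold nullRadius; linarith
        have hz2 : 0 < z.1 * z.2 := mul_pos hz1 (hz1.trans hz)
        rw [indicator_of_mem (by exact ⟨h1, h2⟩), indicator_of_mem h1, indicator_of_mem h2,
          ENNReal.ofReal_mul (by positivity), ENNReal.mul_rpow_of_nonneg _ _ hp0.le,
          ENNReal.mul_rpow_of_nonneg _ _ hp0.le, ENNReal.mul_rpow_of_nonneg _ _ hp0.le,
          ENNReal.ofReal_rpow_of_nonneg (p := p) (x := (1 / 2 * nullRadius z ^ (2 * k)) ^ (1 / p))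
            (by positivity) hp0.le, ← Real.rpow_mul (by positivity),
          one_div_mul_cancel hp0.ne', Real.rpow_one]
        ring
      · simp [hw, h2, hp0]
    · simp [hw, h1, hp0]
  refine ⟨Real.toNNReal (2 * 4 ^ γ) * (C * C), fun G f hG hf => ?_⟩
  have hmf := measurable_conePotential k hf
  have hmi := measurable_influence_integrand k hf
  have hGW : Measurable fun z => G z * conePotential k f z := hG.mul hmf
  rw [← lintegral_indicator measurableSet_nullCone,
    lintegral_nullMeasure k (hGW.indicator measurableSet_nullCone)]
  have hpt : ∀ z, {p : ℝ × ℝ | p.1 < p.2}.indicator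
      (fun p => ENNReal.ofReal (1 / 2 * nullRadius p ^ (2 * k))) z *
      nullCone.indicator (fun z => G z * conePotential k f z) z ≤
      ∫⁻ y, ENNReal.ofReal (2 * 4 ^ γ) * ((w α z * G z) *
        (steinWeiss α β γ z.1 y.1 * steinWeiss α β γ z.2 y.2) * (w β y * f y)) := by
    intro z
    by_cases h1 : z ∈ nullCone
    swap
    · simp [h1]
    by_cases h2 : z ∈ {p : ℝ × ℝ | p.1 < p.2}
    swap
    · simp [h2]
    rw [indicator_of_mem h1, indicator_of_mem h2]
    have hr : 0 < nullRadius z := by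
      have : z.1 < z.2 := h2
      unfold nullRadius; linarith
    unfold conePotential
    have e : ENNReal.ofReal (1 / 2 * nullRadius z ^ (2 * k)) * (ENNReal.ofReal (nullRadius z ^ k))⁻¹
        = ENNReal.ofReal (1 / 2 * nullRadius z ^ k) := by
      rw [← ENNReal.ofReal_inv_of_pos (by positivity), ← ENNReal.ofReal_mul (by positivity)]
      congr 1
      field_simp
      ring
    calc _ = (ENNReal.ofReal (1 / 2 * nullRadius z ^ (2 * k)) * (ENNReal.ofReal (nullRadius z ^ k))⁻¹ * G z)
          * ∫⁻ y, (influencePairs k).indicator (fun z => ENNReal.ofReal (nullRadius z.2 ^ k)) (z, y) * f y := by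
          ring
      _ = ∫⁻ y, (ENNReal.ofReal (1 / 2 * nullRadius z ^ k) * G z) *
          ((influencePairs k).indicator (fun z => ENNReal.ofReal (nullRadius z.2 ^ k)) (z, y) * f y) := by
          rw [e, lintegral_const_mul]
          exact hmi.comp (f := fun y : ℝ × ℝ => (z, y)) (by fun_prop)
      _ ≤ _ := by
          apply lintegral_mono; intro y
          simp only
          by_cases hy : (z, y) ∈ influencePairs k
          swap
          · rw [indicator_of_notMem hy]; simp
          rw [indicator_of_mem hy]
          obtain ⟨ha, hab, hau, huv, hbv, hub⟩ := hy
          simp only at ha hab hau huv hbv hub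
          have hs : 0 < nullRadius y := by unfold nullRadius; linarith
          have hy1 : y ∈ nullCone ∩ {p : ℝ × ℝ | p.1 < p.2} := ⟨ha, hab⟩
          have hu : 0 < z.1 := h1
          have hv : 0 < z.2 := hu.trans huv
          have hb : 0 < y.2 := ha.trans hab
          have hua : 0 < z.1 - y.1 := by linarith
          have hvb : 0 < z.2 - y.2 := by linarith
          simp only [hw]
          rw [indicator_of_mem (by exact ⟨h1, h2⟩), indicator_of_mem hy1]
          unfold steinWeiss
          rw [indicator_of_mem (by exact ⟨ha, hau⟩), indicator_of_mem (by exact ⟨hb, hbv⟩)]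
          have key := influence_kernel_le (k := k) (α := α) (β := β) hq hγ hp1 ha hab hau huv hbv hub
          have key' : ENNReal.ofReal (1 / 2 * ((z.2 - z.1) / 2) ^ k) * ENNReal.ofReal (((y.2 - y.1) / 2) ^ k)
              ≤ ENNReal.ofReal (2 * 4 ^ γ) *
              (ENNReal.ofReal ((z.1 * z.2) ^ α * (1 / 2 * ((z.2 - z.1) / 2) ^ (2 * k)) ^ (1 / p)) *
              (ENNReal.ofReal (z.1 ^ (-α) * y.1 ^ (-β) * (z.1 - y.1) ^ (-γ)) *
              ENNReal.ofReal (z.2 ^ (-α) * y.2 ^ (-β) * (z.2 - y.2) ^ (-γ))) *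
              ENNReal.ofReal ((y.1 * y.2) ^ β * (1 / 2 * ((y.2 - y.1) / 2) ^ (2 * k)) ^ (1 / p))) := by
            unfold nullRadius at hr hs
            rw [← ENNReal.ofReal_mul (by positivity), ← ENNReal.ofReal_mul (by positivity),
              ← ENNReal.ofReal_mul (by positivity), ← ENNReal.ofReal_mul (by positivity),
              ← ENNReal.ofReal_mul (by positivity)]
            exact ENNReal.ofReal_le_ofReal key
          calc _ = (ENNReal.ofReal (1 / 2 * nullRadius z ^ k) * ENNReal.ofReal (nullRadius y ^ k)) * (G z * f y) := by
                ring
            _ ≤ _ := mul_le_mul_left (by exact key') _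
            _ = _ := by simp only [nullRadius]; ring
  refine (lintegral_mono hpt).trans ?_
  have hCC := lintegral_tensor_bilinear hp0 (measurable_steinWeiss α β γ) hC ((hD α).mul hG) ((hD β).mul hf)
  calc _ = ENNReal.ofReal (2 * 4 ^ γ) * ∫⁻ z, ∫⁻ y, (w α z * G z) *
        (steinWeiss α β γ z.1 y.1 * steinWeiss α β γ z.2 y.2) * (w β y * f y) := by
        rw [← lintegral_const_mul' _ _ ENNReal.ofReal_ne_top]
        apply lintegral_congr; intro s
        rw [lintegral_const_mul' _ _ ENNReal.ofReal_ne_top]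
    _ ≤ ENNReal.ofReal (2 * 4 ^ γ) * (C * C * (∫⁻ z, (w α z * G z) ^ p) ^ (1 / p) *
        (∫⁻ z, (w β z * f z) ^ p) ^ (1 / p)) := by gcongr; exact hCC
    _ = _ := by
        rw [hnorm α G hG, hnorm β f hf]
        push_cast
        rw [← ENNReal.ofReal.eq_def]
        ring

/-- Duality: in the bilinear bound take G = (uv)^{-α}H. The weight (uv)^α on G then cancels, because
uv > 0 almost everywhere on the cone. -/
theorem lintegral_conePotential_le {k : ℕ} {q α β γ p : ℝ} (hq : 2 < q)
    (hkq : k * (q - 2) ≤ 2) (hβ : β < 1 / q) (hγ : γ = k * (1 - 2 / q))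
    (h : α + β + γ = 2 / q) (hp : p = q / (q - 1)) :
    ∃ C : ℝ≥0, ∀ f : ℝ × ℝ → ℝ≥0∞, Measurable f →
      (∫⁻ z in nullCone, (ENNReal.ofReal ((z.1 * z.2) ^ (-α)) * conePotential k f z) ^ q
        ∂(nullMeasure k)) ^ (1 / q) ≤ C *
      (∫⁻ z in nullCone, (ENNReal.ofReal ((z.1 * z.2) ^ β) * f z) ^ p ∂(nullMeasure k)) ^ (1 / p) := by
  obtain ⟨C, hC⟩ := lintegral_conePotential_bilinear hq hkq hβ hγ h hp
  have hpq : p.HolderConjugate q := by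
    rw [hp]
    exact (Real.HolderConjugate.conjExponent (by linarith : 1 < q)).symm
  refine ⟨C, fun f hf => ?_⟩
  have hmf := measurable_conePotential k hf
  have hwt : ∀ δ : ℝ, Measurable fun z : ℝ × ℝ => ENNReal.ofReal ((z.1 * z.2) ^ δ) := by
    intro δ; fun_prop
  apply lintegral_rpow_le_of_forall_mul_le _ hpq ((hwt _).mul hmf)
  intro H hH
  have := hC (fun z => ENNReal.ofReal ((z.1 * z.2) ^ (-α)) * H z) f ((hwt _).mul hH) hf
  calc _ = ∫⁻ z in nullCone, ENNReal.ofReal ((z.1 * z.2) ^ (-α)) * H z * conePotential k f z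
        ∂(nullMeasure k) := by
        apply lintegral_congr; intro z
        simp only [Pi.mul_apply]; ring
    _ ≤ _ := this
    _ = _ := by
        rw [mul_right_comm]
        congr 2
        have hae : ∀ᵐ z ∂((nullMeasure k).restrict nullCone), 0 < z.1 * z.2 := by
          rw [ae_restrict_iff' measurableSet_nullCone]
          unfold nullMeasure
          rw [ae_withDensity_iff (measurable_nullDensity k)]
          refine ae_of_all _ fun z hz h0 => ?_
          have h1 : 0 < z.1 := h0
          have h2 : z ∈ {p : ℝ × ℝ | p.1 < p.2} := by
            by_contra hcon
            exact hz (indicator_of_notMem hcon _)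
          exact mul_pos h1 (h1.trans h2)
        apply lintegral_congr_ae
        filter_upwards [hae] with z hz
        rw [← mul_assoc, ← ENNReal.ofReal_mul (by positivity), ← Real.rpow_add hz]
        simp

/-! ### Lebesgue measure in null polar coordinates -/

/-- The linear change of variables factors into a translation r = v - t for fixed t and an affine
substitution t = (u+v)/2 for fixed v; the second produces the Jacobian 1/2. -/
theorem lintegral_time_radius_eq {F : ℝ × ℝ → ℝ≥0∞} (hF : Measurable F) :
    ∫⁻ t, ∫⁻ r, F (t, r) = ∫⁻ p : ℝ × ℝ, ENNReal.ofReal (1 / 2) * F ((p.1 + p.2) / 2, (p.2 - p.1) / 2) := by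
  have m1 : Measurable fun z : ℝ × ℝ => F (z.1, z.2 - z.1) :=
    hF.comp (f := fun z : ℝ × ℝ => (z.1, z.2 - z.1)) (by fun_prop)
  have m2 : Measurable fun p : ℝ × ℝ => F ((p.1 + p.2) / 2, (p.2 - p.1) / 2) :=
    hF.comp (f := fun p : ℝ × ℝ => ((p.1 + p.2) / 2, (p.2 - p.1) / 2)) (by fun_prop)
  have h1 : ∀ t, ∫⁻ r, F (t, r) = ∫⁻ v, F (t, v - t) := fun t =>
    (lintegral_sub_right_eq_self (fun r => F (t, r)) t).symm
  simp_rw [h1]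
  rw [lintegral_lintegral_swap m1.aemeasurable, Measure.volume_eq_prod,
    lintegral_prod_symm' _ (m2.const_mul _)]
  apply lintegral_congr; intro v
  have m3 : Measurable fun t => F (t, v - t) := m1.comp (f := fun t : ℝ => (t, v)) (by fun_prop)
  have m4 : Measurable fun t => F ((t + v) / 2, (v - t) / 2) :=
    m2.comp (f := fun t : ℝ => (t, v)) (by fun_prop)
  rw [lintegral_const_mul _ m4]
  have h2 : ∫⁻ t, F (t, v - t) = ∫⁻ t, F (t + v / 2, v / 2 - t) := by
    rw [← lintegral_add_right_eq_self (fun t => F (t, v - t)) (v / 2)]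
    apply lintegral_congr; intro t; congr 2; ring
  rw [h2]
  have m5 : Measurable fun t => F (t + v / 2, v / 2 - t) :=
    hF.comp (f := fun t : ℝ => (t + v / 2, v / 2 - t)) (by fun_prop)
  have h3 := Real.smul_map_volume_mul_left (a := (1 / 2 : ℝ)) (by norm_num)
  rw [abs_of_pos (by norm_num : (0 : ℝ) < 1 / 2)] at h3
  nth_rewrite 1 [← h3]
  rw [lintegral_smul_measure, smul_eq_mul, lintegral_map m5 (by fun_prop)]
  congr 1
  apply lintegral_congr; intro t; congr 2 <;> ring

/-- The point of `ℝ × E` with null coordinates `p` in the direction `θ`. -/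
noncomputable def nullPoint {E : Type*} [NormedAddCommGroup E] [NormedSpace ℝ E]
    (z : Metric.sphere (0 : E) 1 × ℝ × ℝ) : ℝ × E :=
  ((z.2.1 + z.2.2) / 2, nullRadius z.2 • (z.1 : E))

theorem continuous_nullPoint {E : Type*} [NormedAddCommGroup E] [NormedSpace ℝ E] : Continuous (nullPoint (E := E)) := by
  unfold nullPoint nullRadius
  fun_prop

section Polar

variable {E : Type*} [NormedAddCommGroup E] [NormedSpace ℝ E] [FiniteDimensional ℝ E]
  [MeasureSpace E] [BorelSpace E] [(volume : Measure E).IsAddHaarMeasure] [Nontrivial E]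

theorem lintegral_eq_lintegral_sphere {h : E → ℝ≥0∞} (hh : Measurable h) :
    ∫⁻ x, h x = ∫⁻ θ, (∫⁻ r in Ioi (0 : ℝ),
      ENNReal.ofReal (r ^ (Module.finrank ℝ E - 1)) * h (r • (θ : E))) ∂(volume : Measure E).toSphere := by
  have hp := (volume : Measure E).measurePreserving_homeomorphUnitSphereProd
  have m1 : Measurable fun z : Metric.sphere (0 : E) 1 × ℝ => h (z.2 • (z.1 : E)) :=
    hh.comp (f := fun z : Metric.sphere (0 : E) 1 × ℝ => z.2 • (z.1 : E)) (by fun_prop)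
  have m2 : Measurable fun z : Metric.sphere (0 : E) 1 × Ioi (0 : ℝ) => h ((z.2 : ℝ) • (z.1 : E)) :=
    m1.comp (f := fun z : Metric.sphere (0 : E) 1 × Ioi (0 : ℝ) => (z.1, (z.2 : ℝ))) (by fun_prop)
  calc ∫⁻ x, h x = ∫⁻ x in ({0}ᶜ : Set E), h x := by rw [restrict_compl_singleton]
    _ = ∫⁻ x : ({0}ᶜ : Set E), h (x : E) ∂((volume : Measure E).comap Subtype.val) :=
        (lintegral_subtype_comap (measurableSet_singleton _).compl h).symm
    _ = ∫⁻ x : ({0}ᶜ : Set E), (fun z : Metric.sphere (0 : E) 1 × Ioi (0 : ℝ) => h ((z.2 : ℝ) • (z.1 : E)))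
          (homeomorphUnitSphereProd E x) ∂((volume : Measure E).comap Subtype.val) := by
        apply lintegral_congr; intro x
        have := (homeomorphUnitSphereProd E).symm_apply_apply x
        have h2 := congrArg Subtype.val this
        simp only [homeomorphUnitSphereProd_symm_apply_coe] at h2
        simp only
        rw [h2]
    _ = ∫⁻ z, h ((z.2 : ℝ) • (z.1 : E)) ∂((volume : Measure E).toSphere.prod
          (Measure.volumeIoiPow (Module.finrank ℝ E - 1))) := hp.lintegral_comp m2
    _ = _ := by
        rw [lintegral_prod _ m2.aemeasurable]
        apply lintegral_congr; intro θ
        have m3 : Measurable fun r : ℝ => h (r • (θ : E)) := m1.comp (f := fun r : ℝ => (θ, r)) (by fun_prop)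
        have m8 : Measurable fun r : Ioi (0 : ℝ) => h ((r : ℝ) • (θ : E)) :=
          m3.comp measurable_subtype_coe
        rw [Measure.volumeIoiPow, lintegral_withDensity_eq_lintegral_mul _ (by fun_prop) m8]
        exact lintegral_subtype_comap measurableSet_Ioi
          (fun r : ℝ => ENNReal.ofReal (r ^ (Module.finrank ℝ E - 1)) * h (r • (θ : E)))

theorem measurePreserving_nullPoint {k : ℕ} (hk : Module.finrank ℝ E = 2 * k + 1) :
    MeasurePreserving (nullPoint (E := E)) ((volume : Measure E).toSphere.prod (nullMeasure k))
      (volume : Measure (ℝ × E)) := by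
  refine ⟨continuous_nullPoint.measurable, ?_⟩
  apply Measure.ext_of_lintegral
  intro g hg
  have m7 : Measurable fun z : Metric.sphere (0 : E) 1 × ℝ × ℝ => g (nullPoint z) :=
    hg.comp continuous_nullPoint.measurable
  rw [lintegral_map hg continuous_nullPoint.measurable,
    lintegral_prod _ m7.aemeasurable,
    Measure.volume_eq_prod, lintegral_prod _ hg.aemeasurable]
  have m0 : Measurable fun z : Metric.sphere (0 : E) 1 × ℝ × ℝ =>
      (Ioi (0 : ℝ)).indicator (fun r => ENNReal.ofReal (r ^ (2 * k)) * g (z.2.1, r • (z.1 : E))) z.2.2 := by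
    have : (fun z : Metric.sphere (0 : E) 1 × ℝ × ℝ =>
      (Ioi (0 : ℝ)).indicator (fun r => ENNReal.ofReal (r ^ (2 * k)) * g (z.2.1, r • (z.1 : E))) z.2.2)
      = {z : Metric.sphere (0 : E) 1 × ℝ × ℝ | 0 < z.2.2}.indicator
        fun z => ENNReal.ofReal (z.2.2 ^ (2 * k)) * g (z.2.1, z.2.2 • (z.1 : E)) := by
      ext z; simp [indicator]
    rw [this]
    refine Measurable.indicator ?_ (measurableSet_lt measurable_const (by fun_prop))
    exact Measurable.mul (by fun_prop) (hg.comp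
      (f := fun z : Metric.sphere (0 : E) 1 × ℝ × ℝ => (z.2.1, z.2.2 • (z.1 : E))) (by fun_prop))
  have e1 : ∀ t, ∫⁻ x : E, g (t, x) = ∫⁻ θ, (∫⁻ r, (Ioi (0 : ℝ)).indicator
      (fun r => ENNReal.ofReal (r ^ (2 * k)) * g (t, r • (θ : E))) r) ∂(volume : Measure E).toSphere := by
    intro t
    have m9 : Measurable fun x : E => g (t, x) := hg.comp (by fun_prop)
    rw [lintegral_eq_lintegral_sphere m9, hk]
    apply lintegral_congr; intro θ
    rw [← lintegral_indicator measurableSet_Ioi]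
    rfl
  simp_rw [e1]
  rw [lintegral_lintegral_swap (μ := (volume : Measure ℝ))]
  · apply lintegral_congr; intro θ
    have mθ := m0.comp (f := fun p : ℝ × ℝ => (θ, p)) (by fun_prop)
    have := lintegral_time_radius_eq mθ
    refine Eq.trans ?_ this.symm
    have m10 : Measurable fun p : ℝ × ℝ => g (nullPoint (θ, p)) := m7.comp (by fun_prop)
    rw [lintegral_nullMeasure k m10]
    apply lintegral_congr; intro p
    by_cases hp : p.1 < p.2
    · have hr : 0 < (p.2 - p.1) / 2 := by linarith
      rw [indicator_of_mem (by exact hp)]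
      simp only [Function.comp]
      rw [indicator_of_mem (show (p.2 - p.1) / 2 ∈ Ioi 0 from hr), ENNReal.ofReal_mul (by norm_num),
        mul_assoc]
      rfl
    · have hr : ¬ (0 < (p.2 - p.1) / 2) := by intro h; apply hp; linarith
      rw [indicator_of_notMem (by exact hp)]
      simp only [Function.comp]
      rw [indicator_of_notMem (show (p.2 - p.1) / 2 ∉ Ioi 0 from hr)]
      simp
  · have m6 : Measurable fun z : (ℝ × Metric.sphere (0 : E) 1) × ℝ =>
        (Ioi (0 : ℝ)).indicator (fun r => ENNReal.ofReal (r ^ (2 * k)) * g (z.1.1, r • (z.1.2 : E))) z.2 :=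
      m0.comp (f := fun z : (ℝ × Metric.sphere (0 : E) 1) × ℝ => (z.1.2, (z.1.1, z.2))) (by fun_prop)
    exact (m6.lintegral_prod_right' (ν := (volume : Measure ℝ))).aemeasurable

end Polar

/-! ### The Riemann function of the radial wave operator -/

/-- Coefficients of the Legendre polynomial of degree `k - 1` in the variable `(1 - μ) / 2`. -/
noncomputable def riemannCoeff (k : ℕ) : ℕ → ℝ
  | 0 => 1
  | j + 1 => ((j : ℝ) * (j + 1) - k * (k - 1)) / (j + 1) ^ 2 * riemannCoeff k j

/-- The recursion factor j(j+1) - k(k-1) vanishes at j = k - 1, or at j = 0 if k = 0, and stops the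
series. This bound leaves one spare degree for k ≥ 1 in order to include k = 0. -/
theorem riemannCoeff_eq_zero {k j : ℕ} (h : k < j) : riemannCoeff k j = 0 := by
  induction j with
  | zero => omega
  | succ j ih =>
    rw [riemannCoeff]
    by_cases hj : k < j
    · rw [ih hj, mul_zero]
    · obtain rfl : j = k := by omega
      rcases Nat.eq_zero_or_pos j with rfl | hpos
      · simp
      · obtain ⟨i, rfl⟩ : ∃ i, j = i + 1 := ⟨j - 1, by omega⟩
        rw [riemannCoeff]
        push_cast
        ring

/-- The polynomial giving the Riemann function of `∂ᵤ∂ᵥ + k(k-1)/(v-u)²`. -/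
noncomputable def riemannPoly (k : ℕ) : Polynomial ℝ :=
  ∑ j ∈ Finset.range (k + 1), Polynomial.monomial j (riemannCoeff k j)

theorem riemannPoly_coeff (k j : ℕ) : (riemannPoly k).coeff j = riemannCoeff k j := by
  unfold riemannPoly
  rw [Polynomial.finsetSum_coeff]
  simp only [Polynomial.coeff_monomial]
  rw [Finset.sum_ite_eq']
  split_ifs with h
  · rfl
  · rw [riemannCoeff_eq_zero]; simpa using h

theorem riemannPoly_eval_zero (k : ℕ) : (riemannPoly k).eval 0 = 1 := by
  rw [← Polynomial.coeff_zero_eq_eval_zero, riemannPoly_coeff, riemannCoeff]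

/-- Legendre's equation for ν = k - 1, where ν(ν+1) = k(k-1), transported to [0,1]. Compared
coefficient by coefficient it is exactly the recursion defining `riemannCoeff`. -/
theorem riemannPoly_ode (k : ℕ) :
    Polynomial.X * (1 - Polynomial.X) * (riemannPoly k).derivative.derivative +
      (1 - 2 * Polynomial.X) * (riemannPoly k).derivative
      + Polynomial.C ((k : ℝ) * (k - 1)) * riemannPoly k = 0 := by
  have e : Polynomial.X * (1 - Polynomial.X) * (riemannPoly k).derivative.derivative +
      (1 - 2 * Polynomial.X) * (riemannPoly k).derivative
      + Polynomial.C ((k : ℝ) * (k - 1)) * riemannPoly k =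
      Polynomial.X * (riemannPoly k).derivative.derivative
      - Polynomial.X * (Polynomial.X * (riemannPoly k).derivative.derivative)
      + (riemannPoly k).derivative - Polynomial.C 2 * (Polynomial.X * (riemannPoly k).derivative)
      + Polynomial.C ((k : ℝ) * (k - 1)) * riemannPoly k := by
    have : (Polynomial.C 2 : Polynomial ℝ) = 2 := rfl
    rw [this]; ring
  rw [e]
  ext j
  simp only [Polynomial.coeff_add, Polynomial.coeff_sub, Polynomial.coeff_C_mul,
    Polynomial.coeff_zero]
  rcases j with _ | _ | j
  · simp only [Polynomial.mul_coeff_zero, Polynomial.coeff_X_zero, Polynomial.coeff_derivative,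
      riemannPoly_coeff, riemannCoeff]
    push_cast; ring
  · simp only [Polynomial.coeff_X_mul, Polynomial.mul_coeff_zero, Polynomial.coeff_X_zero,
      Polynomial.coeff_derivative, riemannPoly_coeff, riemannCoeff]
    push_cast; ring
  · simp only [Polynomial.coeff_X_mul, Polynomial.coeff_derivative, riemannPoly_coeff,
      riemannCoeff]
    push_cast
    field_simp
    ring

/-- The Riemann function with vertex `(a, b)`. -/
noncomputable def riemannArg (a b u v : ℝ) : ℝ := (u - a) * (v - b) / ((v - u) * (b - a))

noncomputable def riemannFun (k : ℕ) (a b u v : ℝ) : ℝ := (riemannPoly k).eval (riemannArg a b u v)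

/-- The `v`-derivative of `riemannFun`. Its factor u - a removes the boundary term on the side u =
a, and its factor b - u the one that arises when the side u = c tends to u = b. -/
noncomputable def riemannFunV (k : ℕ) (a b u v : ℝ) : ℝ :=
  (riemannPoly k).derivative.eval (riemannArg a b u v) *
    ((u - a) * (b - u) / ((b - a) * (v - u) ^ 2))

theorem hasDerivAt_riemannArg_right {a b u v : ℝ} (hab : a < b) (huv : u < v) :
    HasDerivAt (fun v => riemannArg a b u v) ((u - a) * (b - u) / ((b - a) * (v - u) ^ 2)) v := by
  unfold riemannArg
  have h1 : b - a ≠ 0 := by linarith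
  have h2 : v - u ≠ 0 := by linarith
  have := (((hasDerivAt_id v).sub_const b).const_mul (u - a)).div
    (((hasDerivAt_id v).sub_const u).mul_const (b - a)) (mul_ne_zero h2 h1)
  refine this.congr_deriv ?_
  simp only [id]
  field_simp
  ring

theorem hasDerivAt_riemannArg_left {a b u v : ℝ} (hab : a < b) (huv : u < v) :
    HasDerivAt (fun u => riemannArg a b u v) ((v - b) * (v - a) / ((b - a) * (v - u) ^ 2)) u := by
  unfold riemannArg
  have h1 : b - a ≠ 0 := by linarith
  have h2 : v - u ≠ 0 := by linarith
  have := (((hasDerivAt_id u).sub_const a).mul_const (v - b)).div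
    (((hasDerivAt_id u).const_sub v).mul_const (b - a)) (mul_ne_zero h2 h1)
  refine this.congr_deriv ?_
  simp only [id]
  field_simp
  ring

theorem hasDerivAt_riemannFun_right (k : ℕ) {a b u v : ℝ} (hab : a < b) (huv : u < v) :
    HasDerivAt (fun v => riemannFun k a b u v) (riemannFunV k a b u v) v :=
  ((riemannPoly k).hasDerivAt _).comp v (hasDerivAt_riemannArg_right hab huv)

/-- For z = `riemannArg` one has zᵤzᵥ = z(1-z)/(v-u)² and zᵤᵥ = (1-2z)/(v-u)², so the chain rule
turns Legendre's equation for the polynomial into ∂ᵤ∂ᵥR + k(k-1)/(v-u)² R = 0. -/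
theorem hasDerivAt_riemannFunV_left (k : ℕ) {a b u v : ℝ} (hab : a < b) (huv : u < v) :
    HasDerivAt (fun u => riemannFunV k a b u v)
      (-((k : ℝ) * (k - 1)) / (v - u) ^ 2 * riemannFun k a b u v) u := by
  have h1 : b - a ≠ 0 := by linarith
  have h2 : v - u ≠ 0 := by linarith
  have hz := hasDerivAt_riemannArg_left hab huv
  have hd := ((riemannPoly k).derivative.hasDerivAt (riemannArg a b u v)).comp u hz
  have hw : HasDerivAt (fun u => (u - a) * (b - u) / ((b - a) * (v - u) ^ 2))
      ((1 - 2 * riemannArg a b u v) / (v - u) ^ 2) u := by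
    have := (((hasDerivAt_id u).sub_const a).mul ((hasDerivAt_id u).const_sub b)).div
      ((((hasDerivAt_id u).const_sub v).pow 2).const_mul (b - a))
      (mul_ne_zero h1 (pow_ne_zero 2 h2))
    refine this.congr_deriv ?_
    simp only [riemannArg, id, Pi.pow_apply, Pi.mul_apply]
    change (((1 : ℝ) * (b - u) + (u - a) * -1) * ((b - a) * (v - u) ^ 2) -
      (u - a) * (b - u) * ((b - a) * ((2 : ℕ) * (v - u) ^ (2 - 1) * -1))) /
      ((b - a) * (v - u) ^ 2) ^ 2 = _
    field_simp
    ring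
  have hode := congrArg (Polynomial.eval (riemannArg a b u v)) (riemannPoly_ode k)
  simp only [Polynomial.eval_add, Polynomial.eval_mul, Polynomial.eval_sub, Polynomial.eval_X,
    Polynomial.eval_one, Polynomial.eval_C, Polynomial.eval_zero, Polynomial.eval_ofNat] at hode
  have hmul := hd.mul hw
  unfold riemannFunV riemannFun
  refine hmul.congr_deriv (Eq.symm ?_)
  simp only [Function.comp]
  set z := riemannArg a b u v with hzdef
  have hzz : (v - b) * (v - a) / ((b - a) * (v - u) ^ 2) * ((u - a) * (b - u) / ((b - a) * (v - u) ^ 2))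
      = z * (1 - z) / (v - u) ^ 2 := by
    rw [hzdef]; unfold riemannArg; field_simp; ring
  calc -((k : ℝ) * (k - 1)) / (v - u) ^ 2 * Polynomial.eval z (riemannPoly k)
      = (z * (1 - z) / (v - u) ^ 2) * Polynomial.eval z (riemannPoly k).derivative.derivative
        + Polynomial.eval z (riemannPoly k).derivative * ((1 - 2 * z) / (v - u) ^ 2) := by
        field_simp; linarith
    _ = _ := by rw [← hzz]; ring

theorem riemannFun_bottom (k : ℕ) (a b u : ℝ) : riemannFun k a b u b = 1 := by
  unfold riemannFun riemannArg
  simp [riemannPoly_eval_zero]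

theorem riemannFunV_left (k : ℕ) (a b v : ℝ) : riemannFunV k a b a v = 0 := by
  unfold riemannFunV; simp

/-- Uniform bounds for the Riemann function and its logarithmic derivative. -/
theorem exists_riemannPoly_bound (k : ℕ) : ∃ M : ℝ, 0 < M ∧ ∀ z ∈ Icc (0 : ℝ) 1,
    |(riemannPoly k).eval z| ≤ M ∧ |(riemannPoly k).derivative.eval z| ≤ M := by
  obtain ⟨M1, h1⟩ := isCompact_Icc.exists_bound_of_continuousOn (s := Icc (0 : ℝ) 1)
    (f := fun z => (riemannPoly k).eval z) (riemannPoly k).continuous.continuousOn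
  obtain ⟨M2, h2⟩ := isCompact_Icc.exists_bound_of_continuousOn (s := Icc (0 : ℝ) 1)
    (f := fun z => (riemannPoly k).derivative.eval z) (riemannPoly k).derivative.continuous.continuousOn
  refine ⟨max 1 (max M1 M2), by positivity, fun z hz => ⟨?_, ?_⟩⟩
  · exact (h1 z hz).trans ((le_max_left _ _).trans (le_max_right _ _))
  · exact (h2 z hz).trans ((le_max_right _ _).trans (le_max_right _ _))

/-- The difference to 1 is (v-a)(b-u)/((v-u)(b-a)) ≥ 0. This is what makes the Riemann function
uniformly bounded on its domain of influence, up to the axis. -/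
theorem riemannArg_mem_Icc {a b u v : ℝ} (hab : a < b) (hau : a ≤ u) (hub : u ≤ b) (hbv : b ≤ v)
    (huv : u < v) : riemannArg a b u v ∈ Icc (0 : ℝ) 1 := by
  unfold riemannArg
  have h1 : 0 < (v - u) * (b - a) := mul_pos (by linarith) (by linarith)
  refine ⟨div_nonneg (mul_nonneg (by linarith) (by linarith)) h1.le, ?_⟩
  rw [div_le_one h1]
  nlinarith [mul_nonneg (show 0 ≤ v - a by linarith) (show 0 ≤ b - u by linarith)]

theorem measurable_riemannFun (k : ℕ) :
    Measurable fun z : (ℝ × ℝ) × ℝ × ℝ => riemannFun k z.2.1 z.2.2 z.1.1 z.1.2 := by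
  unfold riemannFun riemannArg
  exact (riemannPoly k).continuous.measurable.comp (by fun_prop)

/-! ### Riemann's method and the representation formula -/

/-- `A` has continuous derivatives `∂ᵤA = Au`, `∂ᵥA = Av` and `∂ᵥ∂ᵤA = Auv`. -/
structure HasNullDerivs (A Au Av Auv : ℝ → ℝ → ℝ) : Prop where
  deriv_u : ∀ u v, HasDerivAt (fun u => A u v) (Au u v) u
  deriv_v : ∀ u v, HasDerivAt (fun v => A u v) (Av u v) v
  deriv_uv : ∀ u v, HasDerivAt (fun v => Au u v) (Auv u v) v
  cont : Continuous fun p : ℝ × ℝ => A p.1 p.2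
  cont_u : Continuous fun p : ℝ × ℝ => Au p.1 p.2
  cont_v : Continuous fun p : ℝ × ℝ => Av p.1 p.2
  cont_uv : Continuous fun p : ℝ × ℝ => Auv p.1 p.2

theorem hasDerivAt_pow_of_ne (k : ℕ) {s : ℝ} (hs : s ≠ 0) :
    HasDerivAt (fun s : ℝ => s ^ k) (k * s ^ k / s) s := by
  refine (hasDerivAt_pow k s).congr_deriv ?_
  rcases k with _ | k
  · simp
  · simp only [Nat.add_sub_cancel]; field_simp; ring

section Rectangle

variable {k : ℕ} {A Au Av Auv : ℝ → ℝ → ℝ}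

/-- Riemann's method on the rectangle `[a, c] × [b, T]`, away from the axis `u = v`. -/
theorem riemann_rectangle (hA : HasNullDerivs A Au Av Auv) {g : ℝ → ℝ → ℝ}
    (hg : ∀ u v, u < v → Auv u v - k / (v - u) * (Av u v - Au u v) = g u v)
    {a b c T : ℝ} (hac : a < c) (hcb : c < b) (hbT : b < T)
    (hT : ∀ u ∈ Icc a b, A u T = 0 ∧ Au u T = 0) :
    ∫ u in a..c, ∫ v in b..T, riemannFun k a b u v * ((v - u) ^ k * g u v) =
      (b - a) ^ k * A a b - (b - c) ^ k * A c b
        - ∫ v in b..T, (v - c) ^ k * A c v * riemannFunV k a b c v := by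
  have hab : a < b := hac.trans hcb
  set R := riemannFun k a b with hR
  set Rv := riemannFunV k a b with hRv
  -- Multiplication by (v-u)^k removes the first-order terms: Vᵤᵥ + Q V = (v-u)^k g.
  set V : ℝ → ℝ → ℝ := fun u v => (v - u) ^ k * A u v with hV
  set Vu : ℝ → ℝ → ℝ := fun u v => (v - u) ^ k * (Au u v - k * A u v / (v - u)) with hVu
  set Q : ℝ → ℝ → ℝ := fun u v => (k : ℝ) * (k - 1) / (v - u) ^ 2 with hQ
  have lt_of : ∀ {u v : ℝ}, u ∈ Icc a c → v ∈ Icc b T → u < v := fun hu hv =>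
    lt_of_le_of_lt hu.2 (hcb.trans_le hv.1)
  have dV : ∀ u v, u < v → HasDerivAt (fun u => V u v) (Vu u v) u := by
    intro u v huv
    have hs : v - u ≠ 0 := by linarith
    have h1 : HasDerivAt (fun u => (v - u) ^ k) (k * (v - u) ^ k / (v - u) * -1) u :=
      (hasDerivAt_pow_of_ne k hs).comp u ((hasDerivAt_id u).const_sub v)
    refine (h1.mul (hA.deriv_u u v)).congr_deriv ?_
    simp only [hVu]; field_simp; ring
  have dVu : ∀ u v, u < v → HasDerivAt (fun v => Vu u v) ((v - u) ^ k * g u v - Q u v * V u v) v := by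
    intro u v huv
    have hs : v - u ≠ 0 := by linarith
    have h1 : HasDerivAt (fun v => (v - u) ^ k) (k * (v - u) ^ k / (v - u) * 1) v :=
      (hasDerivAt_pow_of_ne k hs).comp v ((hasDerivAt_id v).sub_const u)
    have h2 := (hA.deriv_uv u v).sub
      (((hA.deriv_v u v).const_mul (k : ℝ)).div ((hasDerivAt_id v).sub_const u) hs)
    refine (h1.mul h2).congr_deriv ?_
    simp only [hQ, hV, id, ← hg u v huv]
    change k * (v - u) ^ k / (v - u) * 1 * (Au u v - k * A u v / (v - u)) + (v - u) ^ k *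
      (Auv u v - (k * Av u v * (v - u) - k * A u v * 1) / (v - u) ^ 2) = _
    field_simp; ring
  have dR : ∀ u v, u < v → HasDerivAt (fun v => R u v) (Rv u v) v := fun u v h =>
    hasDerivAt_riemannFun_right k hab h
  have dRv : ∀ u v, u < v → HasDerivAt (fun u => Rv u v) (-Q u v * R u v) u := by
    intro u v h
    refine (hasDerivAt_riemannFunV_left k hab h).congr_deriv ?_
    simp only [hQ, hR]; ring
  -- continuity on the rectangle
  set S : Set (ℝ × ℝ) := Icc a c ×ˢ Icc b T with hS
  have hne : ∀ p ∈ S, p.2 - p.1 ≠ 0 := fun p hp => by linarith [lt_of hp.1 hp.2]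
  have hba : b - a ≠ 0 := by linarith
  have cz : ContinuousOn (fun p : ℝ × ℝ => riemannArg a b p.1 p.2) S := by
    unfold riemannArg
    exact ContinuousOn.div (by fun_prop) (by fun_prop) fun p hp => mul_ne_zero (hne p hp) hba
  have cR : ContinuousOn (fun p : ℝ × ℝ => R p.1 p.2) S :=
    (riemannPoly k).continuous.comp_continuousOn cz
  have cRv : ContinuousOn (fun p : ℝ × ℝ => Rv p.1 p.2) S := by
    refine ((riemannPoly k).derivative.continuous.comp_continuousOn cz).mul ?_
    exact ContinuousOn.div (by fun_prop) (by fun_prop) fun p hp =>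
      mul_ne_zero hba (pow_ne_zero _ (hne p hp))
  have cA := hA.cont
  have cAu := hA.cont_u
  have cAv := hA.cont_v
  have cAuv := hA.cont_uv
  have cV : ContinuousOn (fun p : ℝ × ℝ => V p.1 p.2) S := by simp only [hV]; fun_prop
  have cVu : ContinuousOn (fun p : ℝ × ℝ => Vu p.1 p.2) S := by
    simp only [hVu]
    refine ContinuousOn.mul (by fun_prop) (ContinuousOn.sub (by fun_prop) ?_)
    exact ContinuousOn.div (by fun_prop) (by fun_prop) hne
  have cQ : ContinuousOn (fun p : ℝ × ℝ => Q p.1 p.2) S := by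
    simp only [hQ]
    exact ContinuousOn.div (by fun_prop) (by fun_prop) fun p hp => pow_ne_zero _ (hne p hp)
  have cg : ContinuousOn (fun p : ℝ × ℝ => (p.2 - p.1) ^ k * g p.1 p.2) S := by
    have : ContinuousOn (fun p : ℝ × ℝ => (p.2 - p.1) ^ k *
        (Auv p.1 p.2 - k / (p.2 - p.1) * (Av p.1 p.2 - Au p.1 p.2))) S := by
      refine ContinuousOn.mul (by fun_prop) (ContinuousOn.sub (by fun_prop) ?_)
      refine ContinuousOn.mul ?_ (by fun_prop)
      exact ContinuousOn.div (by fun_prop) (by fun_prop) hne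
    refine this.congr fun p hp => ?_
    simp only [hg p.1 p.2 (lt_of hp.1 hp.2)]
  -- P1 = ∂ᵥ(R Vᵤ) and P2 = ∂ᵤ(V Rᵥ). Since Rᵤᵥ = -QR, their difference is R(v-u)^k g, and only
  -- boundary terms remain: R = 1 on v = b, Rᵥ = 0 on u = a, and V and Vᵤ vanish on v = T.
  set P1 : ℝ → ℝ → ℝ := fun u v => Rv u v * Vu u v + R u v * ((v - u) ^ k * g u v - Q u v * V u v) with hP1
  set P2 : ℝ → ℝ → ℝ := fun u v => Vu u v * Rv u v + V u v * (-Q u v * R u v) with hP2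
  have cP1 : ContinuousOn (fun p : ℝ × ℝ => P1 p.1 p.2) S :=
    (cRv.mul cVu).add (cR.mul (cg.sub (cQ.mul cV)))
  have cP2 : ContinuousOn (fun p : ℝ × ℝ => P2 p.1 p.2) S :=
    (cVu.mul cRv).add (cV.mul (cQ.neg.mul cR))
  have sliceV : ∀ {f : ℝ × ℝ → ℝ}, ContinuousOn f S → ∀ u ∈ Icc a c,
      ContinuousOn (fun v => f (u, v)) (Icc b T) := fun hf u hu =>
    hf.comp (by fun_prop) fun v hv => ⟨hu, hv⟩
  have sliceU : ∀ {f : ℝ × ℝ → ℝ}, ContinuousOn f S → ∀ v ∈ Icc b T,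
      ContinuousOn (fun u => f (u, v)) (Icc a c) := fun hf v hv =>
    hf.comp (by fun_prop) fun u hu => ⟨hu, hv⟩
  have iiV : ∀ {f : ℝ × ℝ → ℝ}, ContinuousOn f S → ∀ u ∈ Icc a c,
      IntervalIntegrable (fun v => f (u, v)) volume b T := fun hf u hu =>
    ContinuousOn.intervalIntegrable (by rw [uIcc_of_le hbT.le]; exact sliceV hf u hu)
  have iiU : ∀ {f : ℝ × ℝ → ℝ}, ContinuousOn f S → ∀ v ∈ Icc b T,
      IntervalIntegrable (fun u => f (u, v)) volume a c := fun hf v hv =>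
    ContinuousOn.intervalIntegrable (by rw [uIcc_of_le hac.le]; exact sliceU hf v hv)
  have hint : ∀ {f : ℝ × ℝ → ℝ}, ContinuousOn f S → IntegrableOn f (S) := fun hf =>
    hf.integrableOn_compact (isCompact_Icc.prod isCompact_Icc)
  have intU : ∀ {f : ℝ × ℝ → ℝ}, ContinuousOn f S →
      IntervalIntegrable (fun u => ∫ v in b..T, f (u, v)) volume a c := by
    intro f hf
    rw [intervalIntegrable_iff_integrableOn_Icc_of_le hac.le]
    have h0 := hint hf
    rw [hS, IntegrableOn, Measure.volume_eq_prod, ← Measure.prod_restrict] at h0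
    have := h0.integral_prod_left
    refine this.congr (ae_of_all _ fun u => ?_)
    simp only
    rw [intervalIntegral.integral_of_le hbT.le, integral_Icc_eq_integral_Ioc]
  have e1 : ∀ u ∈ Icc a c, ∀ v ∈ Icc b T, R u v * ((v - u) ^ k * g u v) = P1 u v - P2 u v := by
    intro u _ v _
    simp only [hP1, hP2]; ring
  have step1 : ∫ u in a..c, ∫ v in b..T, R u v * ((v - u) ^ k * g u v) =
      (∫ u in a..c, ∫ v in b..T, P1 u v) - ∫ u in a..c, ∫ v in b..T, P2 u v := by
    rw [← intervalIntegral.integral_sub (intU cP1) (intU cP2)]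
    apply intervalIntegral.integral_congr
    intro u hu
    rw [uIcc_of_le hac.le] at hu
    simp only
    rw [← intervalIntegral.integral_sub (iiV cP1 u hu) (iiV cP2 u hu)]
    apply intervalIntegral.integral_congr
    intro v hv
    rw [uIcc_of_le hbT.le] at hv
    exact e1 u hu v hv
  have step2 : ∫ u in a..c, ∫ v in b..T, P1 u v = V a b - V c b := by
    have h1 : ∀ u ∈ Icc a c, ∫ v in b..T, P1 u v = -Vu u b := by
      intro u hu
      rw [intervalIntegral.integral_eq_sub_of_hasDerivAt (f := fun v => R u v * Vu u v) _ (iiV cP1 u hu)]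
      · have hT' := hT u ⟨hu.1, hu.2.trans hcb.le⟩
        have hb : R u b = 1 := riemannFun_bottom k a b u
        simp only [hVu, hT'.1, hT'.2, hb]
        ring
      · intro v hv
        rw [uIcc_of_le hbT.le] at hv
        exact (dR u v (lt_of hu hv)).mul (dVu u v (lt_of hu hv))
    rw [intervalIntegral.integral_congr (g := fun u => -Vu u b)]
    · rw [intervalIntegral.integral_neg, intervalIntegral.integral_eq_sub_of_hasDerivAt
        (f := fun u => V u b) _ (iiU cVu b (left_mem_Icc.2 hbT.le))]
      · ring
      · intro u hu
        rw [uIcc_of_le hac.le] at hu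
        exact dV u b (lt_of hu (left_mem_Icc.2 hbT.le))
    · intro u hu
      rw [uIcc_of_le hac.le] at hu
      exact h1 u hu
  have step3 : ∫ u in a..c, ∫ v in b..T, P2 u v = ∫ v in b..T, V c v * Rv c v := by
    rw [intervalIntegral_intervalIntegral_swap]
    · apply intervalIntegral.integral_congr
      intro v hv
      rw [uIcc_of_le hbT.le] at hv
      simp only
      rw [intervalIntegral.integral_eq_sub_of_hasDerivAt (f := fun u => V u v * Rv u v) _ (iiU cP2 v hv)]
      · have : Rv a v = 0 := riemannFunV_left k a b v
        simp [this]
      · intro u hu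
        rw [uIcc_of_le hac.le] at hu
        exact (dV u v (lt_of hu hv)).mul (dRv u v (lt_of hu hv))
    · refine (hint cP2).mono_set ?_
      rw [uIoc_of_le hac.le, uIoc_of_le hbT.le]
      exact prod_mono Ioc_subset_Icc_self Ioc_subset_Icc_self
  rw [step1, step2, step3]

end Rectangle

section Representation

variable {k : ℕ} {A Au Av Auv : ℝ → ℝ → ℝ} {G : ℝ × ℝ → ℝ}

theorem measurable_riemannFunV_slice (k : ℕ) (a b u : ℝ) : Measurable fun v => riemannFunV k a b u v := by
  unfold riemannFunV riemannArg
  exact ((riemannPoly k).derivative.continuous.measurable.comp (by fun_prop)).mul (by fun_prop)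

theorem measurable_riemannFun_plane (k : ℕ) (a b : ℝ) :
    Measurable fun p : ℝ × ℝ => riemannFun k a b p.1 p.2 :=
  (measurable_riemannFun k).comp (f := fun p : ℝ × ℝ => (p, (a, b))) (by fun_prop)

theorem integrableOn_riemannFun_mul (k : ℕ) (hG : Continuous G) {a b : ℝ} (hab : a < b) (T : ℝ) :
    IntegrableOn (fun p : ℝ × ℝ => riemannFun k a b p.1 p.2 * ((p.2 - p.1) ^ k * G p))
      (Ioc a b ×ˢ Ioc b T) := by
  obtain ⟨M, hM0, hM⟩ := exists_riemannPoly_bound k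
  have hc : Continuous fun p : ℝ × ℝ => M * ‖(p.2 - p.1) ^ k * G p‖ := by fun_prop
  have hi : IntegrableOn (fun p : ℝ × ℝ => M * ‖(p.2 - p.1) ^ k * G p‖) (Ioc a b ×ˢ Ioc b T) :=
    (hc.continuousOn.integrableOn_compact (isCompact_Icc.prod isCompact_Icc)).mono_set
      (prod_mono Ioc_subset_Icc_self Ioc_subset_Icc_self)
  refine Integrable.mono' hi ?_ ?_
  · exact ((measurable_riemannFun_plane k a b).mul
      (by have := hG.measurable; fun_prop)).aestronglyMeasurable
  · rw [ae_restrict_iff' (measurableSet_Ioc.prod measurableSet_Ioc)]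
    refine ae_of_all _ fun p hp => ?_
    rw [norm_mul]
    gcongr
    exact (hM _ (riemannArg_mem_Icc hab hp.1.1.le hp.1.2 hp.2.1.le (hp.1.2.trans_lt hp.2.1))).1

/-- Let c tend to b in `riemann_rectangle`. The double integral converges because the Riemann
function is bounded. For k ≥ 1 the integrand on the side u = c is at most a constant times
(b-c)/(v-c), which is bounded and tends to 0 for every v > b; for k = 0 the Riemann function is
constant and the term is absent. The factor `0 ^ k` is 1 for k = 0, so the value on the axis
survives only in one space dimension. -/
theorem riemann_representation_rectangle (hA : HasNullDerivs A Au Av Auv) (hG : Continuous G)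
    (hg : ∀ u v, u < v → Auv u v - k / (v - u) * (Av u v - Au u v) = G (u, v))
    {a b T : ℝ} (hab : a < b) (hbT : b < T) (hT : ∀ u ∈ Icc a b, A u T = 0 ∧ Au u T = 0) :
    ∫ u in a..b, ∫ v in b..T, riemannFun k a b u v * ((v - u) ^ k * G (u, v)) =
      (b - a) ^ k * A a b - (0 : ℝ) ^ k * A b b := by
  obtain ⟨M, hM0, hM⟩ := exists_riemannPoly_bound k
  have hint := integrableOn_riemannFun_mul k hG hab T
  have hH : IntegrableOn (fun u => ∫ v in b..T, riemannFun k a b u v * ((v - u) ^ k * G (u, v)))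
      (uIcc a b) := by
    rw [uIcc_of_le hab.le, integrableOn_Icc_iff_integrableOn_Ioc]
    rw [IntegrableOn, Measure.volume_eq_prod, ← Measure.prod_restrict] at hint
    refine hint.integral_prod_left.congr (ae_of_all _ fun u => ?_)
    simp only
    rw [intervalIntegral.integral_of_le hbT.le]
  have hcont := intervalIntegral.continuousOn_primitive_interval hH
  have hlim1 : Filter.Tendsto (fun c => ∫ u in a..c, ∫ v in b..T,
      riemannFun k a b u v * ((v - u) ^ k * G (u, v))) (nhdsWithin b (Ioo a b))
      (nhds (∫ u in a..b, ∫ v in b..T, riemannFun k a b u v * ((v - u) ^ k * G (u, v)))) := by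
    refine (hcont b right_mem_uIcc).mono_left (nhdsWithin_mono _ ?_)
    rw [uIcc_of_le hab.le]; exact Ioo_subset_Icc_self
  have cA := hA.cont
  have hlim2 : Filter.Tendsto (fun c => (b - c) ^ k * A c b) (nhdsWithin b (Ioo a b))
      (nhds ((0 : ℝ) ^ k * A b b)) := by
    have hc : Continuous fun c => (b - c) ^ k * A c b := by fun_prop
    have := (hc.tendsto b).mono_left (nhdsWithin_le_nhds (s := Ioo a b))
    rwa [sub_self] at this
  have hlim3 : Filter.Tendsto (fun c => ∫ v in b..T, (v - c) ^ k * A c v * riemannFunV k a b c v)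
      (nhdsWithin b (Ioo a b)) (nhds 0) := by
    rcases Nat.eq_zero_or_pos k with hk | hk
    · have : ∀ c v, riemannFunV k a b c v = 0 := by
        intro c v
        have h0 : riemannPoly k = Polynomial.monomial 0 (riemannCoeff k 0) := by
          rw [riemannPoly, hk, Finset.sum_range_one]
        rw [riemannFunV, h0]
        simp
      simpa [this] using tendsto_const_nhds
    · obtain ⟨j, rfl⟩ : ∃ j, k = j + 1 := ⟨k - 1, by omega⟩
      have hcj : Continuous fun p : ℝ × ℝ => (p.2 - p.1) ^ j * A p.1 p.2 := by fun_prop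
      obtain ⟨N, hN⟩ := (isCompact_Icc.prod isCompact_Icc).exists_bound_of_continuousOn
        (s := Icc a b ×ˢ Icc b T) hcj.continuousOn
      have hbound : ∀ c ∈ Ioo a b, ∀ v ∈ Ioc b T,
          ‖(v - c) ^ (j + 1) * A c v * riemannFunV (j + 1) a b c v‖ ≤ N * M * ((b - c) / (v - c)) := by
        intro c hc v hv
        have hvc : 0 < v - c := by linarith [hc.2, hv.1]
        have hbc : 0 < b - c := by linarith [hc.2]
        have h1 := hN (c, v) ⟨⟨hc.1.le, hc.2.le⟩, ⟨hv.1.le, hv.2⟩⟩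
        have h2 := (hM _ (riemannArg_mem_Icc hab hc.1.le hc.2.le hv.1.le (hc.2.trans hv.1))).2
        have h3 : (c - a) * (b - c) / ((b - a) * (v - c) ^ 2) ≤ (b - c) / (v - c) ^ 2 := by
          rw [div_le_div_iff₀ (mul_pos (by linarith) (by positivity)) (by positivity)]
          have : c - a ≤ b - a := by linarith [hc.2]
          nlinarith [mul_nonneg (sub_nonneg.2 this) (mul_nonneg hbc.le (sq_nonneg (v - c)))]
        have h4 : 0 ≤ (c - a) * (b - c) / ((b - a) * (v - c) ^ 2) :=
          div_nonneg (mul_nonneg (by linarith [hc.1]) hbc.le) (mul_nonneg (by linarith) (sq_nonneg _))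
        have hN0 : 0 ≤ N := (norm_nonneg _).trans h1
        have e : (v - c) ^ (j + 1) * A c v * riemannFunV (j + 1) a b c v =
            ((v - c) ^ j * A c v) * (v - c) * ((riemannPoly (j + 1)).derivative.eval (riemannArg a b c v)
              * ((c - a) * (b - c) / ((b - a) * (v - c) ^ 2))) := by
          unfold riemannFunV; ring
        rw [e, norm_mul, norm_mul (_ * _) (v - c), norm_mul (Polynomial.eval _ _),
          Real.norm_of_nonneg hvc.le, Real.norm_of_nonneg h4]
        calc _ ≤ N * (v - c) * (M * ((b - c) / (v - c) ^ 2)) := by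
              refine mul_le_mul (mul_le_mul_of_nonneg_right h1 hvc.le) ?_ (by positivity)
                (by positivity)
              exact mul_le_mul h2 h3 h4 hM0.le
          _ = _ := by field_simp
      have hlim0 : (0 : ℝ) = ∫ v in b..T, (0 : ℝ) := by simp
      rw [hlim0]
      apply intervalIntegral.tendsto_integral_filter_of_dominated_convergence (fun _ => |N * M|)
      · refine Filter.Eventually.of_forall fun c => ?_
        have m1 : Measurable fun v => (v - c) ^ (j + 1) * A c v := by
          have : Continuous fun v => (v - c) ^ (j + 1) * A c v := by fun_prop
          exact this.measurable
        exact (m1.mul (measurable_riemannFunV_slice (j + 1) a b c)).aestronglyMeasurable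
      · filter_upwards [self_mem_nhdsWithin] with c hc
        refine ae_of_all _ fun v hv => ?_
        rw [uIoc_of_le hbT.le] at hv
        refine (hbound c hc v hv).trans ?_
        have hvc : 0 < v - c := by linarith [hc.2, hv.1]
        have h5 : (b - c) / (v - c) ≤ 1 := by rw [div_le_one hvc]; linarith [hv.1]
        have h6 : 0 ≤ (b - c) / (v - c) := div_nonneg (by linarith [hc.2]) hvc.le
        calc _ ≤ |N * M| * ((b - c) / (v - c)) := by gcongr; exact le_abs_self _
          _ ≤ _ := mul_le_of_le_one_right (abs_nonneg _) h5
      · simp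
      · refine ae_of_all _ fun v hv => ?_
        rw [uIoc_of_le hbT.le] at hv
        apply squeeze_zero_norm' (a := fun c => N * M * ((b - c) / (v - c)))
        · filter_upwards [self_mem_nhdsWithin] with c hc
          exact hbound c hc v hv
        · have hvb : v - b ≠ 0 := by linarith [hv.1]
          have : ContinuousAt (fun c => N * M * ((b - c) / (v - c))) b := by
            refine ContinuousAt.mul continuousAt_const (ContinuousAt.div (by fun_prop) (by fun_prop) hvb)
          have := this.tendsto.mono_left (nhdsWithin_le_nhds (s := Ioo a b))
          simpa using this
  have heq : (fun c => ∫ u in a..c, ∫ v in b..T, riemannFun k a b u v * ((v - u) ^ k * G (u, v)))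
      =ᶠ[nhdsWithin b (Ioo a b)] fun c => (b - a) ^ k * A a b - (b - c) ^ k * A c b
        - ∫ v in b..T, (v - c) ^ k * A c v * riemannFunV k a b c v := by
    filter_upwards [self_mem_nhdsWithin] with c hc
    exact riemann_rectangle hA (g := fun u v => G (u, v)) hg hc.1 hc.2 hbT hT
  have : (nhdsWithin b (Ioo a b)).NeBot := right_nhdsWithin_Ioo_neBot hab
  have hlim4 := (tendsto_const_nhds (x := (b - a) ^ k * A a b)).sub hlim2 |>.sub hlim3
  rw [sub_zero] at hlim4
  exact tendsto_nhds_unique (hlim1.congr' heq) hlim4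

/-- On the axis in one space dimension. -/
theorem axis_representation (hA : HasNullDerivs A Au Av Auv)
    (hd : ∀ s, HasDerivAt (fun s => A s s) (2 * Au s s) s) {b T : ℝ} (hbT : b < T) (hTT : A T T = 0)
    (hT : ∀ u ∈ Icc b T, Au u T = 0) :
    A b b = ∫ u in b..T, ∫ v in u..T, 2 * Auv u v := by
  have cAu := hA.cont_u
  have cAuv := hA.cont_uv
  -- The hypothesis `hd` says that Aᵤ = Aᵥ on the diagonal, that is, the radial derivative vanishes
  -- on the axis. Hence 2Aᵤ(u,u) is the derivative of A(u,u) along the axis and can be integrated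
  -- again.
  have h1 : ∀ u ∈ Icc b T, ∫ v in u..T, 2 * Auv u v = -(2 * Au u u) := by
    intro u hu
    rw [intervalIntegral.integral_eq_sub_of_hasDerivAt (f := fun v => 2 * Au u v)]
    · rw [hT u hu]; ring
    · exact fun v _ => (hA.deriv_uv u v).const_mul 2
    · exact Continuous.intervalIntegrable (by fun_prop) _ _
  rw [intervalIntegral.integral_congr (g := fun u => -(2 * Au u u))]
  · rw [intervalIntegral.integral_neg,
      intervalIntegral.integral_eq_sub_of_hasDerivAt (f := fun s => A s s) (fun s _ => hd s)]
    · rw [hTT]; ring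
    · exact Continuous.intervalIntegrable (by fun_prop) _ _
  · intro u hu
    rw [uIcc_of_le hbT.le] at hu
    exact h1 u hu

end Representation

/-- The kernel of the radial wave equation in null coordinates, as a function of the pair
`((u, v), (a, b))`. -/
noncomputable def waveKernel (k : ℕ) (z : (ℝ × ℝ) × ℝ × ℝ) : ℝ :=
  {z : (ℝ × ℝ) × ℝ × ℝ | z.2.1 < z.1.1 ∧ z.1.1 < z.2.2 ∧ z.2.2 < z.1.2}.indicator
      (fun z => riemannFun k z.2.1 z.2.2 z.1.1 z.1.2) z +
    {z : (ℝ × ℝ) × ℝ × ℝ | k = 0 ∧ z.2.1 < z.2.2 ∧ z.2.2 < z.1.1 ∧ z.1.1 < z.1.2}.indicator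
      (fun _ => 2) z

theorem measurable_waveKernel (k : ℕ) : Measurable (waveKernel k) := by
  unfold waveKernel
  refine Measurable.add ((measurable_riemannFun k).indicator ?_) (measurable_const.indicator ?_)
  · measurability
  · by_cases hk : k = 0
    · simp only [hk, true_and]; measurability
    · simp [hk]

/-- The two pieces of the kernel have disjoint supports: on u < b the Riemann function is bounded
because its argument lies in [0,1], and on b < u the kernel is 2, which occurs only for k = 0, where
`influencePairs` does not ask for u < b. -/
theorem exists_waveKernel_bound (k : ℕ) : ∃ M : ℝ≥0, ∀ z : (ℝ × ℝ) × ℝ × ℝ, 0 < z.2.1 →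
    ‖waveKernel k z‖ₑ ≤ M * (influencePairs k).indicator 1 z := by
  obtain ⟨M, hM0, hM⟩ := exists_riemannPoly_bound k
  refine ⟨Real.toNNReal (M + 2), fun z hz => ?_⟩
  have h2 : ∀ x : ℝ, |x| ≤ M + 2 → ‖x‖ₑ ≤ (Real.toNNReal (M + 2) : ℝ≥0) := by
    intro x hx
    rw [Real.enorm_eq_ofReal_abs]
    exact ENNReal.ofReal_le_ofReal hx
  unfold waveKernel
  by_cases h1 : z.2.1 < z.1.1 ∧ z.1.1 < z.2.2 ∧ z.2.2 < z.1.2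
  · rw [indicator_of_mem (by exact h1), indicator_of_notMem]
    swap
    · rintro ⟨-, -, h, -⟩; exact absurd h1.2.1 (not_lt.2 h.le)
    rw [indicator_of_mem (show z ∈ influencePairs k from
      ⟨hz, h1.1.trans h1.2.1, h1.1, h1.2.1.trans h1.2.2, h1.2.2, fun _ => h1.2.1⟩), add_zero,
      Pi.one_apply, mul_one]
    apply h2
    have := (hM _ (riemannArg_mem_Icc (h1.1.trans h1.2.1) h1.1.le h1.2.1.le h1.2.2.le
      (h1.2.1.trans h1.2.2))).1
    unfold riemannFun
    linarith
  · rw [indicator_of_notMem (by exact h1), zero_add]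
    by_cases h3 : k = 0 ∧ z.2.1 < z.2.2 ∧ z.2.2 < z.1.1 ∧ z.1.1 < z.1.2
    · rw [indicator_of_mem (by exact h3)]
      rw [indicator_of_mem (show z ∈ influencePairs k from
        ⟨hz, h3.2.1, h3.2.1.trans h3.2.2.1, h3.2.2.2, h3.2.2.1.trans h3.2.2.2,
          fun h => absurd h3.1 h⟩), Pi.one_apply, mul_one]
      apply h2
      rw [abs_of_pos two_pos]; linarith
    · rw [indicator_of_notMem (by exact h3)]
      simp

/-- The rectangle gives the Riemann part of the kernel. The value on the axis, present only for k =
0, is itself the integral of 2G over b < u < v and gives the constant part. Vanishing at late times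
makes the unbounded regions of integration effectively finite. -/
theorem wave_representation {k : ℕ} {A Au Av Auv : ℝ → ℝ → ℝ} {G : ℝ × ℝ → ℝ}
    (hA : HasNullDerivs A Au Av Auv) (hG : Continuous G)
    (hg : ∀ u v, u < v → Auv u v - k / (v - u) * (Av u v - Au u v) = G (u, v))
    (hd : k = 0 → ∀ s, HasDerivAt (fun s => A s s) (2 * Au s s) s) {T : ℝ}
    (hT : ∀ u v, 2 * T ≤ u + v → A u v = 0 ∧ Au u v = 0 ∧ G (u, v) = 0) {a b : ℝ} (hab : a < b) :
    ((b - a) / 2) ^ k * A a b =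
      ∫ p, waveKernel k (p, (a, b)) * (nullRadius p ^ k * G p) := by
  -- S ≥ 2T - a makes A, Aᵤ and G vanish for u ≥ a, v ≥ S; the other entry only ensures b < S.
  set S := max (2 * T - a) (b + 1) with hS
  have hS1 : 2 * T - a ≤ S := le_max_left _ _
  have hbS : b < S := lt_of_lt_of_le (by linarith) (le_max_right _ _)
  have hTS : ∀ u ∈ Icc a b, A u S = 0 ∧ Au u S = 0 := fun u hu =>
    have := hT u S (by linarith [hu.1])
    ⟨this.1, this.2.1⟩
  have h1 := riemann_representation_rectangle hA hG hg hab hbS hTS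
  have hint1 := integrableOn_riemannFun_mul k hG hab S
  have hset1 : MeasurableSet (Ioc a b ×ˢ Ioc b S) := measurableSet_Ioc.prod measurableSet_Ioc
  set F : ℝ × ℝ → ℝ := fun p => riemannFun k a b p.1 p.2 * ((p.2 - p.1) ^ k * G p) with hF
  have e1 : ∫ u in a..b, ∫ v in b..S, riemannFun k a b u v * ((v - u) ^ k * G (u, v)) =
      ∫ p, (Ioc a b ×ˢ Ioc b S).indicator F p := by
    rw [integral_indicator hset1, Measure.volume_eq_prod, setIntegral_prod _ hint1,
      intervalIntegral.integral_of_le hab.le]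
    simp_rw [intervalIntegral.integral_of_le hbS.le]
    rfl
  have hset2 : MeasurableSet ((Ioc b S ×ˢ Ioc b S) ∩ {p : ℝ × ℝ | p.1 < p.2}) :=
    (measurableSet_Ioc.prod measurableSet_Ioc).inter measurableSet_null_lt
  have hint2 : IntegrableOn (fun p => 2 * G p) (Ioc b S ×ˢ Ioc b S) := by
    have hc : Continuous fun p => 2 * G p := by fun_prop
    exact (hc.continuousOn.integrableOn_compact (isCompact_Icc.prod isCompact_Icc)).mono_set
      (prod_mono Ioc_subset_Icc_self Ioc_subset_Icc_self)
  have e2 : (0 : ℝ) ^ k * A b b = ∫ p, ((Ioc b S ×ˢ Ioc b S) ∩ {p : ℝ × ℝ | p.1 < p.2}).indicator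
      (fun p => (0 : ℝ) ^ k * (2 * G p)) p := by
    rcases Nat.eq_zero_or_pos k with hk | hk
    · subst hk
      have h2 := axis_representation hA (hd rfl) hbS (hT S S (by linarith)).1
        (fun u hu => (hT u S (by linarith [hu.1])).2.1)
      have hi3 : IntegrableOn ({p : ℝ × ℝ | p.1 < p.2}.indicator fun p => 2 * G p)
          (Ioc b S ×ˢ Ioc b S) := hint2.indicator measurableSet_null_lt
      simp only [pow_zero, one_mul]
      rw [integral_indicator hset2, h2, ← setIntegral_indicator measurableSet_null_lt,
        Measure.volume_eq_prod, setIntegral_prod _ hi3, intervalIntegral.integral_of_le hbS.le]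
      apply setIntegral_congr_fun measurableSet_Ioc
      intro u hu
      simp only
      have hfun : ∀ v, {p : ℝ × ℝ | p.1 < p.2}.indicator (fun p => 2 * G p) (u, v) =
          (Ioi u).indicator (fun v => 2 * G (u, v)) v := fun v => by simp [indicator]
      simp_rw [hfun]
      rw [setIntegral_indicator measurableSet_Ioi, intervalIntegral.integral_of_le hu.2]
      have hs : Ioc b S ∩ Ioi u = Ioc u S := by
        ext v; simp only [mem_inter_iff, mem_Ioc, mem_Ioi]
        constructor
        · rintro ⟨⟨_, h⟩, h'⟩; exact ⟨h', h⟩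
        · rintro ⟨h, h'⟩; exact ⟨⟨hu.1.trans h, h'⟩, h⟩
      rw [hs]
      apply setIntegral_congr_fun measurableSet_Ioc
      intro v hv
      have := hg u v hv.1
      simp only [Nat.cast_zero, zero_div, zero_mul, sub_zero] at this
      simp only [this]
    · simp [hk.ne']
  have hi1 : Integrable ((Ioc a b ×ˢ Ioc b S).indicator F) := hint1.integrable_indicator hset1
  have hi2 : Integrable (((Ioc b S ×ˢ Ioc b S) ∩ {p : ℝ × ℝ | p.1 < p.2}).indicator
      (fun p => (0 : ℝ) ^ k * (2 * G p))) :=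
    IntegrableOn.integrable_indicator ((hint2.mono_set inter_subset_left).const_mul _) hset2
  have hne : ∀ᵐ p : ℝ × ℝ, p.1 ≠ b := by
    have h0 : ∀ᵐ x : ℝ, x ≠ b := by simp [ae_iff]
    exact Measure.quasiMeasurePreserving_fst.ae h0
  have hkey : (b - a) ^ k * A a b = 2 ^ k * ∫ p, waveKernel k (p, (a, b)) * (nullRadius p ^ k * G p) := by
    have h3 : (b - a) ^ k * A a b = (∫ p, (Ioc a b ×ˢ Ioc b S).indicator F p) +
        ∫ p, ((Ioc b S ×ˢ Ioc b S) ∩ {p : ℝ × ℝ | p.1 < p.2}).indicator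
          (fun p => (0 : ℝ) ^ k * (2 * G p)) p := by
      rw [← e1, ← e2, h1]; ring
    rw [h3, ← integral_add hi1 hi2, ← integral_const_mul]
    apply integral_congr_ae
    filter_upwards [hne] with p hp
    have hr : (2 : ℝ) ^ k * nullRadius p ^ k = (p.2 - p.1) ^ k := by
      rw [← mul_pow]; congr 1; unfold nullRadius; ring
    have hzero : a < p.1 → S < p.2 → G p = 0 := fun h4 h5 => (hT p.1 p.2 (by linarith)).2.2
    have p1 : (Ioc a b ×ˢ Ioc b S).indicator F p =
        {z : (ℝ × ℝ) × ℝ × ℝ | z.2.1 < z.1.1 ∧ z.1.1 < z.2.2 ∧ z.2.2 < z.1.2}.indicator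
          (fun z => riemannFun k z.2.1 z.2.2 z.1.1 z.1.2) (p, (a, b)) * ((p.2 - p.1) ^ k * G p) := by
      by_cases h4 : a < p.1 ∧ p.1 < b ∧ b < p.2
      · rw [indicator_of_mem (a := (p, (a, b))) (by exact h4)]
        by_cases h5 : p.2 ≤ S
        · rw [indicator_of_mem (show p ∈ Ioc a b ×ˢ Ioc b S from ⟨⟨h4.1, h4.2.1.le⟩, h4.2.2, h5⟩)]
        · rw [indicator_of_notMem (fun h => h5 h.2.2), hzero h4.1 (not_le.1 h5)]; simp
      · rw [indicator_of_notMem (a := (p, (a, b))) (by exact h4), indicator_of_notMem, zero_mul]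
        rintro ⟨⟨h5, h6⟩, h7, -⟩
        exact h4 ⟨h5, lt_of_le_of_ne h6 hp, h7⟩
    have p2 : ((Ioc b S ×ˢ Ioc b S) ∩ {p : ℝ × ℝ | p.1 < p.2}).indicator
          (fun p => (0 : ℝ) ^ k * (2 * G p)) p =
        {z : (ℝ × ℝ) × ℝ × ℝ | k = 0 ∧ z.2.1 < z.2.2 ∧ z.2.2 < z.1.1 ∧ z.1.1 < z.1.2}.indicator
          (fun _ => (2 : ℝ)) (p, (a, b)) * ((p.2 - p.1) ^ k * G p) := by
      by_cases h4 : k = 0 ∧ a < b ∧ b < p.1 ∧ p.1 < p.2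
      · rw [indicator_of_mem (a := (p, (a, b))) (by exact h4)]
        have hk := h4.1
        subst hk
        by_cases h5 : p.2 ≤ S
        · rw [indicator_of_mem (by exact ⟨⟨⟨h4.2.2.1, h4.2.2.2.le.trans h5⟩,
            h4.2.2.1.trans h4.2.2.2, h5⟩, h4.2.2.2⟩)]
          simp
        · rw [indicator_of_notMem (fun h => h5 h.1.2.2),
            hzero (h4.2.1.trans h4.2.2.1) (not_le.1 h5)]; simp
      · rw [indicator_of_notMem (a := (p, (a, b))) (by exact h4), zero_mul]
        by_cases hk : k = 0
        · rw [indicator_of_notMem]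
          rintro ⟨⟨⟨h5, h6⟩, h7, -⟩, h8⟩
          exact h4 ⟨hk, hab, h5, h8⟩
        · simp [hk, indicator]
    rw [p1, p2, ← add_mul, ← hr]
    unfold waveKernel
    ring
  rw [div_pow, div_mul_eq_mul_div, hkey]
  field_simp

/-! ### Smooth dependence of integrals on a parameter -/

section ParametricIntegral

universe u

variable {H : Type u} {W F X : Type*} [NormedAddCommGroup H] [NormedSpace ℝ H] [ProperSpace H]
  [NormedAddCommGroup W] [NormedSpace ℝ W]
  [TopologicalSpace X] [CompactSpace X] [MeasurableSpace X] [OpensMeasurableSpace X]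
  [SecondCountableTopology X] {μ : Measure X} [IsFiniteMeasure μ]

theorem hasFDerivAt_integral_of_contDiff [NormedAddCommGroup F] [NormedSpace ℝ F]
    {Ψ : H × W → F} (hΨ : ContDiff ℝ 1 Ψ) {ι : X → W} (hι : Continuous ι) (h₀ : H) :
    HasFDerivAt (fun h => ∫ x, Ψ (h, ι x) ∂μ)
      (∫ x, (fderiv ℝ Ψ (h₀, ι x)).comp (ContinuousLinearMap.inl ℝ H W) ∂μ) h₀ := by
  have hc' : Continuous fun p : H × X =>
      (fderiv ℝ Ψ (p.1, ι p.2)).comp (ContinuousLinearMap.inl ℝ H W) := by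
    have h1 : Continuous (fderiv ℝ Ψ) := hΨ.continuous_fderiv one_ne_zero
    exact (h1.comp (by fun_prop)).clm_comp continuous_const
  have hc : ∀ h, Continuous fun x => Ψ (h, ι x) := fun h => hΨ.continuous.comp (by fun_prop)
  obtain ⟨N, hN⟩ := ((isCompact_closedBall h₀ 1).prod (isCompact_univ (X := X))).exists_bound_of_continuousOn
    hc'.continuousOn
  refine hasFDerivAt_integral_of_dominated_of_fderiv_le (s := Metric.closedBall h₀ 1)
    (F' := fun h x => (fderiv ℝ Ψ (h, ι x)).comp (ContinuousLinearMap.inl ℝ H W))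
    (bound := fun _ => N)
    (Metric.closedBall_mem_nhds _ one_pos) ?_ ?_ ?_ ?_ (integrable_const _) ?_
  · exact Filter.Eventually.of_forall fun h => (hc h).aestronglyMeasurable
  · obtain ⟨N', hN'⟩ := (isCompact_univ (X := X)).exists_bound_of_continuousOn (hc h₀).continuousOn
    exact Integrable.of_bound (hc h₀).aestronglyMeasurable N' (ae_of_all _ fun x => hN' x (mem_univ _))
  · exact (hc'.comp (Continuous.prodMk_right h₀)).aestronglyMeasurable
  · exact ae_of_all _ fun x h hh => hN (h, x) ⟨hh, mem_univ _⟩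
  · refine ae_of_all _ fun x h _ => ?_
    have h1 := (hΨ.differentiable one_ne_zero (h, ι x)).hasFDerivAt
    exact h1.comp h (hasFDerivAt_prodMk_left h (ι x))

/-- Induction on the order: the derivative is an integral of the same kind with values in H →L[ℝ] F.
This is why F varies in the induction and lies in the universe of H. -/
theorem contDiff_integral_of_contDiff {n : ℕ} : ∀ {F : Type u} [NormedAddCommGroup F] [NormedSpace ℝ F]
    {Ψ : H × W → F}, ContDiff ℝ n Ψ → ∀ {ι : X → W}, Continuous ι →
    ContDiff ℝ n (fun h => ∫ x, Ψ (h, ι x) ∂μ) := by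
  induction n with
  | zero =>
    intro F _ _ Ψ hΨ ι hι
    rw [Nat.cast_zero, contDiff_zero] at hΨ ⊢
    have hc : Continuous (Function.uncurry fun h x => Ψ (h, ι x)) := by
      unfold Function.uncurry; fun_prop
    simpa using continuous_parametric_integral_of_continuous (μ := μ) hc isCompact_univ
  | succ n ih =>
    intro F _ _ Ψ hΨ ι hι
    have h1 : ContDiff ℝ 1 Ψ := hΨ.of_le (by norm_cast; omega)
    have hd := fun h => hasFDerivAt_integral_of_contDiff (μ := μ) h1 hι h
    push_cast at hΨ ⊢
    rw [contDiff_succ_iff_fderiv] at hΨ ⊢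
    refine ⟨fun h => (hd h).differentiableAt, by simp, ?_⟩
    have : fderiv ℝ (fun h => ∫ x, Ψ (h, ι x) ∂μ) = fun h =>
        ∫ x, (fderiv ℝ Ψ (h, ι x)).comp (ContinuousLinearMap.inl ℝ H W) ∂μ :=
      funext fun h => (hd h).fderiv
    rw [this]
    exact ih (Ψ := fun z => (fderiv ℝ Ψ z).comp (ContinuousLinearMap.inl ℝ H W))
      (hΨ.2.2.clm_comp contDiff_const) hι

end ParametricIntegral

/-! ### Directional derivatives and the d'Alembertian -/

theorem HasNullDerivs.of_contDiff {N : ℝ × ℝ → ℝ} (hN : ContDiff ℝ 2 N) :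
    HasNullDerivs (fun u v => N (u, v)) (fun u v => fderiv ℝ N (u, v) (1, 0))
      (fun u v => fderiv ℝ N (u, v) (0, 1))
      (fun u v => fderiv ℝ (fun p => fderiv ℝ N p (1, 0)) (u, v) (0, 1)) := by
  have h1 : ContDiff ℝ 1 (fderiv ℝ N) := hN.fderiv_right (by norm_num)
  have h2 : ContDiff ℝ 1 (fun p => fderiv ℝ N p (1, 0)) := h1.clm_apply contDiff_const
  have e1 : ∀ {f : ℝ × ℝ → ℝ}, ContDiff ℝ 1 f → ∀ u v, HasDerivAt (fun s => f (s, v)) (fderiv ℝ f (u, v) (1, 0)) u := by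
    intro f hf u v
    have := (hf.differentiable one_ne_zero (u, v)).hasFDerivAt.comp_hasDerivAt u
      ((hasDerivAt_id u).prodMk (hasDerivAt_const u v))
    exact this
  have e2 : ∀ {f : ℝ × ℝ → ℝ}, ContDiff ℝ 1 f → ∀ u v, HasDerivAt (fun s => f (u, s)) (fderiv ℝ f (u, v) (0, 1)) v := by
    intro f hf u v
    have := (hf.differentiable one_ne_zero (u, v)).hasFDerivAt.comp_hasDerivAt v
      ((hasDerivAt_const v u).prodMk (hasDerivAt_id v))
    exact this
  have hN1 : ContDiff ℝ 1 N := hN.of_le (by norm_num)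
  have c : ∀ {f : ℝ × ℝ → ℝ}, ContDiff ℝ 1 f → ∀ h, Continuous fun p : ℝ × ℝ => fderiv ℝ f p h :=
    fun hf h => (hf.continuous_fderiv one_ne_zero).clm_apply continuous_const
  exact ⟨fun u v => e1 hN1 u v, fun u v => e2 hN1 u v, fun u v => e2 h2 u v, hN.continuous,
    c hN1 _, c hN1 _, c h2 _⟩

/-- The derivative of `f` in the direction `h`. -/
noncomputable def dirDeriv {V : Type*} [NormedAddCommGroup V] [NormedSpace ℝ V] (h : V) (f : V → ℝ)
    (z : V) : ℝ := fderiv ℝ f z h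

section DirDeriv

variable {V : Type*} [NormedAddCommGroup V] [NormedSpace ℝ V] {f : V → ℝ}

theorem ContDiff.dirDeriv_infty (hf : ContDiff ℝ ∞ f) (h : V) : ContDiff ℝ ∞ (dirDeriv h f) :=
  (hf.fderiv_right (m := ∞) (by simp)).clm_apply contDiff_const

theorem HasCompactSupport.dirDeriv (hf : HasCompactSupport f) (h : V) :
    HasCompactSupport (dirDeriv h f) :=
  hf.fderiv_apply ℝ h

theorem dirDeriv_comm (hf : ContDiff ℝ ∞ f) (h k : V) :
    dirDeriv h (dirDeriv k f) = dirDeriv k (dirDeriv h f) := by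
  ext z
  have hs : IsSymmSndFDerivAt ℝ f z := hf.contDiffAt.isSymmSndFDerivAt (by simp; exact WithTop.coe_le_coe.2 (le_top : (2 : ℕ∞) ≤ ⊤))
  have h1 : DifferentiableAt ℝ (fderiv ℝ f) z :=
    (hf.fderiv_right (m := ∞) (by simp)).differentiable (by simp) z
  have e : ∀ h k : V, dirDeriv h (dirDeriv k f) z = fderiv ℝ (fderiv ℝ f) z h k := by
    intro h k
    unfold dirDeriv
    rw [fderiv_clm_apply h1 (differentiableAt_const k)]
    simp
  rw [e, e]
  exact hs h k

theorem dirDeriv_dirDeriv (hf : ContDiff ℝ ∞ f) (h k z : V) :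
    dirDeriv h (dirDeriv k f) z = iteratedFDeriv ℝ 2 f z ![h, k] := by
  have h1 : DifferentiableAt ℝ (fderiv ℝ f) z :=
    (hf.fderiv_right (m := ∞) (by simp)).differentiable (by simp) z
  rw [iteratedFDeriv_two_apply]
  unfold dirDeriv
  rw [fderiv_clm_apply h1 (differentiableAt_const k)]
  simp

end DirDeriv

section DAlembertian

variable {n : ℕ} {φ : SpaceTime n → ℝ}

theorem dirDeriv_slice_space (hφ : ContDiff ℝ ∞ φ) (t : ℝ) (y h : EuclideanSpace ℝ (Fin n)) :
    dirDeriv h (fun y => φ (t, y)) y = dirDeriv (0, h) φ (t, y) := by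
  have := (hφ.differentiable (by simp) (t, y)).hasFDerivAt.comp y (hasFDerivAt_prodMk_right t y)
  unfold dirDeriv
  rw [HasFDerivAt.fderiv (f := fun y => φ (t, y)) this]
  simp

theorem deriv_slice_time (hφ : ContDiff ℝ ∞ φ) (t : ℝ) (y : EuclideanSpace ℝ (Fin n)) :
    deriv (fun t => φ (t, y)) t = dirDeriv (1, 0) φ (t, y) := by
  have := (hφ.differentiable (by simp) (t, y)).hasFDerivAt.comp_hasDerivAt t
      ((hasDerivAt_id t).prodMk (hasDerivAt_const t y))
  exact this.deriv

/-- With all derivatives taken as directional derivatives on space-time, affine substitutions and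
convolutions can be treated term by term. -/
theorem dAlembertian_eq (hφ : ContDiff ℝ ∞ φ) (z : SpaceTime n) :
    dAlembertian φ z = dirDeriv (1, 0) (dirDeriv (1, 0) φ) z -
      ∑ i, dirDeriv (0, EuclideanSpace.basisFun (Fin n) ℝ i)
        (dirDeriv (0, EuclideanSpace.basisFun (Fin n) ℝ i) φ) z := by
  unfold dAlembertian
  congr 1
  · rw [iteratedDeriv_succ, iteratedDeriv_one]
    have : deriv (fun s => φ (s, z.2)) = fun s => dirDeriv (1, 0) φ (s, z.2) :=
      funext fun s => deriv_slice_time hφ s z.2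
    rw [this, deriv_slice_time (hφ.dirDeriv_infty _)]
  · rw [InnerProductSpace.laplacian_eq_iteratedFDeriv_orthonormalBasis _ (EuclideanSpace.basisFun (Fin n) ℝ)]
    apply Finset.sum_congr rfl
    intro i _
    have hs : ContDiff ℝ ∞ (fun y => φ (z.1, y)) := hφ.comp (by fun_prop)
    rw [← dirDeriv_dirDeriv hs]
    have : dirDeriv (EuclideanSpace.basisFun (Fin n) ℝ i) (fun y => φ (z.1, y)) =
        fun y => dirDeriv (0, EuclideanSpace.basisFun (Fin n) ℝ i) φ (z.1, y) :=
      funext fun y => dirDeriv_slice_space hφ z.1 y _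
    rw [this, dirDeriv_slice_space (hφ.dirDeriv_infty _)]

theorem ContDiff.dAlembertian (hφ : ContDiff ℝ ∞ φ) : ContDiff ℝ ∞ (dAlembertian φ) := by
  rw [show _root_.dAlembertian φ = _ from funext (dAlembertian_eq hφ)]
  exact ((hφ.dirDeriv_infty _).dirDeriv_infty _).sub
    (ContDiff.sum fun i _ => (hφ.dirDeriv_infty _).dirDeriv_infty _)

end DAlembertian

/-! ### Polar coordinates and the divergence theorem on balls -/

section Polar

variable {E : Type*} [NormedAddCommGroup E] [NormedSpace ℝ E] [FiniteDimensional ℝ E]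
  [MeasureSpace E] [BorelSpace E] [(volume : Measure E).IsAddHaarMeasure] [Nontrivial E]

theorem measurePreserving_polar :
    MeasurePreserving (fun z : Metric.sphere (0 : E) 1 × ℝ => z.2 • (z.1 : E))
      ((volume : Measure E).toSphere.prod ((volume.restrict (Ioi (0 : ℝ))).withDensity
        (fun r => ENNReal.ofReal (r ^ (Module.finrank ℝ E - 1))))) volume := by
  refine ⟨by fun_prop, ?_⟩
  ext s hs
  have h1 : Measurable (s.indicator (1 : E → ℝ≥0∞)) := measurable_one.indicator hs
  have hm : Measurable fun z : Metric.sphere (0 : E) 1 × ℝ => z.2 • (z.1 : E) := by fun_prop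
  rw [← lintegral_indicator_one hs, ← lintegral_indicator_one hs, lintegral_map h1 hm,
    lintegral_prod (fun z : Metric.sphere (0 : E) 1 × ℝ => s.indicator (1 : E → ℝ≥0∞) (z.2 • (z.1 : E)))
      (h1.comp hm).aemeasurable, lintegral_eq_lintegral_sphere h1]
  apply lintegral_congr; intro θ
  have h2 : Measurable fun r : ℝ => s.indicator (1 : E → ℝ≥0∞) (r • (θ : E)) :=
    h1.comp (f := fun r : ℝ => r • (θ : E)) (by fun_prop)
  rw [lintegral_withDensity_eq_lintegral_mul _ (by fun_prop) h2]
  rfl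

/-- Integral of `f` over the sphere of radius `r` with respect to the measure of the unit sphere. -/
noncomputable def sphereIntegral (f : E → ℝ) (r : ℝ) : ℝ :=
  ∫ θ, f (r • (θ : E)) ∂(volume : Measure E).toSphere

theorem integral_eq_integral_sphereIntegral {h : E → ℝ} (hh : Integrable h) :
    ∫ x, h x = ∫ r in Ioi (0 : ℝ), r ^ (Module.finrank ℝ E - 1) * sphereIntegral h r := by
  have hp := measurePreserving_polar (E := E)
  have hi := hp.integrable_comp_of_integrable hh
  rw [← hp.map_eq, integral_map hp.aemeasurable (by rw [hp.map_eq]; exact hh.aestronglyMeasurable),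
    integral_prod_symm (fun z : Metric.sphere (0 : E) 1 × ℝ => h (z.2 • (z.1 : E))) hi, integral_withDensity_eq_integral_toReal_smul (by fun_prop) (by simp)]
  apply setIntegral_congr_fun measurableSet_Ioi
  intro r hr
  simp only [sphereIntegral, smul_eq_mul]
  rw [ENNReal.toReal_ofReal (pow_nonneg (le_of_lt hr) _)]

theorem continuous_sphereIntegral {f : E → ℝ} (hf : Continuous f) : Continuous (sphereIntegral f) := by
  have hc : Continuous (Function.uncurry fun (r : ℝ) (θ : Metric.sphere (0 : E) 1) => f (r • (θ : E))) := by
    unfold Function.uncurry; fun_prop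
  have : CompactSpace (Metric.sphere (0 : E) 1) := isCompact_iff_compactSpace.1 (isCompact_sphere _ _)
  have h := continuous_parametric_integral_of_continuous (μ := (volume : Measure E).toSphere) hc isCompact_univ
  simp only [Measure.restrict_univ] at h
  exact h

end Polar

theorem continuous_radial_div {E : Type*} [NormedAddCommGroup E] {η : ℝ → ℝ} (hη : Continuous η) {ε : ℝ}
    (hε : 0 < ε) (hηε : ∀ r < ε, η r = 0) : Continuous fun x : E => η ‖x‖ * ‖x‖⁻¹ := by
  rw [continuous_iff_continuousAt]
  intro x
  by_cases hx : x = 0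
  · subst hx
    have : (fun x : E => η ‖x‖ * ‖x‖⁻¹) =ᶠ[nhds 0] fun _ => 0 := by
      filter_upwards [Metric.ball_mem_nhds (0 : E) hε] with y hy
      rw [hηε _ (by simpa using hy), zero_mul]
    exact continuousAt_const.congr this.symm
  · exact (hη.comp continuous_norm).continuousAt.mul
      (continuous_norm.continuousAt.inv₀ (norm_ne_zero_iff.2 hx))

/-- Only the origin needs care: η vanishes below ε, so χ(|x|) is constant near 0 and the non-smooth
norm does no harm. -/
theorem hasFDerivAt_radial {E : Type*} [NormedAddCommGroup E] [InnerProductSpace ℝ E] {χ η : ℝ → ℝ} (hχ : ∀ r, HasDerivAt χ (η r) r) {ε : ℝ} (hε : 0 < ε)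
    (hη : ∀ r < ε, η r = 0) (x : E) :
    HasFDerivAt (fun x : E => χ ‖x‖) ((η ‖x‖ * ‖x‖⁻¹) • innerSL ℝ x) x := by
  by_cases hx : x = 0
  · subst hx
    rw [norm_zero, hη 0 hε, zero_mul, zero_smul]
    have hc : ∀ r ∈ Iio ε, χ r = χ 0 := by
      intro r hr
      refine (convex_Iio ε).is_const_of_fderivWithin_eq_zero (𝕜 := ℝ) (f := χ)
        (fun y _ => (hχ y).differentiableAt.differentiableWithinAt) (fun y hy => ?_) hr hε
      have := (hχ y).hasDerivWithinAt (s := Iio ε) |>.hasFDerivWithinAt.fderivWithin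
        (isOpen_Iio.uniqueDiffWithinAt hy)
      rw [this, hη y hy]; ext; simp
    have : (fun x : E => χ ‖x‖) =ᶠ[nhds 0] fun _ => χ 0 := by
      filter_upwards [Metric.ball_mem_nhds (0 : E) hε] with y hy
      exact hc _ (by simpa using hy)
    exact (hasFDerivAt_const (χ 0) (0 : E)).congr_of_eventuallyEq this
  · have h1 := (hasStrictFDerivAt_norm_sq x).hasFDerivAt.sqrt
      (by positivity)
    have e : (fun y : E => Real.sqrt (‖y‖ ^ 2)) = fun y => ‖y‖ := by
      funext y; exact Real.sqrt_sq (norm_nonneg y)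
    rw [e] at h1
    have h2 := (hχ ‖x‖).comp_hasFDerivAt x h1
    refine h2.congr_fderiv ?_
    ext v
    have : ‖x‖ ≠ 0 := norm_ne_zero_iff.2 hx
    simp [Real.sqrt_sq (norm_nonneg x)]
    field_simp

section Darboux

variable {E ι : Type*} [NormedAddCommGroup E] [InnerProductSpace ℝ E] [FiniteDimensional ℝ E]
  [MeasureSpace E] [BorelSpace E] [(volume : Measure E).IsAddHaarMeasure] [Nontrivial E]
  [Fintype ι]

/-- Integrate by parts once in each basis direction. The gradient of χ(|x|) is η(|x|)x/|x|, so the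
sum over the basis reassembles the derivative of Ψ in the direction x. -/
theorem integral_dirDeriv_dirDeriv_mul_radial (e : OrthonormalBasis ι ℝ E) {Ψ : E → ℝ} (hΨ : ContDiff ℝ ∞ Ψ)
    {χ η : ℝ → ℝ} (hχ : ∀ r, HasDerivAt χ (η r) r) (hη : Continuous η) {ε R : ℝ} (hε : 0 < ε)
    (hηε : ∀ r < ε, η r = 0) (hR : ∀ r, R ≤ r → χ r = 0) :
    ∫ x, (∑ i, dirDeriv (e i) (dirDeriv (e i) Ψ) x) * χ ‖x‖ =
      -∫ x, (η ‖x‖ * ‖x‖⁻¹) * fderiv ℝ Ψ x x := by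
  have hd := hasFDerivAt_radial (E := E) hχ hε hηε
  have hcχ : Continuous χ := continuous_iff_continuousAt.2 fun r => (hχ r).continuousAt
  have hcg : Continuous fun x : E => χ ‖x‖ := by fun_prop
  have hsupp : HasCompactSupport fun x : E => χ ‖x‖ :=
    HasCompactSupport.intro (isCompact_closedBall (0 : E) R) fun x hx => hR _ (by
      simp at hx; exact hx.le)
  have hinv := continuous_radial_div (E := E) hη hε hηε
  have hsupp' : HasCompactSupport fun x : E => η ‖x‖ * ‖x‖⁻¹ :=
    HasCompactSupport.intro (isCompact_closedBall (0 : E) R) fun x hx => by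
      have hx' : R < ‖x‖ := by simpa using hx
      have : χ =ᶠ[nhds ‖x‖] fun _ => 0 := by
        filter_upwards [Ioi_mem_nhds hx'] with r hr using hR r (le_of_lt hr)
      rw [((hχ ‖x‖).congr_of_eventuallyEq this.symm).unique (hasDerivAt_const _ _), zero_mul]
  have c1 : ∀ i, ContDiff ℝ ∞ (dirDeriv (e i) Ψ) := fun i => hΨ.dirDeriv_infty _
  have c2 : ∀ i, Continuous (dirDeriv (e i) (dirDeriv (e i) Ψ)) := fun i => ((c1 i).dirDeriv_infty _).continuous
  have hfd : ∀ x v, fderiv ℝ (fun x : E => χ ‖x‖) x v = (η ‖x‖ * ‖x‖⁻¹) * inner ℝ x v := by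
    intro x v; rw [(hd x).fderiv]; rfl
  have i1 : ∀ i, Integrable fun x => dirDeriv (e i) (dirDeriv (e i) Ψ) x * χ ‖x‖ := fun i =>
    ((c2 i).mul hcg).integrable_of_hasCompactSupport hsupp.mul_left
  have i2 : ∀ i, Integrable fun x => dirDeriv (e i) Ψ x * ((η ‖x‖ * ‖x‖⁻¹) * inner ℝ x (e i)) := fun i =>
    ((c1 i).continuous.mul (hinv.mul (by fun_prop))).integrable_of_hasCompactSupport
      (HasCompactSupport.mul_left (HasCompactSupport.mul_right hsupp'))
  have hi : ∀ i, ∫ x, dirDeriv (e i) (dirDeriv (e i) Ψ) x * χ ‖x‖ =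
      - ∫ x, dirDeriv (e i) Ψ x * ((η ‖x‖ * ‖x‖⁻¹) * inner ℝ x (e i)) := by
    intro i
    have := integral_mul_fderiv_eq_neg_fderiv_mul_of_integrable (μ := (volume : Measure E))
      (f := dirDeriv (e i) Ψ) (g := fun x => χ ‖x‖) (v := e i) (i1 i)
      (by simp_rw [hfd]; exact i2 i)
      (((c1 i).continuous.mul hcg).integrable_of_hasCompactSupport hsupp.mul_left)
      (fun x _ => (c1 i).differentiable (by simp) x) (fun x _ => (hd x).differentiableAt)
    simp_rw [hfd] at this
    rw [this, neg_neg]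
    rfl
  simp_rw [Finset.sum_mul]
  rw [integral_finsetSum _ fun i _ => i1 i]
  simp_rw [hi]
  rw [Finset.sum_neg_distrib, ← integral_finsetSum _ fun i _ => i2 i]
  congr 1
  apply integral_congr_ae
  refine ae_of_all _ fun x => ?_
  simp only
  have hx : fderiv ℝ Ψ x x = ∑ i, fderiv ℝ Ψ x (e.repr x i • e i) := by
    rw [← map_sum, e.sum_repr]
  rw [hx, Finset.mul_sum]
  apply Finset.sum_congr rfl
  intro i _
  rw [map_smul, e.repr_apply_apply, real_inner_comm, smul_eq_mul, dirDeriv]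
  ring

/-- The divergence theorem on the ball of radius r, proved weakly in r: both sides are continuous,
and their difference integrates to zero against every smooth η with compact support in (0, ∞). This
follows by testing the Laplacian against χ(|x|) with χ' = η and writing both integrals in polar
coordinates. -/
theorem pow_mul_sphereIntegral_deriv (e : OrthonormalBasis ι ℝ E) {Ψ : E → ℝ} (hΨ : ContDiff ℝ ∞ Ψ) {r : ℝ}
    (hr : 0 < r) :
    r ^ (Module.finrank ℝ E - 1) *
        ∫ θ, fderiv ℝ Ψ (r • (θ : E)) (θ : E) ∂(volume : Measure E).toSphere =
      ∫ s in (0 : ℝ)..r, s ^ (Module.finrank ℝ E - 1) *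
        sphereIntegral (fun x => ∑ i, dirDeriv (e i) (dirDeriv (e i) Ψ) x) s := by
  set d := Module.finrank ℝ E - 1
  set Q : ℝ → ℝ := sphereIntegral (fun x => ∑ i, dirDeriv (e i) (dirDeriv (e i) Ψ) x) with hQ
  set D : ℝ → ℝ := fun r => ∫ θ, fderiv ℝ Ψ (r • (θ : E)) (θ : E) ∂(volume : Measure E).toSphere with hD
  have cL : Continuous fun x => ∑ i, dirDeriv (e i) (dirDeriv (e i) Ψ) x :=
    continuous_finsetSum _ fun i _ => ((hΨ.dirDeriv_infty _).dirDeriv_infty _).continuous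
  have cQ : Continuous Q := continuous_sphereIntegral cL
  have cD : Continuous D := by
    have hc : Continuous (Function.uncurry fun (r : ℝ) (θ : Metric.sphere (0 : E) 1) =>
        fderiv ℝ Ψ (r • (θ : E)) (θ : E)) := by
      have := hΨ.continuous_fderiv (by simp)
      unfold Function.uncurry; fun_prop
    have : CompactSpace (Metric.sphere (0 : E) 1) := isCompact_iff_compactSpace.1 (isCompact_sphere _ _)
    have h := continuous_parametric_integral_of_continuous (μ := (volume : Measure E).toSphere) hc isCompact_univ
    simp only [Measure.restrict_univ] at h
    exact h
  set I : ℝ → ℝ := fun r => ∫ s in (0 : ℝ)..r, s ^ d * Q s with hI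
  have cI' : Continuous fun s => s ^ d * Q s := by fun_prop
  have dI : ∀ r, HasDerivAt I (r ^ d * Q r) r := fun r =>
    intervalIntegral.integral_hasDerivAt_right (cI'.intervalIntegrable _ _)
      (cI'.stronglyMeasurableAtFilter _ _) cI'.continuousAt
  have cI : Continuous I := continuous_iff_continuousAt.2 fun r => (dI r).continuousAt
  have cJ : Continuous fun r => r ^ d * D r - I r := by fun_prop
  have key : ∀ᵐ r, r ∈ Ioi (0 : ℝ) → r ^ d * D r - I r = 0 := by
    apply isOpen_Ioi.ae_eq_zero_of_integral_contDiff_smul_eq_zero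
    · exact cJ.locallyIntegrable.locallyIntegrableOn _
    intro η hη hηc hηs
    have cη := hη.continuous
    obtain ⟨ε, hε, hηε⟩ : ∃ ε > 0, ∀ r < ε, η r = 0 := by
      rcases (tsupport η).eq_empty_or_nonempty with h | h
      · refine ⟨1, one_pos, fun r _ => image_eq_zero_of_notMem_tsupport (by simp [h])⟩
      · obtain ⟨m, hm, hm'⟩ := hηc.isCompact.exists_isLeast h
        refine ⟨m, hηs hm, fun r hr => image_eq_zero_of_notMem_tsupport fun hr' => ?_⟩
        exact absurd (hm' hr') (not_le.2 hr)
    obtain ⟨R, hR0, hR⟩ : ∃ R > 0, ∀ r, R ≤ r → η r = 0 := by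
      obtain ⟨R, hR⟩ := hηc.isCompact.bddAbove
      refine ⟨max R 0 + 1, by positivity, fun r hr => image_eq_zero_of_notMem_tsupport fun hr' => ?_⟩
      have := hR hr'
      have := le_max_left R 0
      linarith
    -- The primitive is based at R, so χ vanishes beyond R and χ(|x|) has compact support; near 0 it
    -- is constant but in general nonzero.
    set χ : ℝ → ℝ := fun r => ∫ s in R..r, η s with hχ
    have dχ : ∀ r, HasDerivAt χ (η r) r := fun r =>
      intervalIntegral.integral_hasDerivAt_right (cη.intervalIntegrable _ _)
        (cη.stronglyMeasurableAtFilter _ _) cη.continuousAt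
    have cχ : Continuous χ := continuous_iff_continuousAt.2 fun r => (dχ r).continuousAt
    have hχR : ∀ r, R ≤ r → χ r = 0 := fun r hr => by
      rw [hχ]
      simp only
      rw [intervalIntegral.integral_congr (g := fun _ => 0)]
      · simp
      · intro s hs
        rw [uIcc_of_le hr] at hs
        exact hR s hs.1
    have h1 := integral_dirDeriv_dirDeriv_mul_radial e hΨ dχ cη hε hηε hχR
    have toInt : ∀ g : ℝ → ℝ, (∀ r, R ≤ r → g r = 0) → ∫ r in Ioi (0 : ℝ), g r = ∫ r in (0 : ℝ)..R, g r := by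
      intro g hg
      rw [intervalIntegral.integral_of_le hR0.le]
      apply setIntegral_eq_of_subset_of_forall_sdiff_eq_zero measurableSet_Ioi Ioc_subset_Ioi_self
      intro x hx
      apply hg
      by_contra h
      exact hx.2 ⟨hx.1, (not_le.1 h).le⟩
    have hl : ∫ x, (∑ i, dirDeriv (e i) (dirDeriv (e i) Ψ) x) * χ ‖x‖ = -∫ r in (0 : ℝ)..R, I r * η r := by
      have hint : Integrable fun x : E => (∑ i, dirDeriv (e i) (dirDeriv (e i) Ψ) x) * χ ‖x‖ := by
        apply Continuous.integrable_of_hasCompactSupport (by fun_prop)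
        apply HasCompactSupport.mul_left
        exact HasCompactSupport.intro (isCompact_closedBall (0 : E) R) fun x hx => hχR _ (by
          simp at hx; exact hx.le)
      rw [integral_eq_integral_sphereIntegral hint]
      have : ∀ r ∈ Ioi (0 : ℝ), r ^ (Module.finrank ℝ E - 1) * sphereIntegral (fun x : E =>
          (∑ i, dirDeriv (e i) (dirDeriv (e i) Ψ) x) * χ ‖x‖) r = (r ^ d * Q r) * χ r := by
        intro r hr
        rw [hQ]
        unfold sphereIntegral
        rw [mul_assoc, ← integral_mul_const]
        congr 2
        ext θ
        simp only
        rw [norm_smul, norm_eq_of_mem_sphere, mul_one, Real.norm_of_nonneg (le_of_lt hr)]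
      rw [setIntegral_congr_fun measurableSet_Ioi this, toInt _ (fun r hr => by rw [hχR r hr, mul_zero]),
        intervalIntegral.integral_mul_deriv_eq_deriv_mul (fun x _ => dI x) (fun x _ => dχ x)
          (cI'.intervalIntegrable _ _) (cη.intervalIntegrable _ _), hχR R le_rfl]
      simp [hI]
    have hrr : ∫ x, (η ‖x‖ * ‖x‖⁻¹) * fderiv ℝ Ψ x x = ∫ r in (0 : ℝ)..R, r ^ d * D r * η r := by
      have hint : Integrable fun x : E => (η ‖x‖ * ‖x‖⁻¹) * fderiv ℝ Ψ x x := by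
        apply Continuous.integrable_of_hasCompactSupport
        · have := hΨ.continuous_fderiv (by simp)
          exact (continuous_radial_div cη hε hηε).mul (by fun_prop)
        · apply HasCompactSupport.mul_right
          exact HasCompactSupport.intro (isCompact_closedBall (0 : E) R) fun x hx => by
            rw [hR _ (by simp at hx; exact hx.le), zero_mul]
      rw [integral_eq_integral_sphereIntegral hint]
      have : ∀ r ∈ Ioi (0 : ℝ), r ^ (Module.finrank ℝ E - 1) * sphereIntegral (fun x : E =>
          (η ‖x‖ * ‖x‖⁻¹) * fderiv ℝ Ψ x x) r = r ^ d * D r * η r := by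
        intro r hr
        rw [hD]
        unfold sphereIntegral
        rw [mul_assoc, ← integral_mul_const]
        congr 2
        ext θ
        have hr' : r ≠ 0 := ne_of_gt hr
        simp only
        rw [norm_smul, norm_eq_of_mem_sphere, mul_one, Real.norm_of_nonneg (le_of_lt hr), map_smul,
          smul_eq_mul]
        field_simp
      rw [setIntegral_congr_fun measurableSet_Ioi this, toInt _ (fun r hr => by rw [hR r hr, mul_zero])]
    have hfin : ∫ r, η r • (r ^ d * D r - I r) =
        (∫ r in (0 : ℝ)..R, r ^ d * D r * η r) - ∫ r in (0 : ℝ)..R, I r * η r := by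
      rw [← intervalIntegral.integral_sub (Continuous.intervalIntegrable (by fun_prop) _ _)
        (Continuous.intervalIntegrable (by fun_prop) _ _),
        ← toInt _ (fun r hr => by rw [hR r hr]; ring), ← setIntegral_univ]
      symm
      rw [setIntegral_eq_of_subset_of_forall_sdiff_eq_zero (f := fun r => η r • (r ^ d * D r - I r))
        (s := Ioi 0) MeasurableSet.univ (subset_univ _)]
      · apply setIntegral_congr_fun measurableSet_Ioi
        intro r _
        simp only [smul_eq_mul]; ring
      · intro r hr
        rw [hηε r (lt_of_le_of_lt (not_lt.1 hr.2) hε), zero_smul]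
    rw [hfin, ← hrr]
    linarith
  have hcl : r ^ d * D r - I r = 0 := by
    by_contra hne
    have hopen : IsOpen {r : ℝ | 0 < r ∧ r ^ d * D r - I r ≠ 0} :=
      (isOpen_lt continuous_const continuous_id).inter (isOpen_ne_fun cJ continuous_const)
    have hpos := hopen.measure_pos volume ⟨r, hr, hne⟩
    refine hpos.ne' ?_
    rw [ae_iff] at key
    refine measure_mono_null (fun s hs => ?_) key
    exact fun h => hs.2 (h hs.1)
  linarith
end Darboux

theorem dirDeriv_eventuallyEq {V : Type*} [NormedAddCommGroup V] [NormedSpace ℝ V] {f g : V → ℝ} {z : V}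
    (e : f =ᶠ[nhds z] g) (h : V) : dirDeriv h f =ᶠ[nhds z] dirDeriv h g := by
  filter_upwards [e.fderiv (𝕜 := ℝ)] with y hy
  rw [dirDeriv, hy, dirDeriv]

theorem dirDeriv_comp_clm {V W : Type*} [NormedAddCommGroup V] [NormedSpace ℝ V]
    [NormedAddCommGroup W] [NormedSpace ℝ W] {f : W → ℝ} (hf : ContDiff ℝ ∞ f) (T : V →L[ℝ] W) (h : V) :
    dirDeriv h (fun p => f (T p)) = fun p => dirDeriv (T h) f (T p) := by
  ext p
  have := (hf.differentiable (by simp) (T p)).hasFDerivAt.comp p T.hasFDerivAt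
  unfold dirDeriv
  rw [HasFDerivAt.fderiv (f := fun p => f (T p)) this]
  rfl

theorem dAlembertian_eq_zero_of_eventuallyEq {n : ℕ} {φ : SpaceTime n → ℝ} (hφ : ContDiff ℝ ∞ φ)
    {z : SpaceTime n} (e : φ =ᶠ[nhds z] 0) : dAlembertian φ z = 0 := by
  have h0 : ∀ h : SpaceTime n, dirDeriv h (0 : SpaceTime n → ℝ) = 0 := by
    intro h; ext y; simp [dirDeriv]
  have : ∀ h, dirDeriv h (dirDeriv h φ) z = 0 := by
    intro h
    have e1 := dirDeriv_eventuallyEq e h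
    rw [h0] at e1
    have e2 := dirDeriv_eventuallyEq e1 h
    rw [h0] at e2
    exact e2.eq_of_nhds
  rw [dAlembertian_eq hφ]
  simp [this]

/-! ### Spherical means and the Euler–Poisson–Darboux equation -/

section NullMean

variable {n : ℕ}

/-- Integral of `φ` over the sphere with time and radius `z`. -/
noncomputable def timeMean (φ : SpaceTime n → ℝ) (z : ℝ × ℝ) : ℝ :=
  ∫ θ, φ (z.1, z.2 • (θ : EuclideanSpace ℝ (Fin n))) ∂(volume : Measure (EuclideanSpace ℝ (Fin n))).toSphere

/-- Integral of `φ` over the sphere with null coordinates `p`. -/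
noncomputable def nullMean (φ : SpaceTime n → ℝ) (p : ℝ × ℝ) : ℝ :=
  ∫ θ, φ (nullPoint (θ, p)) ∂(volume : Measure (EuclideanSpace ℝ (Fin n))).toSphere

/-- Time and radius in terms of null coordinates. -/
noncomputable def nullMap : ℝ × ℝ →L[ℝ] ℝ × ℝ :=
  (((1 / 2 : ℝ) • (ContinuousLinearMap.fst ℝ ℝ ℝ + ContinuousLinearMap.snd ℝ ℝ ℝ)).prod
    ((1 / 2 : ℝ) • (ContinuousLinearMap.snd ℝ ℝ ℝ - ContinuousLinearMap.fst ℝ ℝ ℝ)))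

theorem nullMap_apply (p : ℝ × ℝ) : nullMap p = ((p.1 + p.2) / 2, nullRadius p) := by
  unfold nullMap nullRadius
  ext <;> simp <;> ring

theorem nullMean_eq_timeMean (φ : SpaceTime n → ℝ) :
    nullMean φ = fun p => timeMean φ (nullMap p) := by
  ext p
  rw [nullMap_apply]; rfl

variable {φ : SpaceTime n → ℝ}

theorem compactSpace_sphere : CompactSpace (Metric.sphere (0 : EuclideanSpace ℝ (Fin n)) 1) :=
  isCompact_iff_compactSpace.1 (isCompact_sphere _ _)

theorem integrable_sphere {f : Metric.sphere (0 : EuclideanSpace ℝ (Fin n)) 1 → ℝ} (hf : Continuous f) :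
    Integrable f (volume : Measure (EuclideanSpace ℝ (Fin n))).toSphere := by
  have := compactSpace_sphere (n := n)
  exact hf.integrable_of_hasCompactSupport (HasCompactSupport.of_compactSpace f)

theorem contDiff_timeMean (hφ : ContDiff ℝ ∞ φ) : ContDiff ℝ ∞ (timeMean φ) := by
  have := compactSpace_sphere (n := n)
  rw [contDiff_infty]
  intro m
  refine contDiff_integral_of_contDiff (H := ℝ × ℝ) (W := EuclideanSpace ℝ (Fin n))
    (Ψ := fun w => φ (w.1.1, w.1.2 • w.2)) ?_ continuous_subtype_val
  exact (hφ.of_le (by exact_mod_cast le_top)).comp (by fun_prop)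

theorem dirDeriv_timeMean (hφ : ContDiff ℝ ∞ φ) (h z : ℝ × ℝ) :
    dirDeriv h (timeMean φ) z =
      ∫ θ, dirDeriv (h.1, h.2 • (θ : EuclideanSpace ℝ (Fin n))) φ (z.1, z.2 • (θ : EuclideanSpace ℝ (Fin n)))
        ∂(volume : Measure (EuclideanSpace ℝ (Fin n))).toSphere := by
  have := compactSpace_sphere (n := n)
  have hΨ : ContDiff ℝ 1 (fun w : (ℝ × ℝ) × EuclideanSpace ℝ (Fin n) => φ (w.1.1, w.1.2 • w.2)) :=
    (hφ.of_le (by exact_mod_cast le_top)).comp (by fun_prop)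
  have hd := hasFDerivAt_integral_of_contDiff
    (μ := (volume : Measure (EuclideanSpace ℝ (Fin n))).toSphere) hΨ
    (ι := fun θ : Metric.sphere (0 : EuclideanSpace ℝ (Fin n)) 1 => (θ : EuclideanSpace ℝ (Fin n)))
    continuous_subtype_val z
  unfold dirDeriv
  have hd' : fderiv ℝ (timeMean φ) z = _ := HasFDerivAt.fderiv hd
  rw [hd', ContinuousLinearMap.integral_apply]
  · apply integral_congr_ae
    refine ae_of_all _ fun θ => ?_
    simp only
    have h1 := (hφ.differentiable (by simp) (z.1, z.2 • (θ : EuclideanSpace ℝ (Fin n)))).hasFDerivAt.comp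
      (f := fun w : ℝ × ℝ => (w.1, w.2 • (θ : EuclideanSpace ℝ (Fin n)))) z
      (hasFDerivAt_fst.prodMk (hasFDerivAt_snd.smul_const (θ : EuclideanSpace ℝ (Fin n))))
    have h2 := (hΨ.differentiable one_ne_zero (z, (θ : EuclideanSpace ℝ (Fin n)))).hasFDerivAt.comp
      (f := fun e : ℝ × ℝ => (e, (θ : EuclideanSpace ℝ (Fin n)))) z
      (hasFDerivAt_prodMk_left z (θ : EuclideanSpace ℝ (Fin n)))
    have h3 := h2.unique h1
    have h4 := congrArg (fun L => L h) h3
    simpa using h4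
  · apply Continuous.integrable_of_hasCompactSupport _ (HasCompactSupport.of_compactSpace _)
    have := hΨ.continuous_fderiv one_ne_zero
    exact (this.comp (by fun_prop)).clm_comp continuous_const

theorem timeMean_sub {f g : SpaceTime n → ℝ} (hf : Continuous f) (hg : Continuous g) (z : ℝ × ℝ) :
    timeMean (fun y => f y - g y) z = timeMean f z - timeMean g z :=
  integral_sub (integrable_sphere (by fun_prop)) (integrable_sphere (by fun_prop))

theorem timeMean_darboux [NeZero n] (hφ : ContDiff ℝ ∞ φ) {t r : ℝ} (hr : 0 < r) :
    r ^ (n - 1) * dirDeriv (0, 1) (timeMean φ) (t, r) = ∫ s in (0 : ℝ)..r, s ^ (n - 1) *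
      timeMean (fun z => ∑ i, dirDeriv (0, EuclideanSpace.basisFun (Fin n) ℝ i)
        (dirDeriv (0, EuclideanSpace.basisFun (Fin n) ℝ i) φ) z) (t, s) := by
  have hs : ContDiff ℝ ∞ (fun y => φ (t, y)) := hφ.comp (by fun_prop)
  have : Nontrivial (EuclideanSpace ℝ (Fin n)) := by
    apply Module.nontrivial_of_finrank_pos (R := ℝ)
    rw [finrank_euclideanSpace_fin]; exact Nat.pos_of_neZero n
  have h := pow_mul_sphereIntegral_deriv (EuclideanSpace.basisFun (Fin n) ℝ) hs hr
  rw [finrank_euclideanSpace_fin] at h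
  have e1 : dirDeriv (0, 1) (timeMean φ) (t, r) = ∫ θ, fderiv ℝ (fun y => φ (t, y)) (r • (θ : EuclideanSpace ℝ (Fin n)))
      (θ : EuclideanSpace ℝ (Fin n)) ∂(volume : Measure (EuclideanSpace ℝ (Fin n))).toSphere := by
    rw [dirDeriv_timeMean hφ]
    simp only [one_smul]
    apply integral_congr_ae
    refine ae_of_all _ fun θ => ?_
    exact (dirDeriv_slice_space hφ t _ _).symm
  rw [e1, h]
  congr 1
  ext s
  unfold sphereIntegral timeMean
  congr 2
  ext θ
  apply Finset.sum_congr rfl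
  intro i _
  have : dirDeriv (EuclideanSpace.basisFun (Fin n) ℝ i) (fun y => φ (t, y)) =
      fun y => dirDeriv (0, EuclideanSpace.basisFun (Fin n) ℝ i) φ (t, y) :=
    funext fun y => dirDeriv_slice_space hφ t y _
  rw [this, dirDeriv_slice_space (hφ.dirDeriv_infty _)]

theorem continuous_timeMean {f : SpaceTime n → ℝ} (hf : Continuous f) : Continuous (timeMean f) := by
  have := compactSpace_sphere (n := n)
  have hc : Continuous (Function.uncurry fun (z : ℝ × ℝ) (θ : Metric.sphere (0 : EuclideanSpace ℝ (Fin n)) 1) =>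
      f (z.1, z.2 • (θ : EuclideanSpace ℝ (Fin n)))) := by
    unfold Function.uncurry; fun_prop
  have h := continuous_parametric_integral_of_continuous
    (μ := (volume : Measure (EuclideanSpace ℝ (Fin n))).toSphere) hc isCompact_univ
  simp only [Measure.restrict_univ] at h
  exact h

theorem continuous_nullMean {f : SpaceTime n → ℝ} (hf : Continuous f) : Continuous (nullMean f) := by
  rw [nullMean_eq_timeMean]
  exact (continuous_timeMean hf).comp nullMap.continuous

theorem dirDeriv_time_timeMean (hφ : ContDiff ℝ ∞ φ) :
    dirDeriv (1, 0) (timeMean φ) = timeMean (dirDeriv (1, 0) φ) := by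
  ext z
  rw [dirDeriv_timeMean hφ]
  simp [timeMean]

theorem hasDerivAt_radius {f : ℝ × ℝ → ℝ} (hf : ContDiff ℝ ∞ f) (t r : ℝ) :
    HasDerivAt (fun r => f (t, r)) (dirDeriv (0, 1) f (t, r)) r :=
  (hf.differentiable (by simp) (t, r)).hasFDerivAt.comp_hasDerivAt r
      ((hasDerivAt_const r t).prodMk (hasDerivAt_id r))

theorem hasDerivAt_time {f : ℝ × ℝ → ℝ} (hf : ContDiff ℝ ∞ f) (t r : ℝ) :
    HasDerivAt (fun t => f (t, r)) (dirDeriv (1, 0) f (t, r)) t :=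
  (hf.differentiable (by simp) (t, r)).hasFDerivAt.comp_hasDerivAt t
      ((hasDerivAt_id t).prodMk (hasDerivAt_const t r))

/-- The spherical means satisfy the Euler-Poisson-Darboux equation. -/
theorem timeMean_dAlembertian {k : ℕ} (hn : n = 2 * k + 1) (hφ : ContDiff ℝ ∞ φ) {t r : ℝ} (hr : 0 < r) :
    timeMean (dAlembertian φ) (t, r) = dirDeriv (1, 0) (dirDeriv (1, 0) (timeMean φ)) (t, r) -
      dirDeriv (0, 1) (dirDeriv (0, 1) (timeMean φ)) (t, r) -
        2 * k / r * dirDeriv (0, 1) (timeMean φ) (t, r) := by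
  have : NeZero n := ⟨by omega⟩
  set L : SpaceTime n → ℝ := fun z => ∑ i, dirDeriv (0, EuclideanSpace.basisFun (Fin n) ℝ i)
        (dirDeriv (0, EuclideanSpace.basisFun (Fin n) ℝ i) φ) z with hL
  have cL : Continuous L := continuous_finsetSum _ fun i _ =>
    ((hφ.dirDeriv_infty _).dirDeriv_infty _).continuous
  have e1 : timeMean (dAlembertian φ) (t, r) =
      dirDeriv (1, 0) (dirDeriv (1, 0) (timeMean φ)) (t, r) - timeMean L (t, r) := by
    rw [dirDeriv_time_timeMean hφ, dirDeriv_time_timeMean (hφ.dirDeriv_infty _),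
      ← timeMean_sub ((hφ.dirDeriv_infty _).dirDeriv_infty _).continuous cL]
    congr 1
    exact funext (dAlembertian_eq hφ)
  rw [e1, sub_sub]
  congr 1
  have hM := (contDiff_timeMean hφ).dirDeriv_infty (0, 1)
  have cI : Continuous fun s => s ^ (2 * k) * timeMean L (t, s) := by
    have := continuous_timeMean cL
    fun_prop
  -- Differentiating the integrated Darboux identity and comparing with the product rule, as in
  -- `d2`, isolates the mean of the Laplacian.
  have d1 : HasDerivAt (fun r => r ^ (2 * k) * dirDeriv (0, 1) (timeMean φ) (t, r))
      (r ^ (2 * k) * timeMean L (t, r)) r := by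
    have h1 : HasDerivAt (fun r => ∫ s in (0 : ℝ)..r, s ^ (2 * k) * timeMean L (t, s))
      (r ^ (2 * k) * timeMean L (t, r)) r :=
      intervalIntegral.integral_hasDerivAt_right (cI.intervalIntegrable _ _)
        (cI.stronglyMeasurableAtFilter _ _) cI.continuousAt
    refine h1.congr_of_eventuallyEq ?_
    filter_upwards [Ioi_mem_nhds hr] with s hs
    have := timeMean_darboux hφ (t := t) hs
    rwa [show n - 1 = 2 * k by omega] at this
  have d2 := (hasDerivAt_pow (2 * k) r).mul (hasDerivAt_radius hM t r)
  have h3 := d1.unique d2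
  have hr0 : r ^ (2 * k) ≠ 0 := by positivity
  apply mul_left_cancel₀ hr0
  rw [h3]
  rcases Nat.eq_zero_or_pos k with rfl | hk
  · simp
  · obtain ⟨j, hj⟩ : ∃ j, 2 * k = j + 1 := ⟨2 * k - 1, by omega⟩
    have hj' : (2 * k : ℝ) = j + 1 := by exact_mod_cast hj
    rw [hj', hj]
    push_cast
    field_simp
    ring

/-- For n = 1 the Darboux identity carries no power of r, so its right side tends to 0 with r. This
supplies the axis condition `hd` of `wave_representation`. -/
theorem dirDeriv_radius_timeMean_zero (hn : n = 1) (hφ : ContDiff ℝ ∞ φ) (t : ℝ) :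
    dirDeriv (0, 1) (timeMean φ) (t, 0) = 0 := by
  subst hn
  set L : SpaceTime 1 → ℝ := fun z => ∑ i, dirDeriv (0, EuclideanSpace.basisFun (Fin 1) ℝ i)
        (dirDeriv (0, EuclideanSpace.basisFun (Fin 1) ℝ i) φ) z with hL
  have cL : Continuous fun s => timeMean L (t, s) := (continuous_timeMean
    (continuous_finsetSum _ fun i _ => ((hφ.dirDeriv_infty _).dirDeriv_infty _).continuous)).comp (by fun_prop)
  have c1 : Continuous fun r => dirDeriv (0, 1) (timeMean φ) (t, r) :=
    ((contDiff_timeMean hφ).dirDeriv_infty (0, 1)).continuous.comp (by fun_prop)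
  have c2 : Continuous fun r => ∫ s in (0 : ℝ)..r, timeMean L (t, s) :=
    intervalIntegral.continuous_primitive (fun _ _ => cL.intervalIntegrable _ _) 0
  have h1 := (c1.tendsto 0).mono_left (nhdsWithin_le_nhds (s := Ioi 0))
  have h2 := (c2.tendsto 0).mono_left (nhdsWithin_le_nhds (s := Ioi 0))
  have h3 : (fun r => dirDeriv (0, 1) (timeMean φ) (t, r)) =ᶠ[nhdsWithin 0 (Ioi 0)]
      fun r => ∫ s in (0 : ℝ)..r, timeMean L (t, s) := by
    filter_upwards [self_mem_nhdsWithin] with r hr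
    have := timeMean_darboux hφ (t := t) hr
    simpa only [Nat.sub_self, pow_zero, one_mul] using this
  have := tendsto_nhds_unique h1 (h2.congr' h3.symm)
  simpa using this

/-- In null coordinates the Darboux equation reads Aᵤᵥ - k/(v-u)(Aᵥ - Aᵤ) = ¼ mean(□φ), so
`wave_representation` applies. No decay in space is needed, since the part of the future of (a, b)
before a given time is bounded. -/
theorem nullMean_representation {k : ℕ} (hn : n = 2 * k + 1) (hφ : ContDiff ℝ ∞ φ) {T : ℝ}
    (hT : ∀ z : SpaceTime n, T ≤ z.1 → φ z = 0) {a b : ℝ} (hab : a < b) :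
    ((b - a) / 2) ^ k * nullMean φ (a, b) = ∫ p, waveKernel k (p, (a, b)) *
      (nullRadius p ^ k * (1 / 4 * nullMean (dAlembertian φ) p)) := by
  have hM := contDiff_timeMean hφ
  set M := timeMean φ with hMdef
  have hN : ContDiff ℝ ∞ (nullMean φ) := by
    rw [nullMean_eq_timeMean]; exact hM.comp nullMap.contDiff
  have e10 : nullMap (1, 0) = (1 / 2 : ℝ) • (1, 0) + (-(1 / 2) : ℝ) • (0, 1) := by
    rw [nullMap_apply]; unfold nullRadius; ext <;> simp <;> norm_num
  have e01 : nullMap (0, 1) = (1 / 2 : ℝ) • (1, 0) + (1 / 2 : ℝ) • (0, 1) := by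
    rw [nullMap_apply]; unfold nullRadius; ext <;> simp
  have hlin : ∀ (f : ℝ × ℝ → ℝ) (c d : ℝ) (z : ℝ × ℝ), dirDeriv (c • (1, 0) + d • (0, 1)) f z =
      c * dirDeriv (1, 0) f z + d * dirDeriv (0, 1) f z := by
    intro f c d z
    unfold dirDeriv
    rw [map_add, map_smul, map_smul, smul_eq_mul, smul_eq_mul]
  have hu : dirDeriv (1, 0) (nullMean φ) = fun p =>
      1 / 2 * dirDeriv (1, 0) M (nullMap p) - 1 / 2 * dirDeriv (0, 1) M (nullMap p) := by
    rw [nullMean_eq_timeMean, dirDeriv_comp_clm hM]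
    ext p
    rw [e10, hlin]; ring
  have hv : dirDeriv (0, 1) (nullMean φ) = fun p =>
      1 / 2 * dirDeriv (1, 0) M (nullMap p) + 1 / 2 * dirDeriv (0, 1) M (nullMap p) := by
    rw [nullMean_eq_timeMean, dirDeriv_comp_clm hM]
    ext p
    rw [e01, hlin]
  have huv : ∀ p, dirDeriv (0, 1) (dirDeriv (1, 0) (nullMean φ)) p =
      1 / 4 * (dirDeriv (1, 0) (dirDeriv (1, 0) M) (nullMap p) -
        dirDeriv (0, 1) (dirDeriv (0, 1) M) (nullMap p)) := by
    intro p
    have c1 := hM.dirDeriv_infty (1, 0)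
    have c2 := hM.dirDeriv_infty (0, 1)
    have hsub : ContDiff ℝ ∞ fun z => 1 / 2 * dirDeriv (1, 0) M z - 1 / 2 * dirDeriv (0, 1) M z := by
      fun_prop
    have hs : ∀ h z, dirDeriv h (fun z => 1 / 2 * dirDeriv (1, 0) M z - 1 / 2 * dirDeriv (0, 1) M z) z =
        1 / 2 * dirDeriv h (dirDeriv (1, 0) M) z - 1 / 2 * dirDeriv h (dirDeriv (0, 1) M) z := by
      intro h z
      have d1 := c1.differentiable (by simp) z
      have d2 := c2.differentiable (by simp) z
      have := ((d1.hasFDerivAt.const_mul (1 / 2 : ℝ)).sub (d2.hasFDerivAt.const_mul (1 / 2 : ℝ))).fderiv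
      unfold dirDeriv at this ⊢
      rw [show (fun z => 1 / 2 * fderiv ℝ M z (1, 0) - 1 / 2 * fderiv ℝ M z (0, 1)) = _ from rfl]
      erw [this]
      rfl
    rw [hu, dirDeriv_comp_clm hsub]
    simp only
    rw [hs, e01, hlin, hlin, dirDeriv_comm hM (0, 1) (1, 0)]
    ring
  -- The extra unit of time puts the points in an open set where φ vanishes, so that derivatives
  -- vanish there as well.
  refine wave_representation (T := T + 1) (G := fun p => 1 / 4 * nullMean (dAlembertian φ) p)
    (HasNullDerivs.of_contDiff (hN.of_le (WithTop.coe_le_coe.2 (le_top : (2 : ℕ∞) ≤ ⊤)))) ?_ ?_ ?_ ?_ hab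
  · exact continuous_const.mul (continuous_nullMean hφ.dAlembertian.continuous)
  · intro u v huv'
    have h1 := huv (u, v)
    have h2 := congrFun hu (u, v)
    have h3 := congrFun hv (u, v)
    have hr : 0 < nullRadius (u, v) := by unfold nullRadius; simp only; linarith
    have h4 := timeMean_dAlembertian hn hφ (t := (u + v) / 2) hr
    rw [show nullMean (dAlembertian φ) (u, v) = _ from congrFun (nullMean_eq_timeMean _) _]
    simp only [nullMap_apply] at h1 h2 h3 ⊢
    rw [h4]
    unfold dirDeriv at h1 h2 h3 ⊢
    rw [h1, h2, h3]
    have : v - u = 2 * nullRadius (u, v) := by unfold nullRadius; simp only; ring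
    rw [this]
    field_simp
    ring
  · intro hk s
    have h0 := dirDeriv_radius_timeMean_zero (by omega) hφ s
    have h2 := congrFun hu (s, s)
    have hs : nullMap (s, s) = (s, 0) := by rw [nullMap_apply]; unfold nullRadius; ext <;> simp
    simp only [hs] at h2
    rw [← hMdef] at h0
    rw [h0] at h2
    unfold dirDeriv at h2
    rw [h2]
    have h5 := hasDerivAt_time hM s 0
    have : (fun s => nullMean φ (s, s)) = fun s => M (s, 0) := by
      ext s
      rw [nullMean_eq_timeMean]
      have hs : nullMap (s, s) = (s, 0) := by rw [nullMap_apply]; unfold nullRadius; ext <;> simp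
      simp only [hs]; rfl
    rw [this]
    refine h5.congr_deriv ?_
    unfold dirDeriv; ring
  · intro u v huv'
    have hz : ∀ p : ℝ × ℝ, 2 * T ≤ p.1 + p.2 → nullMean φ p = 0 := by
      intro p hp
      unfold nullMean
      rw [integral_congr_ae (g := fun _ => 0)]
      · simp
      · refine ae_of_all _ fun θ => hT _ ?_
        simp only [nullPoint]; linarith
    refine ⟨hz _ (by simp only; linarith), ?_, ?_⟩
    · have : nullMean φ =ᶠ[nhds (u, v)] fun _ => 0 := by
        have ho : IsOpen {p : ℝ × ℝ | 2 * T < p.1 + p.2} := isOpen_lt (by fun_prop) (by fun_prop)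
        filter_upwards [ho.mem_nhds (show 2 * T < u + v by linarith)] with p hp
        exact hz p (le_of_lt hp)
      rw [this.fderiv_eq]; simp
    · unfold nullMean
      rw [integral_congr_ae (g := fun _ => 0)]
      · simp
      · refine ae_of_all _ fun θ => ?_
        apply dAlembertian_eq_zero_of_eventuallyEq hφ
        have ho : IsOpen {z : SpaceTime n | T < z.1} := isOpen_lt (by fun_prop) (by fun_prop)
        filter_upwards [ho.mem_nhds (show T < (nullPoint (θ, u, v) : SpaceTime n).1 by
          simp only [nullPoint]; linarith)] with z hz
        exact hT z (le_of_lt hz)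

end NullMean

/-! ### Uniqueness of weak solutions -/

section Uniqueness

open scoped Convolution

theorem dirDeriv_comp_affine {V W : Type*} [NormedAddCommGroup V] [NormedSpace ℝ V]
    [NormedAddCommGroup W] [NormedSpace ℝ W] {f : W → ℝ} (hf : ContDiff ℝ ∞ f) (T : V →L[ℝ] W) (c : W)
    (h : V) : dirDeriv h (fun p => f (c + T p)) = fun p => dirDeriv (T h) f (c + T p) := by
  ext p
  have := (hf.differentiable (by simp) (c + T p)).hasFDerivAt.comp p (T.hasFDerivAt.const_add c)
  unfold dirDeriv
  rw [HasFDerivAt.fderiv (f := fun p => f (c + T p)) this]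
  rfl

theorem dirDeriv_neg_neg {V : Type*} [NormedAddCommGroup V] [NormedSpace ℝ V] {f : V → ℝ} (h : V) :
    dirDeriv (-h) (dirDeriv (-h) f) = dirDeriv h (dirDeriv h f) := by
  have : dirDeriv (-h) f = -dirDeriv h f := by ext z; simp [dirDeriv]
  rw [this]
  ext z
  unfold dirDeriv
  rw [fderiv_neg]
  simp

variable {n : ℕ}

/-- Second derivatives do not see the sign of the direction. The two uses are y ↦ z - y, for
convolutions, and time reversal. -/
theorem dAlembertian_comp_affine {f : SpaceTime n → ℝ} (hf : ContDiff ℝ ∞ f)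
    (T : SpaceTime n →L[ℝ] SpaceTime n) (c : SpaceTime n) (h₁ : T (1, 0) = (1, 0) ∨ T (1, 0) = -(1, 0))
    (h₂ : ∀ e, T (0, e) = (0, e) ∨ T (0, e) = -(0, e)) (z : SpaceTime n) :
    dAlembertian (fun p => f (c + T p)) z = dAlembertian f (c + T z) := by
  have hc : ContDiff ℝ ∞ (fun p => f (c + T p)) := hf.comp (contDiff_const.add T.contDiff)
  have key : ∀ h, T h = h ∨ T h = -h → dirDeriv h (dirDeriv h (fun p => f (c + T p))) z =
      dirDeriv h (dirDeriv h f) (c + T z) := by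
    intro h hh
    rw [dirDeriv_comp_affine hf, dirDeriv_comp_affine (hf.dirDeriv_infty _)]
    rcases hh with e | e
    · rw [e]
    · rw [e, dirDeriv_neg_neg]
  rw [dAlembertian_eq hc, dAlembertian_eq hf, key _ h₁]
  congr 1
  exact Finset.sum_congr rfl fun i _ => key _ (h₂ _)

variable {Z ρ : SpaceTime n → ℝ}

theorem dirDeriv_convolution (hZ : LocallyIntegrable Z) (hρ : ContDiff ℝ ∞ ρ) (hc : HasCompactSupport ρ)
    (h : SpaceTime n) :
    dirDeriv h (Z ⋆[ContinuousLinearMap.mul ℝ ℝ, volume] ρ) =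
      (Z ⋆[ContinuousLinearMap.mul ℝ ℝ, volume] dirDeriv h ρ) := by
  ext z
  have h1 : ContDiff ℝ 1 ρ := hρ.of_le (by exact_mod_cast le_top)
  unfold dirDeriv
  have : (volume : Measure (SpaceTime n)).IsAddLeftInvariant :=
    inferInstanceAs ((volume : Measure ℝ).prod (volume : Measure (EuclideanSpace ℝ (Fin n)))).IsAddLeftInvariant
  have hd := hc.hasFDerivAt_convolution_right (ContinuousLinearMap.mul ℝ ℝ) hZ h1 z
  rw [HasFDerivAt.fderiv hd]
  exact convolution_precompR_apply (L := ContinuousLinearMap.mul ℝ ℝ) hZ (hc.fderiv ℝ)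
    (h1.continuous_fderiv one_ne_zero) z h

theorem dAlembertian_convolution (hZ : LocallyIntegrable Z) (hρ : ContDiff ℝ ∞ ρ) (hc : HasCompactSupport ρ)
    (z : SpaceTime n) :
    dAlembertian (Z ⋆[ContinuousLinearMap.mul ℝ ℝ, volume] ρ) z = ∫ y, Z y * dAlembertian ρ (z - y) := by
  have hcd : ContDiff ℝ ∞ (Z ⋆[ContinuousLinearMap.mul ℝ ℝ, volume] ρ) :=
    hc.contDiff_convolution_right _ hZ hρ
  have key : ∀ h, dirDeriv h (dirDeriv h (Z ⋆[ContinuousLinearMap.mul ℝ ℝ, volume] ρ)) z =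
      ∫ y, Z y * dirDeriv h (dirDeriv h ρ) (z - y) := by
    intro h
    rw [dirDeriv_convolution hZ hρ hc, dirDeriv_convolution hZ (hρ.dirDeriv_infty _) (hc.dirDeriv _)]
    rfl
  have hint : ∀ h, Integrable fun y => Z y * dirDeriv h (dirDeriv h ρ) (z - y) := fun h =>
    ((hc.dirDeriv h).dirDeriv h).convolutionExists_right (ContinuousLinearMap.mul ℝ ℝ) hZ
      ((hρ.dirDeriv_infty h).dirDeriv_infty h).continuous z
  rw [dAlembertian_eq hcd]
  simp_rw [dAlembertian_eq hρ, key, mul_sub, Finset.mul_sum]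
  rw [integral_sub (hint _) (integrable_finsetSum _ fun i _ => hint _),
    integral_finsetSum _ fun i _ => hint _]

theorem nontrivial_space [NeZero n] : Nontrivial (EuclideanSpace ℝ (Fin n)) := by
  apply Module.nontrivial_of_finrank_pos (R := ℝ)
  rw [finrank_euclideanSpace_fin]; exact Nat.pos_of_neZero n

/-- The pairing of Z with a test function η is g(0) for g = Z ⋆ η(-·), which is smooth, solves the
homogeneous equation and vanishes at early times. Reversed in time it satisfies
`nullMean_representation` with zero right side, so its means vanish off the axis, and by continuity
g(0) = 0. -/
theorem weak_uniqueness {k : ℕ} (hn : n = 2 * k + 1) (hZ : LocallyIntegrable Z)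
    (h0 : ∀ z, z.1 ≤ 0 → Z z = 0)
    (h : ∀ φ : SpaceTime n → ℝ, ContDiff ℝ ∞ φ → HasCompactSupport φ → ∫ z, Z z * dAlembertian φ z = 0) :
    ∀ᵐ z, Z z = 0 := by
  apply ae_eq_zero_of_integral_contDiff_smul_eq_zero hZ
  intro η hη hηc
  set ρ : SpaceTime n → ℝ := fun y => η (-y) with hρdef
  have hρ : ContDiff ℝ ∞ ρ := hη.comp contDiff_neg
  have hρc : HasCompactSupport ρ := hηc.comp_homeomorph (Homeomorph.neg _)
  set g := Z ⋆[ContinuousLinearMap.mul ℝ ℝ, volume] ρ with hgdef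
  have hg : ContDiff ℝ ∞ g := hρc.contDiff_convolution_right _ hZ hρ
  have hgbox : ∀ z, dAlembertian g z = 0 := by
    intro z
    rw [hgdef, dAlembertian_convolution hZ hρ hρc]
    have hc1 : ContDiff ℝ ∞ fun y => ρ (z + (-ContinuousLinearMap.id ℝ (SpaceTime n)) y) :=
      hρ.comp (contDiff_const.add (ContinuousLinearMap.contDiff _))
    have hc2 : HasCompactSupport fun y => ρ (z + (-ContinuousLinearMap.id ℝ (SpaceTime n)) y) := by
      have := hρc.comp_homeomorph ((Homeomorph.neg _).trans (Homeomorph.addLeft z))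
      exact this
    rw [← h _ hc1 hc2]
    congr 1
    ext y
    rw [dAlembertian_comp_affine hρ (-ContinuousLinearMap.id ℝ (SpaceTime n)) z (Or.inr rfl) fun e => Or.inr rfl]
    simp [sub_eq_add_neg]
  obtain ⟨R, hR⟩ : ∃ R : ℝ, ∀ z : SpaceTime n, R < z.1 → ρ (-z) = 0 := by
    obtain ⟨R, hR⟩ := hρc.isCompact.isBounded.exists_norm_le
    refine ⟨R, fun z hz => image_eq_zero_of_notMem_tsupport fun hz' => ?_⟩
    have h1 := hR _ hz'
    rw [norm_neg] at h1
    have := (norm_fst_le z).trans h1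
    rw [Real.norm_eq_abs] at this
    linarith [le_abs_self z.1]
  have hgR : ∀ z, z.1 ≤ -R → g z = 0 := by
    intro z hz
    rw [hgdef, convolution_def, integral_congr_ae (g := fun _ => 0)]
    · simp
    · refine ae_of_all _ fun y => ?_
      simp only [ContinuousLinearMap.mul_apply']
      by_cases hy : y.1 ≤ 0
      · rw [h0 y hy, zero_mul]
      · have := hR (y - z) (by simp only [Prod.fst_sub]; linarith)
        rw [neg_sub] at this
        rw [this, mul_zero]
  -- Time reversal: g vanishes in the past, while the representation formula asks for functions
  -- vanishing in the future.
  set T : SpaceTime n →L[ℝ] SpaceTime n :=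
    (-ContinuousLinearMap.fst ℝ ℝ (EuclideanSpace ℝ (Fin n))).prod (ContinuousLinearMap.snd ℝ ℝ _) with hTdef
  have hTa : ∀ z, T z = (-z.1, z.2) := fun z => rfl
  set Φ : SpaceTime n → ℝ := fun z => g (0 + T z) with hΦdef
  have hΦ : ContDiff ℝ ∞ Φ := hg.comp (contDiff_const.add T.contDiff)
  have hΦbox : ∀ z, dAlembertian Φ z = 0 := by
    intro z
    rw [hΦdef, dAlembertian_comp_affine hg T 0 (Or.inr (by rw [hTa]; simp)) fun e => Or.inl (by rw [hTa]; simp)]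
    exact hgbox _
  have hmean : ∀ a b, a < b → nullMean Φ (a, b) = 0 := by
    intro a b hab
    have h1 := nullMean_representation hn hΦ (T := R) (fun z hz => hgR _ (by rw [zero_add, hTa]; simpa using hz)) hab
    have h2 : nullMean (dAlembertian Φ) = fun _ => 0 := by
      ext p; unfold nullMean; simp [hΦbox]
    rw [h2] at h1
    simp only [mul_zero, integral_zero, mul_eq_zero] at h1
    rcases h1 with h1 | h1
    · have : (b - a) / 2 ≠ 0 := by linarith
      exact absurd h1 (pow_ne_zero _ this)
    · exact h1
  -- The formula requires a < b; the axis point is reached as a limit.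
  have hlim : nullMean Φ (0, 0) = 0 := by
    have hc : Continuous fun s : ℝ => nullMean Φ (0, s) := (continuous_nullMean hΦ.continuous).comp (by fun_prop)
    have h1 := (hc.tendsto 0).mono_left (nhdsWithin_le_nhds (s := Ioi 0))
    have h2 : (fun s : ℝ => nullMean Φ (0, s)) =ᶠ[nhdsWithin 0 (Ioi 0)] fun _ => 0 := by
      filter_upwards [self_mem_nhdsWithin] with s hs
      exact hmean 0 s hs
    exact tendsto_nhds_unique h1 (tendsto_const_nhds.congr' h2.symm)
  have : NeZero n := ⟨by omega⟩
  have := nontrivial_space (n := n)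
  have hσ : ((volume : Measure (EuclideanSpace ℝ (Fin n))).toSphere).real univ ≠ 0 := by
    rw [Measure.real, ENNReal.toReal_ne_zero]
    exact ⟨fun h => Measure.toSphere_ne_zero _ (Measure.measure_univ_eq_zero.1 h), measure_ne_top _ _⟩
  have h3 : nullMean Φ (0, 0) = ((volume : Measure (EuclideanSpace ℝ (Fin n))).toSphere).real univ * g 0 := by
    unfold nullMean
    have : ∀ θ : Metric.sphere (0 : EuclideanSpace ℝ (Fin n)) 1, Φ (nullPoint (θ, (0, 0))) = g 0 := by
      intro θ
      simp only [hΦdef, nullPoint, nullRadius, hTa]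
      simp [← Prod.zero_eq_mk]
    simp_rw [this]
    rw [integral_const, smul_eq_mul]
  rw [h3] at hlim
  have h4 := (mul_eq_zero.1 hlim).resolve_left hσ
  rw [hgdef, convolution_def] at h4
  rw [← h4]
  congr 1
  ext y
  simp [hρdef, mul_comm]

end Uniqueness

/-! ### Profiles of radial functions and their weighted norms -/

section Profile

variable {n k : ℕ}

/-- The surface measure of the unit sphere of `ℝⁿ`. -/
noncomputable abbrev sphereMeasure (n : ℕ) : Measure (Metric.sphere (0 : EuclideanSpace ℝ (Fin n)) 1) :=
  (volume : Measure (EuclideanSpace ℝ (Fin n))).toSphere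

/-- The null coordinates of a point of space-time. -/
noncomputable def nullCoords (z : SpaceTime n) : ℝ × ℝ := (z.1 - ‖z.2‖, z.1 + ‖z.2‖)

theorem continuous_nullCoords : Continuous (nullCoords (n := n)) := by
  unfold nullCoords; fun_prop

theorem nullCoords_nullPoint (θ : Metric.sphere (0 : EuclideanSpace ℝ (Fin n)) 1) {p : ℝ × ℝ}
    (hp : p.1 < p.2) : nullCoords (nullPoint (θ, p)) = p := by
  have hr : 0 ≤ nullRadius p := by unfold nullRadius; linarith
  unfold nullCoords nullPoint
  simp only
  rw [norm_smul, norm_eq_of_mem_sphere, mul_one, Real.norm_of_nonneg hr]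
  unfold nullRadius
  ext <;> simp only <;> ring

theorem measurePreserving_nullPoint_spaceTime (hn : n = 2 * k + 1) :
    MeasurePreserving (nullPoint (E := EuclideanSpace ℝ (Fin n))) ((sphereMeasure n).prod (nullMeasure k))
      volume := by
  have : NeZero n := ⟨by omega⟩
  have := nontrivial_space (n := n)
  exact measurePreserving_nullPoint (by rw [finrank_euclideanSpace_fin, hn])

theorem nullMeasure_absolutelyContinuous : nullMeasure k ≪ volume :=
  withDensity_absolutelyContinuous _ _

theorem ae_nullMeasure_lt : ∀ᵐ p ∂nullMeasure k, p.1 < p.2 := by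
  unfold nullMeasure
  rw [ae_withDensity_iff (measurable_nullDensity k)]
  refine ae_of_all _ fun p hp => ?_
  by_contra h
  exact hp (indicator_of_notMem (by exact h) _)

theorem ae_nullMeasure_fst_ne : ∀ᵐ p ∂nullMeasure k, p.1 ≠ 0 := by
  apply nullMeasure_absolutelyContinuous.ae_le
  have h0 : ∀ᵐ x : ℝ, x ≠ 0 := by simp [ae_iff]
  exact Measure.quasiMeasurePreserving_fst.ae h0

theorem ae_prod_of_ae_nullMeasure {P : ℝ × ℝ → Prop} (h : ∀ᵐ p ∂nullMeasure k, P p) :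
    ∀ᵐ z ∂(sphereMeasure n).prod (nullMeasure k), P z.2 :=
  Measure.quasiMeasurePreserving_snd.ae h

/-- `F` is replaced by a measurable representative first, since an almost-everywhere statement
passes through the image measure only for a measurable set. -/
theorem ae_of_ae_nullPoint (hn : n = 2 * k + 1) {F G : SpaceTime n → ℝ} (hF : AEStronglyMeasurable F volume)
    (hG : Measurable G)
    (h : ∀ᵐ z ∂(sphereMeasure n).prod (nullMeasure k), F (nullPoint z) = G (nullPoint z)) :
    ∀ᵐ z, F z = G z := by
  have hp := measurePreserving_nullPoint_spaceTime hn
  have h1 := hF.ae_eq_mk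
  have h2 := hp.quasiMeasurePreserving.ae h1
  have h3 : ∀ᵐ z ∂(sphereMeasure n).prod (nullMeasure k), hF.mk F (nullPoint z) = G (nullPoint z) := by
    filter_upwards [h, h2] with z hz hz2
    rw [← hz2, hz]
  have h4 : ∀ᵐ z ∂Measure.map nullPoint ((sphereMeasure n).prod (nullMeasure k)), hF.mk F z = G z :=
    (ae_map_iff hp.aemeasurable
      (measurableSet_eq_fun hF.stronglyMeasurable_mk.measurable hG)).2 h3
  rw [hp.map_eq] at h4
  filter_upwards [h1, h4] with z hz hz'
  rw [hz, hz']

theorem measurableSet_upperHalf : MeasurableSet (upperHalf n) :=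
  measurableSet_lt measurable_const measurable_fst

theorem locallyIntegrable_indicator_upperHalf {F : SpaceTime n → ℝ}
    (hF : LocallyIntegrableOn F {z : SpaceTime n | 0 ≤ z.1} volume) :
    LocallyIntegrable ((upperHalf n).indicator F) := by
  rw [locallyIntegrable_iff]
  intro K hK
  rw [IntegrableOn, integrable_indicator_iff measurableSet_upperHalf, IntegrableOn,
    Measure.restrict_restrict measurableSet_upperHalf]
  have hc : IsClosed {z : SpaceTime n | 0 ≤ z.1} := isClosed_le continuous_const continuous_fst
  have h1 : IntegrableOn F ({z : SpaceTime n | 0 ≤ z.1} ∩ K) :=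
    hF.integrableOn_compact_subset inter_subset_left (hK.inter_left hc)
  exact h1.mono_set (inter_subset_inter_left _ fun z (hz : 0 < z.1) => hz.le)

/-- By Fubini almost every direction θ₀ has a measurable slice. Take the profile from one of them;
spherical symmetry identifies all the others with it. Truncation to 0 < u < v makes the support
condition hold everywhere and costs only null sets, among them u = 0. -/
theorem exists_profile (hn : n = 2 * k + 1) {F : SpaceTime n → ℝ} (hs : SphericallySymmetric F)
    (hc : SupportedInForwardCone F) (hF : LocallyIntegrableOn F {z : SpaceTime n | 0 ≤ z.1} volume) :
    ∃ f : ℝ × ℝ → ℝ, Measurable f ∧ (∀ p, f p ≠ 0 → 0 < p.1 ∧ p.1 < p.2) ∧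
      ∀ᵐ z, (upperHalf n).indicator F z = f (nullCoords z) := by
  have : NeZero n := ⟨by omega⟩
  have := nontrivial_space (n := n)
  have hp := measurePreserving_nullPoint_spaceTime hn
  have hm : AEStronglyMeasurable ((upperHalf n).indicator F) volume :=
    (locallyIntegrable_indicator_upperHalf hF).aestronglyMeasurable
  have hm2 := hm.comp_measurePreserving hp
  have hm3 := hm2.prodMk_left
  have hne : (ae (sphereMeasure n)).NeBot := ae_neBot.2 (Measure.toSphere_ne_zero _)
  obtain ⟨θ₀, hθ⟩ := hm3.exists
  have hset : MeasurableSet {p : ℝ × ℝ | 0 < p.1 ∧ p.1 < p.2} :=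
    measurableSet_nullCone.inter measurableSet_null_lt
  refine ⟨{p : ℝ × ℝ | 0 < p.1 ∧ p.1 < p.2}.indicator (hθ.mk _),
    hθ.stronglyMeasurable_mk.measurable.indicator hset, fun p h => ?_, ?_⟩
  · by_contra h'
    exact h (indicator_of_notMem (by exact h') _)
  · apply ae_of_ae_nullPoint hn hm
    · exact (hθ.stronglyMeasurable_mk.measurable.indicator hset).comp continuous_nullCoords.measurable
    have h1 := ae_prod_of_ae_nullMeasure (n := n) hθ.ae_eq_mk
    filter_upwards [h1, ae_prod_of_ae_nullMeasure (n := n) ae_nullMeasure_lt,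
      ae_prod_of_ae_nullMeasure (n := n) ae_nullMeasure_fst_ne] with z hz1 hz2 hz3
    obtain ⟨θ, p⟩ := z
    simp only at hz1 hz2 hz3
    rw [nullCoords_nullPoint θ hz2]
    have hr : 0 ≤ nullRadius p := by unfold nullRadius; linarith
    have hnorm : ∀ θ : Metric.sphere (0 : EuclideanSpace ℝ (Fin n)) 1, ‖nullRadius p • (θ : EuclideanSpace ℝ (Fin n))‖ = nullRadius p := by
      intro θ
      rw [norm_smul, norm_eq_of_mem_sphere, mul_one, Real.norm_of_nonneg hr]
    by_cases ht : 0 < (p.1 + p.2) / 2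
    · have e : (upperHalf n).indicator F (nullPoint (θ, p)) = (upperHalf n).indicator F (nullPoint (θ₀, p)) := by
        rw [indicator_of_mem (show nullPoint (θ, p) ∈ upperHalf n from ht),
          indicator_of_mem (show nullPoint (θ₀, p) ∈ upperHalf n from ht)]
        exact hs _ _ _ ht (by rw [hnorm, hnorm])
      by_cases hu : 0 < p.1
      · rw [indicator_of_mem (show p ∈ {p : ℝ × ℝ | 0 < p.1 ∧ p.1 < p.2} from ⟨hu, hz2⟩), ← hz1]
        exact e
      · rw [indicator_of_notMem (show p ∉ {p : ℝ × ℝ | 0 < p.1 ∧ p.1 < p.2} from fun h => hu h.1),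
          indicator_of_mem (show nullPoint (θ, p) ∈ upperHalf n from ht)]
        apply hc _ _ ht
        rw [hnorm]
        have : p.1 < 0 := lt_of_le_of_ne (not_lt.1 hu) hz3
        unfold nullRadius; linarith
    · rw [indicator_of_notMem (show nullPoint (θ, p) ∉ upperHalf n from ht), indicator_of_notMem]
      rintro ⟨h, h'⟩
      exact ht (by linarith)

/-- Since t² - |x|² = uv, polar coordinates split off the area of the sphere. The support of `f`
lies where uv > 0, so the real power is a genuine positive weight. -/
theorem weightedNorm_eq (hn : n = 2 * k + 1) {F : SpaceTime n → ℝ} {f : ℝ × ℝ → ℝ} (hf : Measurable f)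
    (hf0 : ∀ p, f p ≠ 0 → 0 < p.1 ∧ p.1 < p.2)
    (h : ∀ᵐ z, (upperHalf n).indicator F z = f (nullCoords z)) (a : ℝ) {p : ℝ} (hp : 0 < p) :
    weightedNorm a p F = sphereMeasure n univ ^ (1 / p) *
      (∫⁻ z in nullCone, (ENNReal.ofReal ((z.1 * z.2) ^ a) * ‖f z‖ₑ) ^ p ∂nullMeasure k) ^ (1 / p) := by
  have hmp := measurePreserving_nullPoint_spaceTime hn
  have hp0 : ENNReal.ofReal p ≠ 0 := by simpa using hp
  unfold weightedNorm
  rw [eLpNorm_eq_lintegral_rpow_enorm_toReal hp0 ENNReal.ofReal_ne_top, ENNReal.toReal_ofReal hp.le,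
    ← ENNReal.mul_rpow_of_nonneg _ _ (by positivity)]
  congr 1
  set H : ℝ × ℝ → ℝ≥0∞ := fun w => ‖(w.1 * w.2) ^ a * f w‖ₑ ^ p with hH
  have mH : Measurable H := by
    have m1 : Measurable fun w : ℝ × ℝ => (w.1 * w.2) ^ a * f w :=
      ((measurable_fst.mul measurable_snd).pow_const a).mul hf
    exact m1.enorm.pow_const p
  have e1 : ∫⁻ z in upperHalf n, ‖(z.1 ^ 2 - ‖z.2‖ ^ 2) ^ a * F z‖ₑ ^ p = ∫⁻ z : SpaceTime n, H (nullCoords z) := by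
    rw [← lintegral_indicator measurableSet_upperHalf]
    apply lintegral_congr_ae
    filter_upwards [h] with z hz
    have e : (nullCoords z).1 * (nullCoords z).2 = z.1 ^ 2 - ‖z.2‖ ^ 2 := by
      unfold nullCoords; simp only; ring
    simp only [hH]
    rw [← hz, e]
    by_cases hz' : z ∈ upperHalf n
    · simp only [indicator_of_mem hz']
    · simp only [indicator_of_notMem hz', mul_zero, enorm_zero, ENNReal.zero_rpow_of_pos hp]
  have mHc : Measurable fun z : SpaceTime n => H (nullCoords z) := mH.comp continuous_nullCoords.measurable
  rw [e1, ← hmp.lintegral_comp mHc]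
  have e2 : ∫⁻ z, H (nullCoords (nullPoint z)) ∂(sphereMeasure n).prod (nullMeasure k) =
      ∫⁻ z, H z.2 ∂(sphereMeasure n).prod (nullMeasure k) := by
    apply lintegral_congr_ae
    filter_upwards [ae_prod_of_ae_nullMeasure (n := n) ae_nullMeasure_lt] with z hz
    rw [show z = (z.1, z.2) from rfl, nullCoords_nullPoint z.1 hz]
  have mH2 : Measurable fun z : Metric.sphere (0 : EuclideanSpace ℝ (Fin n)) 1 × ℝ × ℝ => H z.2 :=
    mH.comp measurable_snd
  rw [e2, lintegral_prod _ mH2.aemeasurable]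
  simp only [lintegral_const]
  rw [mul_comm]
  congr 1
  rw [← lintegral_indicator measurableSet_nullCone]
  apply lintegral_congr
  intro w
  by_cases hw : f w = 0
  · simp [hH, hw, ENNReal.zero_rpow_of_pos hp, indicator]
  · have := hf0 w hw
    rw [indicator_of_mem (show w ∈ nullCone from this.1)]
    simp only [hH]
    have h2 : 0 < w.1 * w.2 := mul_pos this.1 (this.1.trans this.2)
    rw [enorm_mul, Real.enorm_of_nonneg (Real.rpow_nonneg h2.le a)]

end Profile

/-! ### The explicit radial solution and its adjoint identity -/

section RadialSolution

variable {k : ℕ} {f : ℝ × ℝ → ℝ}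

/-- The solution of the radial wave equation with source `f`, in null coordinates. -/
noncomputable def radialSolution (k : ℕ) (f : ℝ × ℝ → ℝ) (p : ℝ × ℝ) : ℝ :=
  (nullRadius p ^ k)⁻¹ * (1 / 4 * ∫ w, waveKernel k (p, w) * (nullRadius w ^ k * f w))

theorem measurable_radialSolution (hf : Measurable f) : Measurable (radialSolution k f) := by
  have m1 : Measurable fun z : (ℝ × ℝ) × ℝ × ℝ => waveKernel k z * (nullRadius z.2 ^ k * f z.2) :=
    (measurable_waveKernel k).mul (((measurable_nullRadius.pow_const k).mul hf).comp measurable_snd)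
  have m2 : Measurable fun p : ℝ × ℝ => ∫ w, waveKernel k (p, w) * (nullRadius w ^ k * f w) :=
    (m1.stronglyMeasurable.integral_prod_right (ν := volume)).measurable
  exact (measurable_nullRadius.pow_const k).inv.mul (m2.const_mul _)

theorem waveKernel_mul_eq_zero (hf : ∀ p, f p ≠ 0 → 0 < p.1 ∧ p.1 < p.2) {p w : ℝ × ℝ}
    (h : (p, w) ∉ influencePairs k) : waveKernel k (p, w) * (nullRadius w ^ k * f w) = 0 := by
  by_cases hw : f w = 0
  · rw [hw]; simp
  · obtain ⟨M, hM⟩ := exists_waveKernel_bound k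
    have := hM (p, w) (hf w hw).1
    rw [indicator_of_notMem h, mul_zero, nonpos_iff_eq_zero, enorm_eq_zero] at this
    rw [this, zero_mul]

theorem radialSolution_ne_zero (hf : ∀ p, f p ≠ 0 → 0 < p.1 ∧ p.1 < p.2) (p : ℝ × ℝ)
    (h : radialSolution k f p ≠ 0) : 0 < p.1 ∧ p.1 < p.2 := by
  by_contra hp
  apply h
  have : ∀ w, waveKernel k (p, w) * (nullRadius w ^ k * f w) = 0 := fun w =>
    waveKernel_mul_eq_zero hf fun hi => hp ⟨hi.1.trans hi.2.2.1, hi.2.2.2.1⟩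
  simp [radialSolution, this]

theorem enorm_radialSolution_le {M : ℝ≥0} (hM : ∀ z : (ℝ × ℝ) × ℝ × ℝ, 0 < z.2.1 →
    ‖waveKernel k z‖ₑ ≤ M * (influencePairs k).indicator 1 z) (hfm : Measurable f)
    (hf : ∀ p, f p ≠ 0 → 0 < p.1 ∧ p.1 < p.2) (p : ℝ × ℝ) :
    ‖radialSolution k f p‖ₑ ≤ M * conePotential k (fun w => ‖f w‖ₑ) p := by
  by_cases hp : radialSolution k f p = 0
  · rw [hp]; simp
  have hp' := (radialSolution_ne_zero hf p hp).2
  have hr : 0 < nullRadius p := by unfold nullRadius; linarith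
  unfold radialSolution conePotential
  rw [enorm_mul, enorm_inv (by positivity), Real.enorm_of_nonneg (by positivity), mul_left_comm (M : ℝ≥0∞)]
  apply mul_le_mul_right
  have m1 : Measurable fun w : ℝ × ℝ => (influencePairs k).indicator
      (fun z => ENNReal.ofReal (nullRadius z.2 ^ k)) (p, w) * ‖f w‖ₑ := by
    have := measurable_influence_integrand k hfm.enorm
    exact this.comp (f := fun w : ℝ × ℝ => (p, w)) (by fun_prop)
  rw [enorm_mul, ← lintegral_const_mul _ m1]
  have h1 : ‖(1 / 4 : ℝ)‖ₑ ≤ 1 := by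
    rw [Real.enorm_of_nonneg (by norm_num)]
    exact ENNReal.ofReal_le_one.2 (by norm_num)
  calc _ ≤ 1 * ‖∫ w, waveKernel k (p, w) * (nullRadius w ^ k * f w)‖ₑ := mul_le_mul_left h1 _
    _ ≤ ∫⁻ w, ‖waveKernel k (p, w) * (nullRadius w ^ k * f w)‖ₑ := by
        rw [one_mul]; exact enorm_integral_le_lintegral_enorm _
    _ ≤ _ := by
        apply lintegral_mono; intro w
        beta_reduce
        by_cases hw : f w = 0
        · simp [hw]
        have hw' := hf w hw
        have hrw : 0 < nullRadius w := by unfold nullRadius; linarith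
        rw [enorm_mul, enorm_mul, Real.enorm_of_nonneg (by positivity : 0 ≤ nullRadius w ^ k)]
        refine (mul_le_mul_left (hM (p, w) hw'.1) _).trans (le_of_eq ?_)
        by_cases hi : (p, w) ∈ influencePairs k
        · simp only [indicator_of_mem hi, Pi.one_apply]; ring
        · simp only [indicator_of_notMem hi]; simp

theorem integral_nullMeasure (k : ℕ) (g : ℝ × ℝ → ℝ) : ∫ p, g p ∂nullMeasure k =
    ∫ p, {p : ℝ × ℝ | p.1 < p.2}.indicator (fun p => 1 / 2 * nullRadius p ^ (2 * k) * g p) p := by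
  unfold nullMeasure
  rw [integral_withDensity_eq_integral_toReal_smul (measurable_nullDensity k)]
  · apply integral_congr_ae
    refine ae_of_all _ fun p => ?_
    by_cases hp : p ∈ {p : ℝ × ℝ | p.1 < p.2}
    · have hp' : p.1 < p.2 := hp
      have hr : 0 < nullRadius p := by unfold nullRadius; linarith
      simp only [indicator_of_mem hp, smul_eq_mul]
      rw [ENNReal.toReal_ofReal (by positivity)]
    · simp only [indicator_of_notMem hp]; simp
  · refine ae_of_all _ fun p => ?_
    by_cases hp : p ∈ {p : ℝ × ℝ | p.1 < p.2}
    · simp only [indicator_of_mem hp]; exact ENNReal.ofReal_lt_top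
    · simp only [indicator_of_notMem hp]; exact ENNReal.zero_lt_top

/-- Fubini: `radialSolution` integrates the wave kernel in its second variable against f, and `hrep`
integrates the same kernel in its first variable against B. Absolute convergence holds because B is
bounded, vanishes for v > T on the cone, and the cone potential of |f| is integrable on {v ≤ T}. -/
theorem integral_radialSolution_mul (hfm : Measurable f) (hf : ∀ p, f p ≠ 0 → 0 < p.1 ∧ p.1 < p.2)
    {A B : ℝ × ℝ → ℝ} {b T : ℝ} (hB : Measurable B) (hBb : ∀ p, |B p| ≤ b)
    (hBT : ∀ p, 0 < p.1 → T < p.2 → B p = 0)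
    (hfin : ∫⁻ z in nullCone, {z : ℝ × ℝ | z.2 ≤ T}.indicator 1 z * conePotential k (fun w => ‖f w‖ₑ) z
      ∂nullMeasure k < ⊤)
    (hrep : ∀ w : ℝ × ℝ, w.1 < w.2 → nullRadius w ^ k * A w =
      ∫ p, waveKernel k (p, w) * (nullRadius p ^ k * (1 / 4 * B p))) :
    ∫ p, radialSolution k f p * B p ∂nullMeasure k = ∫ w, f w * A w ∂nullMeasure k := by
  obtain ⟨M, hM⟩ := exists_waveKernel_bound k
  -- The factor 1/8 is the 1/2 in the density of `nullMeasure` times the 1/4 from □ = 4∂ᵤ∂ᵥ + lower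
  -- order terms.
  set Φ : ℝ × ℝ → ℝ × ℝ → ℝ := fun p w =>
    1 / 8 * (nullRadius p ^ k * B p) * (waveKernel k (p, w) * (nullRadius w ^ k * f w)) with hΦ
  have hΦm : Measurable (Function.uncurry Φ) := by
    have m1 : Measurable fun z : (ℝ × ℝ) × ℝ × ℝ => waveKernel k z * (nullRadius z.2 ^ k * f z.2) :=
      (measurable_waveKernel k).mul (((measurable_nullRadius.pow_const k).mul hfm).comp measurable_snd)
    have m2 : Measurable fun z : (ℝ × ℝ) × ℝ × ℝ => 1 / 8 * (nullRadius z.1 ^ k * B z.1) :=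
      (((measurable_nullRadius.pow_const k).mul hB).const_mul _).comp measurable_fst
    exact m2.mul m1
  have mf := measurable_influence_integrand k hfm.enorm
  have mcone := measurable_conePotential k hfm.enorm
  have mT : MeasurableSet {z : ℝ × ℝ | z.2 ≤ T} := measurableSet_le measurable_snd measurable_const
  have hΦi : Integrable (Function.uncurry Φ) (volume.prod volume) := by
    refine ⟨hΦm.aestronglyMeasurable, ?_⟩
    rw [hasFiniteIntegral_iff_enorm, lintegral_prod _ hΦm.enorm.aemeasurable]
    have hb1 : ∀ p w, ‖Φ p w‖ₑ ≤ (ENNReal.ofReal b * M) * (ENNReal.ofReal (nullRadius p ^ k) *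
        {z : ℝ × ℝ | 0 < z.1 ∧ z.1 < z.2 ∧ z.2 ≤ T}.indicator 1 p *
        ((influencePairs k).indicator (fun z => ENNReal.ofReal (nullRadius z.2 ^ k)) (p, w) * ‖f w‖ₑ)) := by
      intro p w
      by_cases hi : (p, w) ∈ influencePairs k
      swap
      · simp only [hΦ, waveKernel_mul_eq_zero hf hi]; simp
      by_cases hw : f w = 0
      · simp [hΦ, hw]
      have hp1 : p.1 < p.2 := hi.2.2.2.1
      have hp0 : 0 < p.1 := hi.1.trans hi.2.2.1
      have hw' := hf w hw
      have hrw : 0 < nullRadius w := by unfold nullRadius; linarith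
      have hrp : 0 < nullRadius p := by unfold nullRadius; linarith
      by_cases hpT : p.2 ≤ T
      swap
      · simp [hΦ, hBT p hp0 (not_le.1 hpT)]
      have h8 : ‖(1 / 8 : ℝ)‖ₑ ≤ 1 := by
        rw [Real.enorm_of_nonneg (by norm_num)]
        exact ENNReal.ofReal_le_one.2 (by norm_num)
      have hBe : ‖B p‖ₑ ≤ ENNReal.ofReal b := by
        rw [Real.enorm_eq_ofReal_abs]; exact ENNReal.ofReal_le_ofReal (hBb p)
      have hKe := hM (p, w) hw'.1
      rw [indicator_of_mem hi, Pi.one_apply, mul_one] at hKe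
      rw [indicator_of_mem (show p ∈ {z : ℝ × ℝ | 0 < z.1 ∧ z.1 < z.2 ∧ z.2 ≤ T} from ⟨hp0, hp1, hpT⟩),
        indicator_of_mem hi]
      simp only [hΦ]
      rw [enorm_mul, enorm_mul, enorm_mul, enorm_mul, enorm_mul,
        Real.enorm_of_nonneg (by positivity : 0 ≤ nullRadius w ^ k),
        Real.enorm_of_nonneg (by positivity : 0 ≤ nullRadius p ^ k), Pi.one_apply, mul_one]
      calc _ ≤ 1 * (ENNReal.ofReal (nullRadius p ^ k) * ENNReal.ofReal b) *
            (M * (ENNReal.ofReal (nullRadius w ^ k) * ‖f w‖ₑ)) :=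
            mul_le_mul' (mul_le_mul' h8 (mul_le_mul' le_rfl hBe)) (mul_le_mul' hKe le_rfl)
        _ = _ := by ring
    have hb2 : ∀ p, ∫⁻ w, ‖Φ p w‖ₑ ≤ (ENNReal.ofReal b * M) * (2 * ({p : ℝ × ℝ | p.1 < p.2}.indicator
      (fun p => ENNReal.ofReal (1 / 2 * nullRadius p ^ (2 * k))) p * nullCone.indicator (fun z =>
        {z : ℝ × ℝ | z.2 ≤ T}.indicator 1 z * conePotential k (fun w => ‖f w‖ₑ) z) p)) := by
      intro p
      have ms : Measurable fun w : ℝ × ℝ => (influencePairs k).indicator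
          (fun z => ENNReal.ofReal (nullRadius z.2 ^ k)) (p, w) * ‖f w‖ₑ :=
        mf.comp (f := fun w : ℝ × ℝ => (p, w)) (by fun_prop)
      refine (lintegral_mono (hb1 p)).trans ?_
      rw [lintegral_const_mul _ (ms.const_mul _), lintegral_const_mul _ ms]
      apply mul_le_mul_right
      by_cases hp : 0 < p.1 ∧ p.1 < p.2 ∧ p.2 ≤ T
      swap
      · rw [indicator_of_notMem (by exact hp)]; simp
      have hrp : 0 < nullRadius p := by unfold nullRadius; linarith [hp.2.1]
      rw [indicator_of_mem (show p ∈ {z : ℝ × ℝ | 0 < z.1 ∧ z.1 < z.2 ∧ z.2 ≤ T} from hp),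
        indicator_of_mem (show p ∈ {p : ℝ × ℝ | p.1 < p.2} from hp.2.1),
        indicator_of_mem (show p ∈ nullCone from hp.1),
        indicator_of_mem (show p ∈ {z : ℝ × ℝ | z.2 ≤ T} from hp.2.2)]
      unfold conePotential
      have hx0 : ENNReal.ofReal (nullRadius p ^ k) ≠ 0 := by
        simpa using pow_pos hrp k
      have e2 : 2 * ENNReal.ofReal (1 / 2 * nullRadius p ^ (2 * k)) =
          ENNReal.ofReal (nullRadius p ^ k) * ENNReal.ofReal (nullRadius p ^ k) := by
        rw [← ENNReal.ofReal_mul (by positivity), show (2 : ℝ≥0∞) = ENNReal.ofReal 2 by simp,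
          ← ENNReal.ofReal_mul (by norm_num)]
        congr 1; ring
      simp only [Pi.one_apply, mul_one, one_mul]
      rw [← mul_assoc, e2, mul_assoc, ← mul_assoc (ENNReal.ofReal (nullRadius p ^ k)) (_)⁻¹,
        ENNReal.mul_inv_cancel hx0 ENNReal.ofReal_ne_top, one_mul]
    have m3 : Measurable (nullCone.indicator (fun z =>
        {z : ℝ × ℝ | z.2 ≤ T}.indicator 1 z * conePotential k (fun w => ‖f w‖ₑ) z)) :=
      ((measurable_one.indicator mT).mul mcone).indicator measurableSet_nullCone
    refine (lintegral_mono hb2).trans_lt ?_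
    have m4 := (measurable_nullDensity k).mul m3
    rw [lintegral_const_mul _ (by exact m4.const_mul 2), lintegral_const_mul _ (by exact m4)]
    rw [← lintegral_nullMeasure k m3, lintegral_indicator measurableSet_nullCone]
    exact ENNReal.mul_lt_top (ENNReal.mul_lt_top ENNReal.ofReal_lt_top ENNReal.coe_lt_top)
      (ENNReal.mul_lt_top (by simp) hfin)
  rw [integral_nullMeasure, integral_nullMeasure]
  have e1 : ∀ p, {p : ℝ × ℝ | p.1 < p.2}.indicator (fun p => 1 / 2 * nullRadius p ^ (2 * k) *
      (radialSolution k f p * B p)) p = ∫ w, Φ p w := by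
    intro p
    by_cases hp : p.1 < p.2
    · have hrp : 0 < nullRadius p := by unfold nullRadius; linarith
      rw [indicator_of_mem (by exact hp)]
      simp only [hΦ]
      rw [integral_const_mul]
      unfold radialSolution
      field_simp
      ring
    · rw [indicator_of_notMem (by exact hp)]
      have : ∀ w, Φ p w = 0 := fun w => by
        simp only [hΦ, waveKernel_mul_eq_zero hf (fun hi : (p, w) ∈ influencePairs k => hp hi.2.2.2.1), mul_zero]
      simp [this]
  have e2 : ∀ w, {p : ℝ × ℝ | p.1 < p.2}.indicator (fun p => 1 / 2 * nullRadius p ^ (2 * k) *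
      (f p * A p)) w = ∫ p, Φ p w := by
    intro w
    by_cases hw : w.1 < w.2
    · rw [indicator_of_mem (by exact hw)]
      have : (fun p => Φ p w) = fun p => (1 / 2 * nullRadius w ^ k * f w) *
          (waveKernel k (p, w) * (nullRadius p ^ k * (1 / 4 * B p))) := by
        ext p; simp only [hΦ]; ring
      rw [this, integral_const_mul, ← hrep w hw]
      ring
    · rw [indicator_of_notMem (by exact hw)]
      have : ∀ p, Φ p w = 0 := fun p => by
        have : f w = 0 := by
          by_contra h; exact hw (hf w h).2
        simp [hΦ, this]
      simp [this]
  simp_rw [e1, e2]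
  exact integral_integral_swap hΦi

end RadialSolution

theorem lintegral_rpow_Ioc_lt_top {s T : ℝ} (hs : -1 < s) :
    ∫⁻ x in Ioc 0 T, ENNReal.ofReal (x ^ s) < ⊤ := by
  by_cases hT : 0 ≤ T
  · have h := (intervalIntegral.intervalIntegrable_rpow' (a := 0) (b := T) hs)
    rw [intervalIntegrable_iff_integrableOn_Ioc_of_le hT] at h
    exact h.lintegral_lt_top
  · rw [Ioc_eq_empty (fun h => hT h.le)]; simp

/-- On 0 < u < v ≤ T the integrand is at most ½T^{2k} times u^{αp}v^{αp}, a product of one-variable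
functions integrable at 0. -/
theorem lintegral_cone_weight_lt_top (k : ℕ) {α p T : ℝ} (hp : 0 < p) (hα : -1 < α * p) :
    ∫⁻ z in nullCone, (ENNReal.ofReal ((z.1 * z.2) ^ α) * {z : ℝ × ℝ | z.2 ≤ T}.indicator 1 z) ^ p
      ∂nullMeasure k < ⊤ := by
  have mT : MeasurableSet {z : ℝ × ℝ | z.2 ≤ T} := measurableSet_le measurable_snd measurable_const
  have m1 : Measurable fun z : ℝ × ℝ =>
      (ENNReal.ofReal ((z.1 * z.2) ^ α) * {z : ℝ × ℝ | z.2 ≤ T}.indicator 1 z) ^ p :=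
    (((measurable_fst.mul measurable_snd).pow_const α).ennreal_ofReal.mul
      (measurable_one.indicator mT)).pow_const p
  rw [← lintegral_indicator measurableSet_nullCone, lintegral_nullMeasure k (m1.indicator measurableSet_nullCone)]
  set g : ℝ → ℝ≥0∞ := (Ioc 0 T).indicator fun x => ENNReal.ofReal (x ^ (α * p)) with hg
  have mg : Measurable g := ((measurable_id.pow_const _).ennreal_ofReal).indicator measurableSet_Ioc
  have hb : ∀ z : ℝ × ℝ, {p : ℝ × ℝ | p.1 < p.2}.indicator
      (fun p => ENNReal.ofReal (1 / 2 * nullRadius p ^ (2 * k))) z * nullCone.indicator (fun z : ℝ × ℝ =>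
      (ENNReal.ofReal ((z.1 * z.2) ^ α) * {z : ℝ × ℝ | z.2 ≤ T}.indicator 1 z) ^ p) z ≤
      ENNReal.ofReal (1 / 2 * T ^ (2 * k)) * (g z.1 * g z.2) := by
    intro z
    by_cases h : 0 < z.1 ∧ z.1 < z.2 ∧ z.2 ≤ T
    · rw [indicator_of_mem (show z ∈ {p : ℝ × ℝ | p.1 < p.2} from h.2.1),
        indicator_of_mem (show z ∈ nullCone from h.1),
        indicator_of_mem (show z ∈ {z : ℝ × ℝ | z.2 ≤ T} from h.2.2), hg,
        indicator_of_mem (show z.1 ∈ Ioc 0 T from ⟨h.1, h.2.1.le.trans h.2.2⟩),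
        indicator_of_mem (show z.2 ∈ Ioc 0 T from ⟨h.1.trans h.2.1, h.2.2⟩)]
      have h2 : 0 < z.2 := h.1.trans h.2.1
      have hr : 0 ≤ nullRadius z := by unfold nullRadius; linarith
      apply mul_le_mul'
      · apply ENNReal.ofReal_le_ofReal
        have : nullRadius z ≤ T := by unfold nullRadius; linarith
        gcongr
      · rw [Pi.one_apply, mul_one, ENNReal.ofReal_rpow_of_nonneg (Real.rpow_nonneg (mul_pos h.1 h2).le _) hp.le,
          ← Real.rpow_mul (mul_pos h.1 h2).le, Real.mul_rpow h.1.le h2.le,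
          ENNReal.ofReal_mul (Real.rpow_nonneg h.1.le _)]
    · by_cases h1 : z ∈ nullCone
      · by_cases h2 : z.1 < z.2
        · have h3 : z ∉ {z : ℝ × ℝ | z.2 ≤ T} := fun h' => h ⟨h1, h2, h'⟩
          rw [indicator_of_mem h1, indicator_of_notMem h3, mul_zero, ENNReal.zero_rpow_of_pos hp, mul_zero]
          exact zero_le
        · rw [indicator_of_notMem (show z ∉ {p : ℝ × ℝ | p.1 < p.2} from h2), zero_mul]
          exact zero_le
      · rw [indicator_of_notMem h1, mul_zero]
        exact zero_le
  refine (lintegral_mono hb).trans_lt ?_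
  have mgg : Measurable fun z : ℝ × ℝ => g z.1 * g z.2 := (mg.comp measurable_fst).mul (mg.comp measurable_snd)
  rw [lintegral_const_mul _ mgg,
    Measure.volume_eq_prod, lintegral_prod_mul mg.aemeasurable mg.aemeasurable, hg,
    lintegral_indicator measurableSet_Ioc]
  have := lintegral_rpow_Ioc_lt_top (T := T) hα
  exact ENNReal.mul_lt_top ENNReal.ofReal_lt_top (ENNReal.mul_lt_top this this)

/-! ### The explicit solution on space-time and its identification with w -/

section SpaceTimeSolution

variable {n k : ℕ} {f : ℝ × ℝ → ℝ}

/-- The solution of the wave equation with radial source `f ∘ nullCoords`. -/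
noncomputable def coneSolution (n k : ℕ) (f : ℝ × ℝ → ℝ) (z : SpaceTime n) : ℝ :=
  radialSolution k f (nullCoords z)

theorem measurable_coneSolution (hf : Measurable f) : Measurable (coneSolution n k f) :=
  (measurable_radialSolution hf).comp continuous_nullCoords.measurable

/-- Every point has a neighbourhood of the form {t + |x| ≤ T}, and there the solution is dominated
by a multiple of the cone potential of |f|. -/
theorem locallyIntegrable_coneSolution (hn : n = 2 * k + 1) (hfm : Measurable f)
    (hf : ∀ p, f p ≠ 0 → 0 < p.1 ∧ p.1 < p.2)
    (hfin : ∀ T : ℝ, ∫⁻ z in nullCone, {z : ℝ × ℝ | z.2 ≤ T}.indicator 1 z *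
      conePotential k (fun w => ‖f w‖ₑ) z ∂nullMeasure k < ⊤) :
    LocallyIntegrable (coneSolution n k f) := by
  obtain ⟨M, hM⟩ := exists_waveKernel_bound k
  have hmp := measurePreserving_nullPoint_spaceTime hn
  have hT : ∀ T : ℝ, IntegrableOn (coneSolution n k f) {z | (nullCoords z).2 ≤ T} := by
    intro T
    have mT : MeasurableSet {z : ℝ × ℝ | z.2 ≤ T} := measurableSet_le measurable_snd measurable_const
    have mTz : MeasurableSet {z : SpaceTime n | (nullCoords z).2 ≤ T} :=
      mT.preimage continuous_nullCoords.measurable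
    refine ⟨(measurable_coneSolution hfm).aestronglyMeasurable, ?_⟩
    rw [hasFiniteIntegral_iff_enorm, ← lintegral_indicator mTz]
    have mcone := measurable_conePotential k hfm.enorm
    set H : ℝ × ℝ → ℝ≥0∞ := nullCone.indicator fun z => {z : ℝ × ℝ | z.2 ≤ T}.indicator 1 z *
      conePotential k (fun w => ‖f w‖ₑ) z with hH
    have mH : Measurable H := ((measurable_one.indicator mT).mul mcone).indicator measurableSet_nullCone
    have hle : ∀ z : SpaceTime n, {z : SpaceTime n | (nullCoords z).2 ≤ T}.indicator
        (fun z => ‖coneSolution n k f z‖ₑ) z ≤ M * H (nullCoords z) := by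
      intro z
      by_cases hz : (nullCoords z).2 ≤ T
      swap
      · rw [indicator_of_notMem (by exact hz)]; exact zero_le
      by_cases h0 : coneSolution n k f z = 0
      · rw [indicator_of_mem (by exact hz), h0]; simp
      have h1 := radialSolution_ne_zero hf _ h0
      rw [indicator_of_mem (by exact hz), hH, indicator_of_mem (show nullCoords z ∈ nullCone from h1.1),
        indicator_of_mem (by exact hz), Pi.one_apply, one_mul]
      exact enorm_radialSolution_le hM hfm hf _
    refine (lintegral_mono hle).trans_lt ?_
    have mHc : Measurable fun z : SpaceTime n => H (nullCoords z) := mH.comp continuous_nullCoords.measurable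
    have mH2 : Measurable fun z : Metric.sphere (0 : EuclideanSpace ℝ (Fin n)) 1 × ℝ × ℝ => H z.2 :=
      mH.comp measurable_snd
    rw [lintegral_const_mul _ mHc, ← hmp.lintegral_comp mHc]
    have e2 : ∫⁻ z, H (nullCoords (nullPoint z)) ∂(sphereMeasure n).prod (nullMeasure k) =
        ∫⁻ z, H z.2 ∂(sphereMeasure n).prod (nullMeasure k) := by
      apply lintegral_congr_ae
      filter_upwards [ae_prod_of_ae_nullMeasure (n := n) ae_nullMeasure_lt] with z hz
      rw [show z = (z.1, z.2) from rfl, nullCoords_nullPoint z.1 hz]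
    rw [e2, lintegral_prod _ mH2.aemeasurable]
    simp only [lintegral_const]
    rw [hH, lintegral_indicator measurableSet_nullCone]
    exact ENNReal.mul_lt_top ENNReal.coe_lt_top (ENNReal.mul_lt_top (hfin T) (measure_lt_top _ _))
  intro z
  refine ⟨{y | (nullCoords y).2 ≤ (nullCoords z).2 + 1}, ?_, hT _⟩
  have ho : IsOpen {y : SpaceTime n | (nullCoords y).2 < (nullCoords z).2 + 1} :=
    isOpen_lt (continuous_nullCoords.snd) continuous_const
  exact Filter.mem_of_superset (ho.mem_nhds (by simp)) fun y (hy : (nullCoords y).2 < (nullCoords z).2 + 1) => hy.le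

theorem integral_comp_nullCoords_mul (hn : n = 2 * k + 1) {W : ℝ × ℝ → ℝ} {ψ : SpaceTime n → ℝ}
    (hint : Integrable fun z => W (nullCoords z) * ψ z) :
    ∫ z, W (nullCoords z) * ψ z = ∫ p, W p * nullMean ψ p ∂nullMeasure k := by
  have hmp := measurePreserving_nullPoint_spaceTime hn
  have hae : ∀ᵐ z ∂(sphereMeasure n).prod (nullMeasure k),
      W (nullCoords (nullPoint z)) * ψ (nullPoint z) = W z.2 * ψ (nullPoint z) := by
    filter_upwards [ae_prod_of_ae_nullMeasure (n := n) ae_nullMeasure_lt] with z hz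
    rw [show z = (z.1, z.2) from rfl, nullCoords_nullPoint z.1 hz]
  have h1 : Integrable (fun z => W z.2 * ψ (nullPoint z)) ((sphereMeasure n).prod (nullMeasure k)) :=
    (hmp.integrable_comp_of_integrable hint).congr hae
  rw [← hmp.map_eq, integral_map hmp.aemeasurable (by rw [hmp.map_eq]; exact hint.aestronglyMeasurable),
    integral_congr_ae hae, integral_prod_symm _ h1]
  simp only [integral_const_mul]
  rfl

/-- The weak equation for the candidate: integration over spheres reduces both sides to spherical
means of φ and □φ, which `nullMean_representation` relates through the kernel defining the
candidate. -/
theorem integral_coneSolution_mul_dAlembertian (hn : n = 2 * k + 1) (hfm : Measurable f)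
    (hf : ∀ p, f p ≠ 0 → 0 < p.1 ∧ p.1 < p.2)
    (hfin : ∀ T : ℝ, ∫⁻ z in nullCone, {z : ℝ × ℝ | z.2 ≤ T}.indicator 1 z *
      conePotential k (fun w => ‖f w‖ₑ) z ∂nullMeasure k < ⊤)
    (hfi : LocallyIntegrable fun z : SpaceTime n => f (nullCoords z))
    {φ : SpaceTime n → ℝ} (hφ : ContDiff ℝ ∞ φ) (hc : HasCompactSupport φ) :
    ∫ z, coneSolution n k f z * dAlembertian φ z = ∫ z, f (nullCoords z) * φ z := by
  obtain ⟨R, hR⟩ : ∃ R : ℝ, ∀ z : SpaceTime n, R ≤ z.1 → φ z = 0 := by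
    obtain ⟨R, hR⟩ := hc.isCompact.isBounded.exists_norm_le
    refine ⟨R + 1, fun z hz => image_eq_zero_of_notMem_tsupport fun hz' => ?_⟩
    have := (norm_fst_le z).trans (hR _ hz')
    rw [Real.norm_eq_abs] at this
    linarith [le_abs_self z.1]
  have hbc := hφ.dAlembertian.continuous
  have hbs : HasCompactSupport (dAlembertian φ) := by
    refine HasCompactSupport.intro hc.isCompact fun z hz => ?_
    exact dAlembertian_eq_zero_of_eventuallyEq hφ (notMem_tsupport_iff_eventuallyEq.1 hz)
  have hi1 : Integrable fun z => coneSolution n k f z * dAlembertian φ z := by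
    have := (locallyIntegrable_coneSolution hn hfm hf hfin).integrable_smul_left_of_hasCompactSupport hbc hbs
    simpa [mul_comm] using this
  have hi2 : Integrable fun z => f (nullCoords z) * φ z := by
    have := hfi.integrable_smul_left_of_hasCompactSupport hφ.continuous hc
    simpa [mul_comm] using this
  have e1 := integral_comp_nullCoords_mul hn (W := radialSolution k f) hi1
  have e2 := integral_comp_nullCoords_mul hn (W := f) hi2
  rw [e2]
  refine Eq.trans e1 ?_
  obtain ⟨N, hN⟩ := hbs.exists_bound_of_continuous hbc
  refine integral_radialSolution_mul (b := N * (sphereMeasure n).real univ) (T := 2 * (R + 1)) hfm hf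
    (continuous_nullMean hbc).measurable ?_ ?_ (hfin _) ?_
  · intro p
    exact norm_integral_le_of_norm_le_const (ae_of_all _ fun θ => hN _)
  · intro p hp0 hpT
    unfold nullMean
    rw [integral_congr_ae (g := fun _ => 0)]
    · simp
    · refine ae_of_all _ fun θ => ?_
      apply dAlembertian_eq_zero_of_eventuallyEq hφ
      have ho : IsOpen {z : SpaceTime n | R < z.1} := isOpen_lt (by fun_prop) (by fun_prop)
      filter_upwards [ho.mem_nhds (show R < (nullPoint (θ, p) : SpaceTime n).1 by
        simp only [nullPoint]; linarith)] with z hz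
      exact hR z (le_of_lt hz)
  · intro w hw
    exact nullMean_representation hn hφ hR hw

/-- Extended by zero to t ≤ 0, w and the candidate solve the same weak equation on all of
space-time, because the test functions need not vanish at t = 0. Their difference is covered by
`weak_uniqueness`; in particular w is radial almost everywhere for t > 0. -/
theorem ae_eq_coneSolution (hn : n = 2 * k + 1) (hfm : Measurable f)
    (hf : ∀ p, f p ≠ 0 → 0 < p.1 ∧ p.1 < p.2)
    (hfin : ∀ T : ℝ, ∫⁻ z in nullCone, {z : ℝ × ℝ | z.2 ≤ T}.indicator 1 z *
      conePotential k (fun w => ‖f w‖ₑ) z ∂nullMeasure k < ⊤)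
    {w F : SpaceTime n → ℝ} (hw : IsWeakSolution w F)
    (hF : ∀ᵐ z, (upperHalf n).indicator F z = f (nullCoords z)) :
    ∀ᵐ z, (upperHalf n).indicator w z = coneSolution n k f z := by
  have hwi := locallyIntegrable_indicator_upperHalf hw.locallyIntegrable
  have hci := locallyIntegrable_coneSolution hn hfm hf hfin
  have hFi : LocallyIntegrable fun z : SpaceTime n => f (nullCoords z) :=
    (locallyIntegrable_indicator_upperHalf hw.locallyIntegrable_source).congr hF
  have key : ∀ᵐ z, ((upperHalf n).indicator w - coneSolution n k f) z = 0 := by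
    apply weak_uniqueness hn (hwi.sub hci)
    · intro z hz
      have h1 : (upperHalf n).indicator w z = 0 := 
        indicator_of_notMem (show z ∉ upperHalf n from not_lt.2 hz) _
      have h2 : coneSolution n k f z = 0 := by
        by_contra h
        have h3 := (radialSolution_ne_zero hf _ h).1
        unfold nullCoords at h3
        simp only at h3
        linarith [norm_nonneg z.2]
      rw [Pi.sub_apply, h1, h2, sub_zero]
    · intro φ hφ hc
      have hbc := hφ.dAlembertian.continuous
      have hbs : HasCompactSupport (dAlembertian φ) := by
        refine HasCompactSupport.intro hc.isCompact fun z hz => ?_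
        exact dAlembertian_eq_zero_of_eventuallyEq hφ (notMem_tsupport_iff_eventuallyEq.1 hz)
      have hi : ∀ {g : SpaceTime n → ℝ}, LocallyIntegrable g → Integrable fun z => g z * dAlembertian φ z := by
        intro g hg
        have := hg.integrable_smul_left_of_hasCompactSupport hbc hbs
        simpa [mul_comm] using this
      have hind : ∀ (g ψ : SpaceTime n → ℝ), ∫ z, (upperHalf n).indicator g z * ψ z =
          ∫ z in upperHalf n, g z * ψ z := by
        intro g ψ
        rw [← integral_indicator measurableSet_upperHalf]
        congr 1; ext z
        exact (indicator_mul_left _ _ _).symm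
      simp only [Pi.sub_apply, sub_mul]
      rw [integral_sub (hi hwi) (hi hci), integral_coneSolution_mul_dAlembertian hn hfm hf hfin hFi hφ hc,
        hind, hw.integral_eq φ hφ hc, ← hind, sub_eq_zero]
      apply integral_congr_ae
      filter_upwards [hF] with z hz
      rw [hz]
  filter_upwards [key] with z hz
  exact sub_eq_zero.1 hz

end SpaceTimeSolution

/-! ### The weighted estimate -/

theorem theorem1p4 (n : ℕ) (hn : Odd n) (q α β γ : ℝ) (hq : 2 < q)
    (hqn : ((n : ℝ) - 1) * q ≤ 2 * ((n : ℝ) + 1)) (hβ : β < 1 / q)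
    (hγ : γ = ((n : ℝ) - 1) * (1 / 2 - 1 / q)) (hαβγ : α + β + γ = 2 / q) :
    ∃ C : ℝ≥0, ∀ w F : SpaceTime n → ℝ, SphericallySymmetric F → SupportedInForwardCone F →
      IsWeakSolution w F →
        weightedNorm (-α) q w ≤ C * weightedNorm β (q / (q - 1)) F := by
  obtain ⟨k, hk⟩ := hn
  have hnk : (n : ℝ) = 2 * k + 1 := by exact_mod_cast hk
  have hq0 : 0 < q := by linarith
  have hq1 : 0 < q - 1 := by linarith
  -- The upper bound on q in the form equivalent to γ ≤ 2/q; it is void for n = 1.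
  have hkq : k * (q - 2) ≤ 2 := by rw [hnk] at hqn; nlinarith
  have hγ' : γ = k * (1 - 2 / q) := by rw [hγ, hnk]; ring
  obtain ⟨p, hp⟩ : ∃ p, p = q / (q - 1) := ⟨_, rfl⟩
  have hp0 : 0 < p := by rw [hp]; positivity
  -- From β < 1/q and γ ≤ 2/q one gets α > -1/q, hence αp > -1/(q-1) ≥ -1. This makes the weight on
  -- the dual side locally integrable.
  have hαp : -1 < α * p := by
    have h1 : γ ≤ 2 / q := by
      rw [hγ', le_div_iff₀ hq0]
      have : k * (1 - 2 / q) * q = k * (q - 2) := by field_simp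
      rw [this]; exact hkq
    have h2 : -(1 / q) < α := by
      have : 2 / q = 1 / q + 1 / q := by ring
      linarith
    have h3 : -(1 / q) * p < α * p := mul_lt_mul_of_pos_right h2 hp0
    have h4 : -1 ≤ -(1 / q) * p := by
      have : -(1 / q) * p = -(1 / (q - 1)) := by rw [hp]; field_simp
      rw [this, neg_le_neg_iff, div_le_one hq1]
      linarith
    linarith
  obtain ⟨C₁, hC₁⟩ := lintegral_conePotential_bilinear hq hkq hβ hγ' hαβγ hp
  obtain ⟨C₂, hC₂⟩ := lintegral_conePotential_le hq hkq hβ hγ' hαβγ hp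
  obtain ⟨M, hM⟩ := exists_waveKernel_bound k
  have : NeZero n := ⟨by omega⟩
  have := nontrivial_space (n := n)
  set s := sphereMeasure n univ with hs
  have hs0 : s ≠ 0 := fun h => Measure.toSphere_ne_zero _ (Measure.measure_univ_eq_zero.1 h)
  have hsT : s ≠ ⊤ := measure_ne_top _ _
  have hsp0 : s ^ (1 / p) ≠ 0 := by simp [hs0, hsT]
  have hspT : s ^ (1 / p) ≠ ⊤ := ENNReal.rpow_ne_top_of_nonneg (by positivity) hsT
  have hsqT : s ^ (1 / q) ≠ ⊤ := ENNReal.rpow_ne_top_of_nonneg (by positivity) hsT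
  -- The area s of the sphere enters the two norms with different exponents, M bounds the wave
  -- kernel, and C₂ is the norm of the potential.
  obtain ⟨D, hD⟩ : ∃ D : ℝ≥0, (D : ℝ≥0∞) = s ^ (1 / q) * M * C₂ * (s ^ (1 / p))⁻¹ := by
    refine ⟨ENNReal.toNNReal _, ENNReal.coe_toNNReal ?_⟩
    exact ENNReal.mul_ne_top (ENNReal.mul_ne_top (ENNReal.mul_ne_top hsqT ENNReal.coe_ne_top)
      ENNReal.coe_ne_top) (ENNReal.inv_ne_top.2 hsp0)
  -- A positive constant makes the claim trivial when the norm of F is infinite.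
  refine ⟨D + 1, fun w F hsym hcone hweak => ?_⟩
  rw [← hp]
  by_cases htop : weightedNorm β p F = ⊤
  · rw [htop, ENNReal.mul_top (by simp)]
    exact le_top
  obtain ⟨f, hfm, hf, hfF⟩ := exists_profile hk hsym hcone hweak.locallyIntegrable_source
  have eF := weightedNorm_eq hk hfm hf hfF β hp0
  set N := (∫⁻ z in nullCone, (ENNReal.ofReal ((z.1 * z.2) ^ β) * ‖f z‖ₑ) ^ p ∂nullMeasure k) ^ (1 / p) with hN
  have hNT : N ≠ ⊤ := by
    intro h
    rw [h, ENNReal.mul_top hsp0] at eF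
    exact htop eF
  -- The bilinear bound with G the indicator of {v ≤ T}: finiteness of the weighted norm of F
  -- already gives the local integrability on which the identification of w rests.
  have hfin : ∀ T : ℝ, ∫⁻ z in nullCone, {z : ℝ × ℝ | z.2 ≤ T}.indicator 1 z *
      conePotential k (fun w => ‖f w‖ₑ) z ∂nullMeasure k < ⊤ := by
    intro T
    have mT : MeasurableSet {z : ℝ × ℝ | z.2 ≤ T} := measurableSet_le measurable_snd measurable_const
    refine (hC₁ _ _ (measurable_one.indicator mT) hfm.enorm).trans_lt ?_
    exact ENNReal.mul_lt_top (ENNReal.mul_lt_top ENNReal.coe_lt_top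
      (ENNReal.rpow_lt_top_of_nonneg (by positivity) (lintegral_cone_weight_lt_top k hp0 hαp).ne)) hNT.lt_top
  have hwae := ae_eq_coneSolution hk hfm hf hfin hweak hfF
  have ew := weightedNorm_eq hk (measurable_radialSolution hfm) (radialSolution_ne_zero hf) hwae (-α) hq0
  have hbound : (∫⁻ z in nullCone, (ENNReal.ofReal ((z.1 * z.2) ^ (-α)) * ‖radialSolution k f z‖ₑ) ^ q
      ∂nullMeasure k) ^ (1 / q) ≤ M * (C₂ * N) := by
    have h1 : (∫⁻ z in nullCone, (ENNReal.ofReal ((z.1 * z.2) ^ (-α)) * ‖radialSolution k f z‖ₑ) ^ q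
        ∂nullMeasure k) ≤ (M : ℝ≥0∞) ^ q * ∫⁻ z in nullCone, (ENNReal.ofReal ((z.1 * z.2) ^ (-α)) *
          conePotential k (fun w => ‖f w‖ₑ) z) ^ q ∂nullMeasure k := by
      rw [← lintegral_const_mul' _ _ (ENNReal.rpow_ne_top_of_nonneg hq0.le ENNReal.coe_ne_top)]
      apply lintegral_mono
      intro z
      beta_reduce
      rw [← ENNReal.mul_rpow_of_nonneg _ _ hq0.le]
      apply ENNReal.rpow_le_rpow _ hq0.le
      rw [mul_left_comm]
      exact mul_le_mul_right (enorm_radialSolution_le hM hfm hf z) _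
    calc _ ≤ ((M : ℝ≥0∞) ^ q * ∫⁻ z in nullCone, (ENNReal.ofReal ((z.1 * z.2) ^ (-α)) *
          conePotential k (fun w => ‖f w‖ₑ) z) ^ q ∂nullMeasure k) ^ (1 / q) :=
          ENNReal.rpow_le_rpow h1 (by positivity)
      _ = M * (∫⁻ z in nullCone, (ENNReal.ofReal ((z.1 * z.2) ^ (-α)) *
          conePotential k (fun w => ‖f w‖ₑ) z) ^ q ∂nullMeasure k) ^ (1 / q) := by
          rw [ENNReal.mul_rpow_of_nonneg _ _ (by positivity), ← ENNReal.rpow_mul,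
            mul_one_div_cancel hq0.ne', ENNReal.rpow_one]
      _ ≤ _ := mul_le_mul_right (hC₂ _ hfm.enorm) _
  calc weightedNorm (-α) q w ≤ s ^ (1 / q) * (M * (C₂ * N)) := by
        rw [ew]; exact mul_le_mul_right hbound _
    _ = D * (s ^ (1 / p) * N) := by
        rw [hD, mul_assoc _ (s ^ (1 / p))⁻¹, ← mul_assoc (s ^ (1 / p))⁻¹, ENNReal.inv_mul_cancel hsp0 hspT]
        ring
    _ ≤ ((D + 1 : ℝ≥0) : ℝ≥0∞) * weightedNorm β p F := by
        rw [eF]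
        apply mul_le_mul_left
        exact_mod_cast le_self_add
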